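/- **Conventions.** Let $d\ge 1$. A dyadic cube is a set $2^{-k}([0,1)^d+j)$ with $k\in\mathbb Z$, $j\in\mathbb Z^d$. Throughout, $\mathcal D$ denotes a finite collection of dyadic cubes in $\mathbb R^d$. For a Banach lattice $E$ and $1<r<\infty$, $L^r_E(\mu)$ is the Lebesgue--Bochner space, $L^r_E=L^r_E(dx)$, and $r'=r/(r-1)$. The dual $E^*$ carries the order $e^*\le f^*$ iff $e^*(e)\le f^*(e)$ for all $e\ge 0$. Write $\langle f\rangle_Q=|Q|^{-1}\int_Q f\,dx$ and $$\bar M_{\mathcal D}f=\sup_{Q\in\mathcal D}\langle f\rangle_Q 1_Q\quad\text{(supremum in the lattice order)},\qquad \|\bar M\|_{L^r_E}:=\sup_{\mathcal D}\|\bar M_{\mathcal D}\|_{L^r_E\to L^r_E},$$ the last supremum being over all finite collections $\mathcal D$ of dyadic cubes. $E$ has the dyadic Hardy--Littlewood property if $\|\bar M\|_{L^r_E}<\infty$ for some $r\in(1,\infty)$. **Theorem.** Let $1<p\le q<\infty$. There is a constant $K$ depending only on $p$ and $q$ such that the following holds for all $d\ge1$. Let $\sigma,\omega$ be locally finite Borel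 measures on $\mathbb R^d$, let $C$ and $D$ be Banach lattices such that $C$ and $D^*$ have the dyadic Hardy--Littlewood property, let $\mathcal D$ be a finite collection of dyadic cubes, and let $\lambda_Q:C\to D$ ($Q\in\mathcal D$) be positive linear operators, with adjoints $\lambda_Q^*:D^*\to C^*$. Put $$T(f\sigma)=\sum_{Q\in\mathcal D}\lambda_Q\Big(\int_Q f\,d\sigma\Big)1_Q,\quad T_R(f\sigma)=\sum_{Q\in\mathcal D,\,Q\subseteq R}\lambda_Q\Big(\int_Q f\,d\sigma\Big)1_Q,\quad T_R^*(g\omega)=\sum_{Q\in\mathcal D,\,Q\subseteq R}\lambda_Q^*\Big(\int_Q g\,d\omega\Big)1_Q,$$ and let $\mathfrak T,\mathfrak T^*$ be the least constants such that, for every $R\in\mathcal D$, every $f\in L^\infty_C(R,\sigma)$ and every $g\in L^\infty_{D^*}(R,\omega)$, $$\|T_R(f\sigma)\|_{L^q_D(\omega)}\le\mathfrak T\,\|f\|_{L^\infty_C(R,\sigma)}\,\sigma(R)^{1/p},\qquad \|T^*_R(g\omega)\|_{L^{p'}_{C^*}(\sigma)}\le\mathfrak T^*\,\|g\|_{L^\infty_{D^*}(R,\omega)}\,\omega(R)^{1/q'}.$$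 Then $\|\bar M\|_{L^p_C}$ and $\|\bar M\|_{L^{q'}_{D^*}}$ are finite, and $$\max\{\mathfrak T,\mathfrak T^*\}\le\|T(\cdot\,\sigma)\|_{L^p_C(\sigma)\to L^q_D(\omega)}\le K\big(\|\bar M\|_{L^p_C}\,\mathfrak T+\|\bar M\|_{L^{q'}_{D^*}}\,\mathfrak T^*\big).$$ -/

import Mathlib

open MeasureTheory
open scoped ENNReal NNReal

noncomputable section

/-! ### The dual of a Banach lattice as a lattice -/

section Dual

variable {E : Type*} [NormedAddCommGroup E] [NormedSpace ℝ E] [Lattice E] [HasSolidNorm E]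
  [IsOrderedAddMonoid E] [IsOrderedModule ℝ E]

/-- The Riesz-Kantorovich formula for the positive part of a functional, on the positive cone. -/
def dualPosAux (h : StrongDual ℝ E) (x : E) : ℝ := sSup (h '' Set.Icc 0 x)

theorem norm_le_of_mem_Icc_zero {E : Type*} [NormedAddCommGroup E] [Lattice E] [HasSolidNorm E]
    [IsOrderedAddMonoid E] {x y : E} (hy : y ∈ Set.Icc 0 x) : ‖y‖ ≤ ‖x‖ := by
  apply HasSolidNorm.solid
  rw [abs_of_nonneg hy.1, abs_of_nonneg (hy.1.trans hy.2)]
  exact hy.2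

theorem dualPosAux_upper (h : StrongDual ℝ E) (x : E) :
    ‖h‖ * ‖x‖ ∈ upperBounds (h '' Set.Icc 0 x) := by
  rintro _ ⟨y, hy, rfl⟩
  calc h y ≤ ‖h y‖ := le_abs_self _
    _ ≤ ‖h‖ * ‖y‖ := h.le_opNorm y
    _ ≤ ‖h‖ * ‖x‖ := by gcongr; exact norm_le_of_mem_Icc_zero hy

theorem le_dualPosAux (h : StrongDual ℝ E) {x y : E} (h0 : 0 ≤ y) (hyx : y ≤ x) :
    h y ≤ dualPosAux h x :=
  le_csSup (Set.nonempty_of_mem (dualPosAux_upper h x)) (Set.mem_image_of_mem h ⟨h0, hyx⟩)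

theorem dualPosAux_le (h : StrongDual ℝ E) {x : E} (hx : 0 ≤ x) {b : ℝ}
    (hb : ∀ y, 0 ≤ y → y ≤ x → h y ≤ b) : dualPosAux h x ≤ b := by
  apply csSup_le (Set.Nonempty.image h (Set.nonempty_Icc.2 hx))
  rintro _ ⟨y, hy, rfl⟩
  exact hb y hy.1 hy.2

theorem dualPosAux_nonneg (h : StrongDual ℝ E) {x : E} (hx : 0 ≤ x) : 0 ≤ dualPosAux h x := by
  have := le_dualPosAux h (le_refl (0 : E)) hx
  simpa using this

theorem dualPosAux_bound (h : StrongDual ℝ E) {x : E} (hx : 0 ≤ x) :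
    dualPosAux h x ≤ ‖h‖ * ‖x‖ :=
  csSup_le (Set.Nonempty.image h (Set.nonempty_Icc.2 hx)) (dualPosAux_upper h x)

theorem dualPosAux_add (h : StrongDual ℝ E) {a b : E} (ha : 0 ≤ a) (hb : 0 ≤ b) :
    dualPosAux h (a + b) = dualPosAux h a + dualPosAux h b := by
  apply le_antisymm
  · apply dualPosAux_le h (add_nonneg ha hb)
    intro y h0 hy
    have h1 : h (y ⊓ a) ≤ dualPosAux h a := le_dualPosAux h (le_inf h0 ha) inf_le_right
    have h2 : h (y - y ⊓ a) ≤ dualPosAux h b := by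
      apply le_dualPosAux h (sub_nonneg.2 inf_le_left)
      rw [sub_le_iff_le_add, ← sub_le_iff_le_add']
      exact le_inf (sub_le_self _ hb) (sub_le_iff_le_add.2 hy)
    rw [map_sub] at h2
    linarith
  · rw [← le_sub_iff_add_le]
    apply dualPosAux_le h ha
    intro y h0 hy
    rw [le_sub_comm]
    apply dualPosAux_le h hb
    intro z h0' hz
    have := le_dualPosAux h (add_nonneg h0 h0') (add_le_add hy hz)
    rw [map_add] at this
    linarith

theorem dualPosAux_smul_le (h : StrongDual ℝ E) {c : ℝ} (hc : 0 < c) {a : E} (ha : 0 ≤ a) :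
    c * dualPosAux h a ≤ dualPosAux h (c • a) := by
  rw [← le_div_iff₀' hc]
  apply dualPosAux_le h ha
  intro y h0 hy
  rw [le_div_iff₀' hc]
  have := le_dualPosAux h (smul_nonneg hc.le h0) (smul_le_smul_of_nonneg_left hy hc.le)
  simpa using this

theorem dualPosAux_smul (h : StrongDual ℝ E) {c : ℝ} (hc : 0 ≤ c) {a : E} (ha : 0 ≤ a) :
    dualPosAux h (c • a) = c * dualPosAux h a := by
  rcases hc.eq_or_lt with rfl | hc
  · simp [dualPosAux]
  · apply le_antisymm _ (dualPosAux_smul_le h hc ha)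
    have := dualPosAux_smul_le h (inv_pos.2 hc) (smul_nonneg hc.le ha)
    rwa [inv_smul_smul₀ hc.ne', inv_mul_le_iff₀ hc] at this

theorem dualPosAux_sub (h : StrongDual ℝ E) {x a b : E} (ha : 0 ≤ a) (hb : 0 ≤ b)
    (hx : x = a - b) :
    dualPosAux h (x ⊔ 0) - dualPosAux h (-x ⊔ 0) = dualPosAux h a - dualPosAux h b := by
  have key : x ⊔ 0 + b = a + (-x ⊔ 0) := by
    have : (x ⊔ 0) - (-x ⊔ 0) = x := posPart_sub_negPart x
    rw [← sub_eq_sub_iff_add_eq_add, this, hx]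
  have := congrArg (dualPosAux h) key
  rw [dualPosAux_add h le_sup_right hb, dualPosAux_add h ha le_sup_right] at this
  linarith

/-- The positive part of a functional. -/
def dualPos (h : StrongDual ℝ E) : StrongDual ℝ E :=
  LinearMap.mkContinuous
    { toFun := fun x => dualPosAux h (x ⊔ 0) - dualPosAux h (-x ⊔ 0)
      map_add' := by
        intro x y
        rw [dualPosAux_sub h (a := (x ⊔ 0) + (y ⊔ 0)) (b := (-x ⊔ 0) + (-y ⊔ 0))
          (add_nonneg le_sup_right le_sup_right) (add_nonneg le_sup_right le_sup_right),
          dualPosAux_add h le_sup_right le_sup_right, dualPosAux_add h le_sup_right le_sup_right]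
        · ring
        · have h1 : (x ⊔ 0) - (-x ⊔ 0) = x := posPart_sub_negPart x
          have h2 : (y ⊔ 0) - (-y ⊔ 0) = y := posPart_sub_negPart y
          rw [add_sub_add_comm, h1, h2]
      map_smul' := by
        intro c x
        have h1 : (x ⊔ 0) - (-x ⊔ 0) = x := posPart_sub_negPart x
        rcases le_total 0 c with hc | hc
        · rw [dualPosAux_sub h (a := c • (x ⊔ 0)) (b := c • (-x ⊔ 0))
            (smul_nonneg hc le_sup_right) (smul_nonneg hc le_sup_right),
            dualPosAux_smul h hc le_sup_right, dualPosAux_smul h hc le_sup_right]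
          · simp [mul_sub]
          · rw [← smul_sub, h1]
        · have hc' : 0 ≤ -c := neg_nonneg.2 hc
          rw [dualPosAux_sub h (a := (-c) • (-x ⊔ 0)) (b := (-c) • (x ⊔ 0))
            (smul_nonneg hc' le_sup_right) (smul_nonneg hc' le_sup_right),
            dualPosAux_smul h hc' le_sup_right, dualPosAux_smul h hc' le_sup_right]
          · simp only [RingHom.id_apply, smul_eq_mul]; ring
          · rw [← smul_sub, neg_smul, ← smul_neg, neg_sub, h1] }
    (‖h‖ + ‖h‖) (by
      intro x
      have hn : ∀ z : E, ‖z ⊔ 0‖ ≤ ‖z‖ := fun z => by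
        apply HasSolidNorm.solid
        rw [abs_of_nonneg (le_sup_right : (0 : E) ≤ z ⊔ 0)]
        exact sup_le (le_abs_self z) (abs_nonneg z)
      have a1 := dualPosAux_bound h (le_sup_right : (0 : E) ≤ x ⊔ 0)
      have a2 := dualPosAux_bound h (le_sup_right : (0 : E) ≤ -x ⊔ 0)
      have b1 := dualPosAux_nonneg h (le_sup_right : (0 : E) ≤ x ⊔ 0)
      have b2 := dualPosAux_nonneg h (le_sup_right : (0 : E) ≤ -x ⊔ 0)
      have c1 : ‖h‖ * ‖x ⊔ 0‖ ≤ ‖h‖ * ‖x‖ := by gcongr; exact hn x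
      have c2 : ‖h‖ * ‖-x ⊔ 0‖ ≤ ‖h‖ * ‖x‖ := by
        gcongr; simpa using hn (-x)
      have d : 0 ≤ ‖h‖ * ‖x‖ := by positivity
      change |dualPosAux h (x ⊔ 0) - dualPosAux h (-x ⊔ 0)| ≤ _
      rw [abs_le]
      constructor <;> linarith)

theorem dualPos_apply (h : StrongDual ℝ E) {x : E} (hx : 0 ≤ x) :
    dualPos h x = dualPosAux h x := by
  change dualPosAux h (x ⊔ 0) - dualPosAux h (-x ⊔ 0) = _
  rw [dualPosAux_sub h hx le_rfl (sub_zero x).symm]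
  simp [dualPosAux]

/-- The lattice order of the dual of a Banach lattice:
`f ≤ g` if and only if `f x ≤ g x` for every `x ≥ 0`. -/
instance dualLattice : Lattice (StrongDual ℝ E) where
  le f g := ∀ x, 0 ≤ x → f x ≤ g x
  le_refl f x _ := le_rfl
  le_trans f g k h1 h2 x hx := (h1 x hx).trans (h2 x hx)
  le_antisymm f g h1 h2 := by
    have pos : ∀ x, 0 ≤ x → f x = g x := fun x hx => le_antisymm (h1 x hx) (h2 x hx)
    ext x
    have e : (x ⊔ 0) - (-x ⊔ 0) = x := posPart_sub_negPart x
    rw [← e, map_sub, map_sub, pos _ le_sup_right, pos _ le_sup_right]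
  sup f g := g + dualPos (f - g)
  le_sup_left f g x hx := by
    have := le_dualPosAux (f - g) hx le_rfl
    rw [← dualPos_apply _ hx] at this
    simp only [sub_apply, add_apply] at *
    linarith
  le_sup_right f g x hx := by
    have := dualPosAux_nonneg (f - g) hx
    rw [← dualPos_apply _ hx] at this
    simp only [add_apply]
    linarith
  sup_le f g k h1 h2 x hx := by
    have : dualPosAux (f - g) x ≤ k x - g x := by
      apply dualPosAux_le _ hx
      intro y h0 hy
      have a := h1 y h0
      have b := h2 (x - y) (sub_nonneg.2 hy)
      simp only [map_sub, sub_apply] at *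
      linarith
    rw [← dualPos_apply _ hx] at this
    simp only [add_apply]
    linarith
  inf f g := f - dualPos (f - g)
  inf_le_left f g x hx := by
    have := dualPosAux_nonneg (f - g) hx
    rw [← dualPos_apply _ hx] at this
    simp only [sub_apply]
    linarith
  inf_le_right f g x hx := by
    have := le_dualPosAux (f - g) hx le_rfl
    rw [← dualPos_apply _ hx] at this
    simp only [sub_apply] at *
    linarith
  le_inf k f g h1 h2 x hx := by
    have : dualPosAux (f - g) x ≤ f x - k x := by
      apply dualPosAux_le _ hx
      intro y h0 hy
      have a := h2 y h0
      have b := h1 (x - y) (sub_nonneg.2 hy)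
      simp only [map_sub, sub_apply] at *
      linarith
    rw [← dualPos_apply _ hx] at this
    simp only [sub_apply]
    linarith

end Dual

/-! ### Positive operators between Banach lattices and their adjoints -/

section Positive

variable {C D : Type*}
  [NormedAddCommGroup C] [NormedSpace ℝ C] [Lattice C] [HasSolidNorm C]
  [IsOrderedAddMonoid C] [IsOrderedModule ℝ C] [CompleteSpace C]
  [NormedAddCommGroup D] [NormedSpace ℝ D] [Lattice D] [HasSolidNorm D]
  [IsOrderedAddMonoid D] [IsOrderedModule ℝ D]

/-- A positive linear operator on a Banach lattice is automatically bounded. -/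
theorem exists_bound_of_positive (T : C →ₚ[ℝ] D) : ∃ K : ℝ, ∀ x, ‖T x‖ ≤ K * ‖x‖ := by
  by_contra! hcon
  choose x hx using fun n : ℕ => hcon (n * 2 ^ n)
  have hxpos : ∀ n, 0 < ‖x n‖ := fun n => by
    rw [norm_pos_iff]
    intro h0
    have := hx n
    simp [h0] at this
  let y : ℕ → C := fun n => ((2 : ℝ) ^ n * ‖x n‖)⁻¹ • |x n|
  have hy0 : ∀ n, 0 ≤ y n := fun n =>
    smul_nonneg (by positivity) (abs_nonneg _)
  have hyn : ∀ n, ‖y n‖ = (1 / 2) ^ n := fun n => by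
    have := hxpos n
    rw [norm_smul, norm_abs_eq_norm, norm_inv, Real.norm_of_nonneg (by positivity)]
    field_simp
    rw [← mul_pow]; norm_num
  have hsum : Summable y := by
    apply Summable.of_norm
    simp only [hyn]
    exact summable_geometric_two
  have hle : ∀ n, y n ≤ ∑' k, y k := fun n => hsum.le_tsum n (fun k _ => hy0 k)
  have hTy : ∀ n : ℕ, (n : ℝ) ≤ ‖T (y n)‖ := fun n => by
    have hpos := hxpos n
    have h1 : ‖T (x n)‖ ≤ ‖T |x n|‖ := by
      apply HasSolidNorm.solid
      rw [abs_of_nonneg (map_nonneg T (abs_nonneg (x n)))]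
      apply abs_le'.2
      refine ⟨OrderHomClass.mono T (le_abs_self _), ?_⟩
      rw [← map_neg]
      exact OrderHomClass.mono T (neg_le_abs _)
    have h2 : T (y n) = ((2 : ℝ) ^ n * ‖x n‖)⁻¹ • T |x n| := map_smul T _ _
    rw [h2, norm_smul, norm_inv, Real.norm_of_nonneg (by positivity), le_inv_mul_iff₀ (by positivity)]
    have := hx n
    nlinarith
  obtain ⟨n, hn⟩ := exists_nat_gt ‖T (∑' k, y k)‖
  have h3 : ‖T (y n)‖ ≤ ‖T (∑' k, y k)‖ :=
    norm_le_of_mem_Icc_zero ⟨map_nonneg T (hy0 n), OrderHomClass.mono T (hle n)⟩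
  linarith [hTy n]

/-- A positive linear operator as a bounded operator. -/
def PositiveLinearMap.toBounded (T : C →ₚ[ℝ] D) : C →L[ℝ] D :=
  ⟨T.toLinearMap, by
    obtain ⟨K, hK⟩ := exists_bound_of_positive T
    exact (T.toLinearMap.mkContinuous K hK).continuous⟩

/-- The adjoint `T* : D* → C*`, `T* d* = d* ∘ T`, of a positive operator `T : C → D`;
it is again a positive operator. -/
def PositiveLinearMap.dualAdjoint (T : C →ₚ[ℝ] D) : StrongDual ℝ D →ₚ[ℝ] StrongDual ℝ C where
  toFun g := g.comp T.toBounded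
  map_add' _ _ := rfl
  map_smul' _ _ := rfl
  monotone' _ _ h x hx := h (T x) (map_nonneg T hx)

end Positive

/-! ### Dyadic cubes, the lattice maximal operator, and positive dyadic operators -/

/-- A dyadic cube `2 ^ (-scale) • ([0, 1) ^ d + index)` of `ℝ ^ d`. -/
structure DyadicCube (d : ℕ) where
  scale : ℤ
  index : Fin d → ℤ

/-- The dyadic cube as a subset of `ℝ ^ d`. -/
def DyadicCube.toSet {d : ℕ} (Q : DyadicCube d) : Set (Fin d → ℝ) :=
  {x | ∀ i, (2 : ℝ) ^ (-Q.scale) * Q.index i ≤ x i ∧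
    x i < (2 : ℝ) ^ (-Q.scale) * (Q.index i + 1)}

section Operators

variable {d : ℕ} {E F : Type*}
  [NormedAddCommGroup E] [NormedSpace ℝ E] [Lattice E]
  [NormedAddCommGroup F] [NormedSpace ℝ F] [Lattice F]

/-- The least constant `K ∈ [0, ∞]` such that `‖T f‖_{L^q_F(ν)} ≤ K ‖f‖_{L^p_E(μ)}`
for every `f ∈ L^p_E(μ)`. -/
def operatorNorm (p q : ℝ) (μ ν : Measure (Fin d → ℝ))
    (T : ((Fin d → ℝ) → E) → ((Fin d → ℝ) → F)) : ℝ≥0∞ :=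
  sInf {K : ℝ≥0∞ | ∀ f : (Fin d → ℝ) → E, MemLp f (ENNReal.ofReal p) μ →
    eLpNorm (T f) (ENNReal.ofReal q) ν ≤ K * eLpNorm f (ENNReal.ofReal p) μ}

/-- The dyadic lattice Hardy-Littlewood maximal function `sup_{Q ∈ 𝒟} ⟨f⟩_Q 1_Q` with respect
to the Lebesgue measure, the supremum being taken in the lattice `E`
(and understood as `0` if `𝒟` is empty). -/
def latticeMaximal (𝒟 : Finset (DyadicCube d)) (f : (Fin d → ℝ) → E) (x : Fin d → ℝ) : E :=
  open Classical in
  if h : 𝒟.Nonempty then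
    𝒟.sup' h fun Q => Q.toSet.indicator (fun _ => ⨍ y in Q.toSet, f y) x
  else 0

variable (d E) in
/-- The norm of the dyadic lattice Hardy-Littlewood maximal operator on `L^p_E(ℝ ^ d, dx)`:
the supremum of the norms over all finite collections `𝒟` of dyadic cubes. -/
def latticeMaximalNorm (p : ℝ) : ℝ≥0∞ :=
  ⨆ 𝒟 : Finset (DyadicCube d),
    operatorNorm p p volume volume (latticeMaximal 𝒟 : ((Fin d → ℝ) → E) → ((Fin d → ℝ) → E))

variable (d E) in
/-- The dyadic Hardy-Littlewood property of a Banach lattice. -/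
def HasDyadicHardyLittlewood : Prop :=
  ∃ p : ℝ, 1 < p ∧ ∃ K : ℝ≥0, ∀ 𝒟 : Finset (DyadicCube d),
    operatorNorm p p volume volume
      (latticeMaximal 𝒟 : ((Fin d → ℝ) → E) → ((Fin d → ℝ) → E)) ≤ K

/-- The positive dyadic operator `T_Λ(f μ) = ∑_{Q ∈ 𝒟} Λ_Q (∫_Q f dμ) 1_Q`. -/
def dyadicOp (𝒟 : Finset (DyadicCube d)) (Λ : DyadicCube d → E →ₚ[ℝ] F)
    (μ : Measure (Fin d → ℝ)) (f : (Fin d → ℝ) → E) (x : Fin d → ℝ) : F :=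
  ∑ Q ∈ 𝒟, Q.toSet.indicator (fun _ => Λ Q (∫ y in Q.toSet, f y ∂μ)) x

/-- The localization `T_{Λ,R}(f μ) = ∑_{Q ∈ 𝒟, Q ⊆ R} Λ_Q (∫_Q f dμ) 1_Q`. -/
def localizedOp (𝒟 : Finset (DyadicCube d)) (Λ : DyadicCube d → E →ₚ[ℝ] F)
    (R : DyadicCube d) (μ : Measure (Fin d → ℝ)) :
    ((Fin d → ℝ) → E) → ((Fin d → ℝ) → F) :=
  open Classical in
  dyadicOp (𝒟.filter fun Q => Q.toSet ⊆ R.toSet) Λ μ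

/-- The `L^∞` testing constant: the least `K ∈ [0, ∞]` such that
`‖T_{Λ,R}(f μ)‖_{L^q_F(ν)} ≤ K ‖f‖_{L^∞_E(R,μ)} μ(R)^{1/p}`
for every `R ∈ 𝒟` and every `f ∈ L^∞_E(R,μ)`. -/
def testingConst (𝒟 : Finset (DyadicCube d)) (Λ : DyadicCube d → E →ₚ[ℝ] F)
    (p q : ℝ) (μ ν : Measure (Fin d → ℝ)) : ℝ≥0∞ :=
  sInf {K : ℝ≥0∞ | ∀ R ∈ 𝒟, ∀ f : (Fin d → ℝ) → E, MemLp f ∞ (μ.restrict R.toSet) →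
    eLpNorm (localizedOp 𝒟 Λ R μ f) (ENNReal.ofReal q) ν ≤
      K * eLpNorm f ∞ (μ.restrict R.toSet) * μ R.toSet ^ (1 / p)}

end Operators

end

/-!
# Two-weight testing for positive dyadic operators between Banach lattices

The operator norm is bounded from below by the testing constants because the operators are
positive: restricting the sum to the cubes inside `R` only decreases `T |f|`, and the adjoint
condition follows by duality (`eLpNorm_positiveOp_le_of_top`,
`eLpNorm_positiveOp_dualAdjoint_le_of_top`).

For the upper bound one estimates the bilinear form `∑_Q ⟨∫_Q g dω, Λ_Q ∫_Q f dσ⟩` for `f, g ≥ 0`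
by parallel stopping cubes. Below a stopping cube `F` for `f`, the norms of the lattice suprema
`sup_{R ⊇ Q} ⟨f⟩_R` are at most four times the `σ`-average over `F` of the norm of the lattice
maximal function of `f`; similarly for `g` and `ω`. Each cube `Q` has a smallest stopping cube
`π Q` above it for `f`, and `ρ Q` for `g`, one of which contains the other. Consider the cubes
with `ρ Q ⊆ π Q`. Those with `π Q = F` form an operator applied to `f` which is dominated by the
localization `T_F` applied to the bounded function `sup_{π Q = F} ⟨f⟩_Q 1_Q`, so the testing
condition applies to it. Its values are constant on the maximal stopping cubes inside `F`, so that
`‖g‖` may be replaced there by its averages, and only averages controlled by those over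
`ρ`-stopping cubes inside `F` occur. Hölder's inequality, `p ≤ q`, and the Carleson embedding
theorem for the two families of stopping cubes complete the estimate
(`IsLaminar.sum_lintegral_positiveOp_mul_le`, `IsLaminar.ofReal_sum_bilinear_le`). The remaining
cubes are treated in the same way with the adjoint operators.

The argument uses the lattice maximal operator with respect to the measures `σ` and `ω`, whereas
the constants in the theorem refer to Lebesgue measure. The transference works for all measures
and all finite families of sets which are pairwise nested or disjoint: on such a family with
finitely many atoms only the weights of the atoms matter, and any weighted finite family can be
simulated up to a factor close to one by dyadic cubes with Lebesgue measure
(`exists_isSimulation`, `maximalBound_of_lebesgue`). This costs only a factor of `4`, which keeps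
the linear dependence on the norms of the maximal operators and the independence of the dimension.

Boundedness of the maximal operator does not depend on the exponent
(`MaximalBound.exists_of_exponent`): by a stopping argument the maximal function of `f` is
pointwise dominated by a sparse operator applied to `‖f‖`. The level sets in the stopping argument
are estimated by the `L^r` bound alone, with no weak-type endpoint: a function whose averages over
the family are bounded is divided by a density, which is moved into the measure; the function
becomes bounded, and the measure of each set of the family is at most doubled.
-/

open MeasureTheory
open scoped ENNReal NNReal

set_option linter.unusedSectionVars false

noncomputable section

/-! ### Laminar families and the Carleson embedding theorem -/

theorem ENNReal.sum_biUnion_le {ι κ : Type*} [DecidableEq κ] (s : Finset ι) (t : ι → Finset κ)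
    (f : κ → ℝ≥0∞) : ∑ j ∈ s.biUnion t, f j ≤ ∑ i ∈ s, ∑ j ∈ t i, f j := by
  classical
  induction s using Finset.induction_on with
  | empty => simp
  | insert a s ha ih =>
    rw [Finset.biUnion_insert, Finset.sum_insert ha]
    calc _ ≤ ∑ j ∈ t a ∪ s.biUnion t, f j + ∑ j ∈ t a ∩ s.biUnion t, f j := le_self_add
      _ = ∑ j ∈ t a, f j + ∑ j ∈ s.biUnion t, f j := Finset.sum_union_inter
      _ ≤ _ := by gcongr

section Laminar

variable {X : Type*}

/-- A finite family of sets any two members of which are nested or disjoint. -/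
def IsLaminar (𝒟 : Finset (Set X)) : Prop :=
  ∀ A ∈ 𝒟, ∀ B ∈ 𝒟, A ⊆ B ∨ B ⊆ A ∨ Disjoint A B

theorem IsLaminar.mono {𝒟 𝒮 : Finset (Set X)} (h : IsLaminar 𝒟) (hs : 𝒮 ⊆ 𝒟) : IsLaminar 𝒮 :=
  fun A hA B hB => h A (hs hA) B (hs hB)

open Classical in
/-- The maximal members of a finite family of sets. -/
def maximalSets (𝒮 : Finset (Set X)) : Finset (Set X) := 𝒮.filter fun M => Maximal (· ∈ 𝒮) M

theorem mem_maximalSets {𝒮 : Finset (Set X)} {M : Set X} :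
    M ∈ maximalSets 𝒮 ↔ Maximal (· ∈ 𝒮) M := by
  classical
  simp only [maximalSets, Finset.mem_filter, and_iff_right_iff_imp]
  exact fun h => h.prop

theorem maximalSets_subset (𝒮 : Finset (Set X)) : maximalSets 𝒮 ⊆ 𝒮 :=
  fun _ hM => (mem_maximalSets.1 hM).prop

theorem exists_mem_maximalSets {𝒮 : Finset (Set X)} {Q : Set X} (hQ : Q ∈ 𝒮) :
    ∃ M ∈ maximalSets 𝒮, Q ⊆ M := by
  obtain ⟨M, h1, h2⟩ := 𝒮.exists_le_maximal hQ
  exact ⟨M, mem_maximalSets.2 h2, h1⟩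

theorem IsLaminar.pairwiseDisjoint_maximalSets {𝒮 : Finset (Set X)} (h : IsLaminar 𝒮) :
    (maximalSets 𝒮 : Set (Set X)).PairwiseDisjoint id := by
  intro A hA B hB hne
  have hA' := mem_maximalSets.1 (Finset.mem_coe.1 hA)
  have hB' := mem_maximalSets.1 (Finset.mem_coe.1 hB)
  rcases h A hA'.prop B hB'.prop with h1 | h1 | h1
  · exact (hne (hA'.eq_of_le hB'.prop h1)).elim
  · exact (hne (hB'.eq_of_le hA'.prop h1).symm).elim
  · exact h1

theorem biUnion_maximalSets (𝒮 : Finset (Set X)) :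
    ⋃ Q ∈ maximalSets 𝒮, Q = ⋃ Q ∈ 𝒮, Q := by
  apply Set.Subset.antisymm
  · exact Set.biUnion_subset_biUnion_left (maximalSets_subset 𝒮)
  · refine Set.iUnion₂_subset fun Q hQ => ?_
    obtain ⟨M, hM, hQM⟩ := exists_mem_maximalSets hQ
    exact hQM.trans (Set.subset_biUnion_of_mem (u := fun Q => Q) hM)

variable [MeasurableSpace X] {μ : Measure X}

/-- The weak-type inequality for averages over a laminar family. -/
theorem IsLaminar.mul_measure_biUnion_le {𝒮 : Finset (Set X)} (h : IsLaminar 𝒮)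
    (hm : ∀ Q ∈ 𝒮, MeasurableSet Q) {t : ℝ≥0∞} {u : X → ℝ≥0∞}
    (ht : ∀ Q ∈ 𝒮, t * μ Q ≤ ∫⁻ x in Q, u x ∂μ) :
    t * μ (⋃ Q ∈ 𝒮, Q) ≤ ∫⁻ x in ⋃ Q ∈ 𝒮, Q, u x ∂μ := by
  have hm' : ∀ Q ∈ maximalSets 𝒮, MeasurableSet (id Q) :=
    fun Q hQ => hm Q (maximalSets_subset _ hQ)
  rw [← biUnion_maximalSets]
  change t * μ (⋃ Q ∈ maximalSets 𝒮, id Q) ≤ ∫⁻ x in ⋃ Q ∈ maximalSets 𝒮, id Q, u x ∂μ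
  rw [lintegral_biUnion_finset h.pairwiseDisjoint_maximalSets hm',
    measure_biUnion_finset h.pairwiseDisjoint_maximalSets hm', Finset.mul_sum]
  exact Finset.sum_le_sum fun Q hQ => ht Q (maximalSets_subset _ hQ)

theorem mul_measure_le_of_lt_setLAverage {t : ℝ≥0∞} {u : X → ℝ≥0∞} {Q : Set X}
    (h : t < ⨍⁻ x in Q, u x ∂μ) : t * μ Q ≤ ∫⁻ x in Q, u x ∂μ := by
  rw [setLAverage_eq] at h
  exact ENNReal.mul_le_of_le_div h.le

theorem setLAverage_mul_measure (u : X → ℝ≥0∞) {Q : Set X} (h : μ Q ≠ ∞) :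
    (⨍⁻ x in Q, u x ∂μ) * μ Q = ∫⁻ x in Q, u x ∂μ := by
  rw [mul_comm]; exact measure_mul_setLAverage u h

/-- The layer-cake formula for a single number. -/
theorem rpow_eq_lintegral_Ioi {p : ℝ} (hp : 0 < p) {a : ℝ≥0∞} (ha : a ≠ ∞) :
    a ^ p = ENNReal.ofReal p * ∫⁻ t in Set.Ioi (0 : ℝ),
      (if ENNReal.ofReal t < a then 1 else 0) * ENNReal.ofReal (t ^ (p - 1)) := by
  have := lintegral_rpow_eq_lintegral_meas_lt_mul (Measure.dirac ()) (f := fun _ => a.toReal)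
    (Filter.Eventually.of_forall fun _ => ENNReal.toReal_nonneg) aemeasurable_const hp
  rw [lintegral_dirac, ← ENNReal.ofReal_rpow_of_nonneg ENNReal.toReal_nonneg hp.le,
    ENNReal.ofReal_toReal ha] at this
  rw [this]
  congr 1
  refine setLIntegral_congr_fun measurableSet_Ioi fun t ht => ?_
  have : ENNReal.ofReal t < a ↔ t < a.toReal :=
    ENNReal.ofReal_lt_iff_lt_toReal (le_of_lt ht) ha
  by_cases h : t < a.toReal
  · simp [this.2 h, h]
  · simp [mt this.1 h, h]

/-- The constant in the Carleson embedding theorem. -/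
def carlesonConst (p : ℝ) : ℝ≥0 := Real.toNNReal (p / (p - 1) * 2 ^ p)

/-- The level-set estimate behind the Carleson embedding theorem; only the part of `u` above `t / 2`
matters, which is what makes the strong-type inequality follow. -/
theorem IsLaminar.sum_lt_le {𝒟 : Finset (Set X)} (h : IsLaminar 𝒟)
    (hm : ∀ Q ∈ 𝒟, MeasurableSet Q) (hfin : ∀ Q ∈ 𝒟, μ Q ≠ ∞) {α : Set X → ℝ≥0∞} {C : ℝ≥0∞}
    (hα : ∀ R ∈ 𝒟, (open Classical in ∑ Q ∈ 𝒟 with Q ⊆ R, α Q) ≤ C * μ R)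
    {u : X → ℝ≥0} (hu : Measurable u) {t : ℝ≥0} :
    t * (∑ Q ∈ 𝒟, α Q * (if (t : ℝ≥0∞) < ⨍⁻ x in Q, u x ∂μ then 1 else 0)) ≤
      2 * C * ∫⁻ x in {x | t < 2 * u x}, u x ∂μ := by
  classical
  set 𝒮 := 𝒟.filter fun Q => (t : ℝ≥0∞) < ⨍⁻ x in Q, u x ∂μ with h𝒮
  have hsub : 𝒮 ⊆ 𝒟 := Finset.filter_subset _ _
  have hlev : MeasurableSet {x | t < 2 * u x} := measurableSet_lt measurable_const (by fun_prop)
  have h1 : (∑ Q ∈ 𝒟, α Q * (if (t : ℝ≥0∞) < ⨍⁻ x in Q, u x ∂μ then 1 else 0))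
      = ∑ Q ∈ 𝒮, α Q := by
    rw [h𝒮, Finset.sum_filter]
    exact Finset.sum_congr rfl fun Q _ => by split_ifs <;> simp
  have h2 : ∑ Q ∈ 𝒮, α Q ≤ ∑ M ∈ maximalSets 𝒮, C * μ M := by
    calc ∑ Q ∈ 𝒮, α Q ≤ ∑ Q ∈ (maximalSets 𝒮).biUnion fun M => 𝒟.filter (· ⊆ M), α Q := by
          apply Finset.sum_le_sum_of_subset
          intro Q hQ
          obtain ⟨M, hM, hQM⟩ := exists_mem_maximalSets hQ
          exact Finset.mem_biUnion.2 ⟨M, hM, Finset.mem_filter.2 ⟨hsub hQ, hQM⟩⟩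
      _ ≤ ∑ M ∈ maximalSets 𝒮, ∑ Q ∈ 𝒟 with Q ⊆ M, α Q := ENNReal.sum_biUnion_le _ _ _
      _ ≤ _ := Finset.sum_le_sum fun M hM => hα M (hsub (maximalSets_subset _ hM))
  have h3 : ∀ M ∈ maximalSets 𝒮, t * μ M ≤ 2 * ∫⁻ x in M ∩ {x | t < 2 * u x}, u x ∂μ := by
    intro M hM
    have hM' := maximalSets_subset _ hM
    have hMf := hfin M (hsub hM')
    have a1 := mul_measure_le_of_lt_setLAverage (Finset.mem_filter.1 hM').2
    have a2 : ∫⁻ x in M, u x ∂μ ≤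
        ∫⁻ x in M ∩ {x | t < 2 * u x}, u x ∂μ + t / 2 * μ M := by
      rw [← lintegral_inter_add_sdiff _ M hlev]
      gcongr
      calc ∫⁻ x in M \ {x | t < 2 * u x}, (u x : ℝ≥0∞) ∂μ
          ≤ ∫⁻ x in M \ {x | t < 2 * u x}, (t / 2 : ℝ≥0∞) ∂μ := by
            apply setLIntegral_mono' ((hm M (hsub hM')).diff hlev)
            intro x hx
            have : 2 * u x ≤ t := not_lt.1 hx.2
            rw [ENNReal.le_div_iff_mul_le (by simp) (by simp), mul_comm]
            exact_mod_cast this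
        _ = t / 2 * μ (M \ {x | t < 2 * u x}) := setLIntegral_const _ _
        _ ≤ t / 2 * μ M := by gcongr; exact Set.sdiff_subset
    have a3 : (t : ℝ≥0∞) * μ M = t / 2 * μ M + t / 2 * μ M := by
      rw [← add_mul, ENNReal.add_halves]
    have a4 : (t : ℝ≥0∞) / 2 * μ M ≠ ∞ :=
      ENNReal.mul_ne_top (ENNReal.div_ne_top (by simp) (by simp)) hMf
    have a5 := a1.trans a2
    rw [a3, ENNReal.add_le_add_iff_right a4] at a5
    rw [a3, two_mul]
    exact add_le_add a5 a5
  rw [h1]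
  calc t * ∑ Q ∈ 𝒮, α Q ≤ t * ∑ M ∈ maximalSets 𝒮, C * μ M := by gcongr
    _ = C * ∑ M ∈ maximalSets 𝒮, t * μ M := by
      rw [← Finset.mul_sum, ← Finset.mul_sum]; ring
    _ ≤ C * ∑ M ∈ maximalSets 𝒮, 2 * ∫⁻ x in M ∩ {x | t < 2 * u x}, u x ∂μ := by
      gcongr C * ?_
      exact Finset.sum_le_sum h3
    _ = 2 * C * ∑ M ∈ maximalSets 𝒮, ∫⁻ x in M ∩ {x | t < 2 * u x}, u x ∂μ := by
      rw [← Finset.mul_sum]; ring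
    _ ≤ 2 * C * ∫⁻ x in {x | t < 2 * u x}, u x ∂μ := by
      gcongr
      rw [← lintegral_biUnion_finset]
      · exact lintegral_mono_set (Set.iUnion₂_subset fun M _ => Set.inter_subset_right)
      · exact (h.mono hsub).pairwiseDisjoint_maximalSets.mono fun M => Set.inter_subset_left
      · exact fun M hM => (hm M (hsub (maximalSets_subset _ hM))).inter hlev

/-- The Carleson embedding theorem for a finite laminar family. -/
theorem IsLaminar.carleson_embedding {𝒟 : Finset (Set X)} (h : IsLaminar 𝒟)
    (hm : ∀ Q ∈ 𝒟, MeasurableSet Q) (hfin : ∀ Q ∈ 𝒟, μ Q ≠ ∞) {α : Set X → ℝ≥0∞} {C : ℝ≥0∞}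
    (hα : ∀ R ∈ 𝒟, (open Classical in ∑ Q ∈ 𝒟 with Q ⊆ R, α Q) ≤ C * μ R)
    {u : X → ℝ≥0} (hu : Measurable u) (hui : ∀ Q ∈ 𝒟, ⨍⁻ x in Q, u x ∂μ ≠ ∞)
    {p : ℝ} (hp : 1 < p) :
    ∑ Q ∈ 𝒟, α Q * (⨍⁻ x in Q, u x ∂μ) ^ p ≤ C * carlesonConst p * ∫⁻ x, (u x : ℝ≥0∞) ^ p ∂μ := by
  have hp0 : 0 < p := by linarith
  have hp1 : 0 < p - 1 := by linarith
  set ν := μ.withDensity fun x => (u x : ℝ≥0∞) with hν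
  -- The right-hand side as a layer-cake integral with respect to the measure `u μ`.
  have hR : ENNReal.ofReal (2 ^ (p - 1)) * ∫⁻ x, (u x : ℝ≥0∞) ^ p ∂μ = ENNReal.ofReal (p - 1) *
      ∫⁻ t in Set.Ioi (0 : ℝ), ν {x | t < 2 * (u x : ℝ)} * ENNReal.ofReal (t ^ (p - 1 - 1)) := by
    rw [← lintegral_rpow_eq_lintegral_meas_lt_mul ν (f := fun x => 2 * (u x : ℝ))
      (Filter.Eventually.of_forall fun x => by positivity) (by fun_prop) hp1, hν,
      lintegral_withDensity_eq_lintegral_mul _ (by fun_prop) (by fun_prop),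
      ← lintegral_const_mul _ (by fun_prop)]
    refine lintegral_congr fun x => ?_
    rw [Pi.mul_apply, Real.mul_rpow (by norm_num) (by positivity),
      ENNReal.ofReal_mul (by positivity), mul_left_comm]
    congr 1
    rw [← ENNReal.ofReal_rpow_of_nonneg (by positivity) hp1.le, ENNReal.ofReal_coe_nnreal]
    conv_rhs => rw [← ENNReal.rpow_one (u x : ℝ≥0∞), ← ENNReal.rpow_mul, one_mul]
    rw [← ENNReal.rpow_add_of_nonneg _ _ zero_le_one hp1.le, add_sub_cancel]
  have hL : ∑ Q ∈ 𝒟, α Q * (⨍⁻ x in Q, u x ∂μ) ^ p = ENNReal.ofReal p *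
      ∫⁻ t in Set.Ioi (0 : ℝ), (∑ Q ∈ 𝒟, α Q *
        (if ENNReal.ofReal t < ⨍⁻ x in Q, u x ∂μ then 1 else 0)) * ENNReal.ofReal (t ^ (p - 1)) := by
    have hmeas : ∀ a : ℝ≥0∞, Measurable fun t : ℝ =>
        (if ENNReal.ofReal t < a then (1 : ℝ≥0∞) else 0) := fun a =>
      Measurable.ite (measurableSet_lt (by fun_prop) measurable_const)
        measurable_const measurable_const
    simp_rw [Finset.sum_mul]
    rw [lintegral_finsetSum, Finset.mul_sum]
    · refine Finset.sum_congr rfl fun Q hQ => ?_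
      rw [rpow_eq_lintegral_Ioi hp0 (hui Q hQ), mul_left_comm]
      congr 1
      rw [← lintegral_const_mul]
      · simp_rw [mul_assoc]
      · exact (hmeas _).mul (by fun_prop)
    · intro Q _
      exact (measurable_const.mul (hmeas _)).mul (by fun_prop)
  have hstep : ∫⁻ t in Set.Ioi (0 : ℝ), (∑ Q ∈ 𝒟, α Q *
        (if ENNReal.ofReal t < ⨍⁻ x in Q, u x ∂μ then 1 else 0)) * ENNReal.ofReal (t ^ (p - 1))
      ≤ 2 * C * ∫⁻ t in Set.Ioi (0 : ℝ),
        ν {x | t < 2 * (u x : ℝ)} * ENNReal.ofReal (t ^ (p - 1 - 1)) := by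
    have hνm : Measurable fun t : ℝ => ν {x | t < 2 * (u x : ℝ)} := by
      refine Antitone.measurable fun s t hst => measure_mono fun x hx => ?_
      exact lt_of_le_of_lt hst hx
    have hνm' : Measurable fun t : ℝ =>
        ν {x | t < 2 * (u x : ℝ)} * ENNReal.ofReal (t ^ (p - 1 - 1)) := hνm.mul (by fun_prop)
    rw [← lintegral_const_mul _ hνm']
    apply setLIntegral_mono' measurableSet_Ioi
    intro t ht
    have ht0 : 0 < t := ht
    lift t to ℝ≥0 using ht0.le
    have key := h.sum_lt_le hm hfin hα hu (t := t)
    have hset : {x | (t : ℝ) < 2 * (u x : ℝ)} = {x | t < 2 * u x} := by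
      ext x; simp only [Set.mem_ofPred_eq]; exact_mod_cast Iff.rfl
    have e1 : ν {x | (t : ℝ) < 2 * (u x : ℝ)} = ∫⁻ x in {x | t < 2 * u x}, u x ∂μ := by
      rw [hset, hν, withDensity_apply]
      exact measurableSet_lt measurable_const (by fun_prop)
    have e2 : ENNReal.ofReal ((t : ℝ) ^ (p - 1)) = t * ENNReal.ofReal ((t : ℝ) ^ (p - 1 - 1)) := by
      rw [← ENNReal.ofReal_coe_nnreal, ← ENNReal.ofReal_mul (NNReal.coe_nonneg t)]
      congr 1
      nth_rw 2 [← Real.rpow_one (t : ℝ)]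
      rw [← Real.rpow_add ht0]; ring_nf
    rw [e1, e2, ENNReal.ofReal_coe_nnreal, ← mul_assoc, ← mul_assoc, mul_comm _ (t : ℝ≥0∞)]
    gcongr
  have hc : ENNReal.ofReal p * (2 * (ENNReal.ofReal (p - 1))⁻¹ * ENNReal.ofReal (2 ^ (p - 1))) =
      carlesonConst p := by
    rw [carlesonConst, ← ENNReal.ofReal_inv_of_pos hp1, ← ENNReal.ofReal_ofNat 2,
      ← ENNReal.ofReal_mul (by norm_num), ← ENNReal.ofReal_mul (by positivity),
      ← ENNReal.ofReal_mul (by positivity), ENNReal.ofReal]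
    congr 2
    rw [Real.rpow_sub_one (by norm_num)]
    field_simp
  have hp1' : ENNReal.ofReal (p - 1) ≠ 0 := by simpa using hp1
  rw [hL, ← hc]
  calc _ ≤ ENNReal.ofReal p * (2 * C * ∫⁻ t in Set.Ioi (0 : ℝ),
        ν {x | t < 2 * (u x : ℝ)} * ENNReal.ofReal (t ^ (p - 1 - 1))) := by gcongr
    _ = ENNReal.ofReal p * (2 * C * ((ENNReal.ofReal (p - 1))⁻¹ *
          (ENNReal.ofReal (2 ^ (p - 1)) * ∫⁻ x, (u x : ℝ≥0∞) ^ p ∂μ))) := by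
        rw [hR, ENNReal.inv_mul_cancel_left hp1' ENNReal.ofReal_ne_top]
    _ = _ := by ring

end Laminar

/-! ### Stopping families -/

section Stopping

/-- A stopping projection on a finite set `𝒟` for the stopping relation `s`: `π Q` is the smallest
stopping element above `Q`, where an element stops if it is maximal in `𝒟`, or if it is a maximal
element below some stopping element `F` satisfying `s F`. The fixed points are the stopping
elements. -/
structure IsStoppingProjection {α : Type*} [PartialOrder α] (𝒟 : Finset α) (s : α → α → Prop)
    (π : α → α) : Prop where
  mem : ∀ Q ∈ 𝒟, π Q ∈ 𝒟
  le : ∀ Q ∈ 𝒟, Q ≤ π Q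
  idem : ∀ Q ∈ 𝒟, π (π Q) = π Q
  mono : ∀ Q ∈ 𝒟, ∀ R ∈ 𝒟, Q ≤ R → π Q ≤ π R
  not_stop : ∀ Q ∈ 𝒟, π Q ≠ Q → ¬ s (π Q) Q
  exists_stop : ∀ F ∈ 𝒟, ∀ F' ∈ 𝒟, π F = F → π F' = F' → F' < F →
    ∃ F'' ∈ 𝒟, F' ≤ F'' ∧ F'' < F ∧ s F F''

/-- Stopping projections exist if the elements above each element form a chain. By induction,
removing a minimal element `Q₀`: its projection is that of its cover `P`, unless `s (π P) Q₀` holds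
or there is no cover, in which case `Q₀` becomes a stopping element. -/
theorem exists_isStoppingProjection {α : Type*} [PartialOrder α] (𝒟 : Finset α)
    (hchain : ∀ Q ∈ 𝒟, ∀ R ∈ 𝒟, ∀ S ∈ 𝒟, Q ≤ R → Q ≤ S → R ≤ S ∨ S ≤ R) (s : α → α → Prop) :
    ∃ π, IsStoppingProjection 𝒟 s π := by
  classical
  induction hn : 𝒟.card generalizing 𝒟 with
  | zero =>
    rw [Finset.card_eq_zero] at hn
    subst hn
    exact ⟨id, by constructor <;> simp⟩
  | succ n ih =>
    have hne : 𝒟.Nonempty := Finset.card_pos.1 (by omega)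
    obtain ⟨Q₀, hQ₀⟩ := 𝒟.exists_minimal hne
    have hmin : ∀ R ∈ 𝒟, R ≤ Q₀ → R = Q₀ := fun R hR hle => (hQ₀.eq_of_ge hR hle).symm
    have hQ₀m := hQ₀.prop
    obtain ⟨π, hπ⟩ := ih (𝒟.erase Q₀)
      (fun Q hQ R hR S hS => hchain Q (Finset.mem_of_mem_erase hQ) R (Finset.mem_of_mem_erase hR)
        S (Finset.mem_of_mem_erase hS)) (by rw [Finset.card_erase_of_mem hQ₀m]; omega)
    have hmem : ∀ Q ∈ 𝒟, Q ≠ Q₀ → Q ∈ 𝒟.erase Q₀ := fun Q hQ h => Finset.mem_erase.2 ⟨h, hQ⟩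
    have hπne : ∀ Q ∈ 𝒟, Q ≠ Q₀ → π Q ≠ Q₀ := fun Q hQ h =>
      (Finset.mem_erase.1 (hπ.mem Q (hmem Q hQ h))).1
    -- It remains to choose the value at the minimal element `Q₀`.
    obtain ⟨v, hvD, hvle, hvi, hvm, hvs, hve⟩ : ∃ v ∈ 𝒟, Q₀ ≤ v ∧ (v ≠ Q₀ → π v = v) ∧
        (∀ R ∈ 𝒟, R ≠ Q₀ → Q₀ ≤ R → v ≤ π R) ∧ (v ≠ Q₀ → ¬ s v Q₀) ∧
        (v = Q₀ → ∀ F ∈ 𝒟, F ≠ Q₀ → π F = F → Q₀ < F →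
          ∃ F'' ∈ 𝒟, Q₀ ≤ F'' ∧ F'' < F ∧ s F F'') := by
      by_cases htop : ((𝒟.erase Q₀).filter (Q₀ ≤ ·)).Nonempty
      · obtain ⟨P, hP⟩ := Finset.exists_minimal htop
        obtain ⟨hP1, hP2⟩ := Finset.mem_filter.1 hP.prop
        obtain ⟨hPne, hPD⟩ := Finset.mem_erase.1 hP1
        have hleast : ∀ R ∈ 𝒟, R ≠ Q₀ → Q₀ ≤ R → P ≤ R := by
          intro R hR hRne hle
          rcases hchain Q₀ hQ₀m P hPD R hR hP2 hle with h | h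
          · exact h
          · exact (hP.eq_of_ge (Finset.mem_filter.2 ⟨hmem R hR hRne, hle⟩) h).le
        by_cases hs : s (π P) Q₀
        · refine ⟨Q₀, hQ₀m, le_rfl, fun h => (h rfl).elim, ?_, fun h => (h rfl).elim, ?_⟩
          · exact fun R hR hRne hle => hle.trans (hπ.le R (hmem R hR hRne))
          · intro _ F hF hFne hFF hlt
            have h1 : π P ≤ F := hFF ▸ hπ.mono P hP1 F (hmem F hF hFne) (hleast F hF hFne hlt.le)
            rcases h1.eq_or_lt with h2 | h2
            · exact ⟨Q₀, hQ₀m, le_rfl, hlt, h2 ▸ hs⟩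
            · obtain ⟨F'', a, b, c, e⟩ := hπ.exists_stop F (hmem F hF hFne) (π P)
                (hπ.mem P hP1) hFF (hπ.idem P hP1) h2
              exact ⟨F'', Finset.mem_of_mem_erase a, (hP2.trans (hπ.le P hP1)).trans b, c, e⟩
        · refine ⟨π P, Finset.mem_of_mem_erase (hπ.mem P hP1), hP2.trans (hπ.le P hP1),
            fun _ => hπ.idem P hP1, ?_, fun _ => hs, fun h => (hπne P hPD hPne h).elim⟩
          exact fun R hR hRne hle => hπ.mono P hP1 R (hmem R hR hRne) (hleast R hR hRne hle)
      · rw [Finset.not_nonempty_iff_eq_empty, Finset.filter_eq_empty_iff] at htop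
        refine ⟨Q₀, hQ₀m, le_rfl, fun h => (h rfl).elim, ?_, fun h => (h rfl).elim, ?_⟩
        · exact fun R hR hRne hle => (htop (hmem R hR hRne) hle).elim
        · exact fun _ F hF hFne _ hlt => (htop (hmem F hF hFne) hlt.le).elim
    refine ⟨fun Q => if Q = Q₀ then v else π Q, ?_, ?_, ?_, ?_, ?_, ?_⟩
    · intro Q hQ
      split_ifs with h
      · exact hvD
      · exact Finset.mem_of_mem_erase (hπ.mem Q (hmem Q hQ h))
    · intro Q hQ
      split_ifs with h
      · exact h ▸ hvle
      · exact hπ.le Q (hmem Q hQ h)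
    · intro Q hQ
      split_ifs with h h1 h2
      · rfl
      · exact hvi h1
      · exact (hπne Q hQ h h2).elim
      · exact hπ.idem Q (hmem Q hQ h)
    · intro Q hQ R hR hle
      by_cases hR0 : R = Q₀
      · have : Q = Q₀ := hmin Q hQ (hR0 ▸ hle)
        simp [hR0, this]
      · rw [if_neg hR0]
        split_ifs with h
        · exact hvm R hR hR0 (h ▸ hle)
        · exact hπ.mono Q (hmem Q hQ h) R (hmem R hR hR0) hle
    · intro Q hQ
      split_ifs with h
      · subst h; exact hvs
      · exact hπ.not_stop Q (hmem Q hQ h)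
    · intro F hF F' hF' hFF hFF' hlt
      have hF0 : F ≠ Q₀ := by
        rintro rfl
        exact hlt.ne (hmin F' hF' hlt.le)
      rw [if_neg hF0] at hFF
      by_cases h : F' = Q₀
      · rw [if_pos h] at hFF'
        subst h
        exact hve hFF' F hF hF0 hFF hlt
      · rw [if_neg h] at hFF'
        obtain ⟨F'', a, b⟩ := hπ.exists_stop F (hmem F hF hF0) F' (hmem F' hF' h) hFF hFF' hlt
        exact ⟨F'', Finset.mem_of_mem_erase a, b⟩

variable {X : Type*} {𝒟 : Finset (Set X)} {s : Set X → Set X → Prop} {π : Set X → Set X}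

theorem IsLaminar.exists_isStoppingProjection (h : IsLaminar 𝒟) (hne : ∀ Q ∈ 𝒟, Q.Nonempty)
    (s : Set X → Set X → Prop) : ∃ π, IsStoppingProjection 𝒟 s π := by
  apply _root_.exists_isStoppingProjection
  intro Q hQ R hR S hS h1 h2
  rcases h R hR S hS with h3 | h3 | h3
  · exact Or.inl h3
  · exact Or.inr h3
  · obtain ⟨x, hx⟩ := hne Q hQ
    exact (Set.disjoint_left.1 h3 (h1 hx) (h2 hx)).elim

open Classical in
/-- The stopping sets of a stopping projection. -/
def stoppingSets (𝒟 : Finset (Set X)) (π : Set X → Set X) : Finset (Set X) :=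
  𝒟.filter fun F => π F = F

theorem mem_stoppingSets {F : Set X} : F ∈ stoppingSets 𝒟 π ↔ F ∈ 𝒟 ∧ π F = F := by
  simp [stoppingSets]

open Classical in
/-- The stopping sets strictly contained in `F`. -/
def stoppingBelow (𝒟 : Finset (Set X)) (π : Set X → Set X) (F : Set X) : Finset (Set X) :=
  (stoppingSets 𝒟 π).filter fun F' => F' ⊂ F

theorem mem_stoppingBelow {F F' : Set X} :
    F' ∈ stoppingBelow 𝒟 π F ↔ (F' ∈ 𝒟 ∧ π F' = F') ∧ F' ⊂ F := by
  simp [stoppingBelow, mem_stoppingSets]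

/-- The part of `F` outside all smaller stopping sets. -/
def stoppingCore (𝒟 : Finset (Set X)) (π : Set X → Set X) (F : Set X) : Set X :=
  F \ ⋃ F' ∈ stoppingBelow 𝒟 π F, F'

theorem stoppingCore_subset (F : Set X) : stoppingCore 𝒟 π F ⊆ F := Set.sdiff_subset

theorem IsLaminar.pairwiseDisjoint_stoppingCore (h : IsLaminar 𝒟) :
    (stoppingSets 𝒟 π : Set (Set X)).PairwiseDisjoint (stoppingCore 𝒟 π) := by
  have key : ∀ A ∈ stoppingSets 𝒟 π, ∀ B, A ⊂ B →
      Disjoint (stoppingCore 𝒟 π A) (stoppingCore 𝒟 π B) := by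
    intro A hA B hAB
    refine Set.disjoint_left.2 fun x hx hx' => hx'.2 ?_
    exact Set.mem_biUnion (mem_stoppingBelow.2 ⟨mem_stoppingSets.1 hA, hAB⟩) hx.1
  intro A hA B hB hne
  rw [Finset.mem_coe] at hA hB
  rcases h A (mem_stoppingSets.1 hA).1 B (mem_stoppingSets.1 hB).1 with h1 | h1 | h1
  · exact key A hA B (h1.ssubset_of_ne hne)
  · exact (key B hB A (h1.ssubset_of_ne hne.symm)).symm
  · exact h1.mono (stoppingCore_subset A) (stoppingCore_subset B)

variable [MeasurableSpace X] {μ : Measure X}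

theorem measurableSet_stoppingCore (hm : ∀ Q ∈ 𝒟, MeasurableSet Q) {F : Set X} (hF : F ∈ 𝒟) :
    MeasurableSet (stoppingCore 𝒟 π F) :=
  (hm F hF).diff (Finset.measurableSet_biUnion _ fun F' hF' =>
    hm F' (mem_stoppingBelow.1 hF').1.1)

open Classical in
/-- If in each stopping set the stopped sets fill at most half of the measure, then the stopping
sets satisfy the Carleson packing condition. -/
theorem IsStoppingProjection.sum_measure_le (hπ : IsStoppingProjection 𝒟 s π) (h : IsLaminar 𝒟)
    (hm : ∀ Q ∈ 𝒟, MeasurableSet Q) (hfin : ∀ Q ∈ 𝒟, μ Q ≠ ∞)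
    (hhalf : ∀ F ∈ 𝒟, ∃ H, μ H ≤ μ F / 2 ∧ ∀ Q ∈ 𝒟, Q ⊂ F → s F Q → Q ⊆ H) (R : Set X) :
    ∑ F ∈ stoppingSets 𝒟 π with F ⊆ R, μ F ≤ 2 * μ R := by
  have hcore : ∀ F ∈ stoppingSets 𝒟 π, μ F ≤ 2 * μ (stoppingCore 𝒟 π F) := by
    intro F hF
    obtain ⟨hFD, hFF⟩ := mem_stoppingSets.1 hF
    obtain ⟨H, hH, hsub⟩ := hhalf F hFD
    have h1 : F ⊆ stoppingCore 𝒟 π F ∪ H := by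
      intro x hx
      by_cases hx' : x ∈ ⋃ F' ∈ stoppingBelow 𝒟 π F, F'
      · right
        obtain ⟨F', hF', hxF'⟩ := Set.mem_iUnion₂.1 hx'
        obtain ⟨⟨a, b⟩, c⟩ := mem_stoppingBelow.1 hF'
        obtain ⟨F'', h1, h2, h3, h4⟩ := hπ.exists_stop F hFD F' a hFF b c
        exact hsub F'' h1 h3 h4 (h2 hxF')
      · exact Or.inl ⟨hx, hx'⟩
    have h2 : μ F / 2 + μ F / 2 ≤ μ (stoppingCore 𝒟 π F) + μ F / 2 := by
      rw [ENNReal.add_halves]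
      exact ((measure_mono h1).trans (measure_union_le _ _)).trans (by gcongr)
    rw [ENNReal.add_le_add_iff_right (ENNReal.div_ne_top (hfin F hFD) (by simp))] at h2
    rw [mul_comm]
    exact (ENNReal.div_le_iff (by simp) (by simp)).1 h2
  calc ∑ F ∈ stoppingSets 𝒟 π with F ⊆ R, μ F
      ≤ ∑ F ∈ stoppingSets 𝒟 π with F ⊆ R, 2 * μ (stoppingCore 𝒟 π F) :=
        Finset.sum_le_sum fun F hF => hcore F (Finset.mem_filter.1 hF).1
    _ = 2 * μ (⋃ F ∈ (stoppingSets 𝒟 π).filter (· ⊆ R), stoppingCore 𝒟 π F) := by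
        rw [← Finset.mul_sum, measure_biUnion_finset]
        · exact h.pairwiseDisjoint_stoppingCore.subset
            (by exact_mod_cast Finset.filter_subset _ _)
        · exact fun F hF => measurableSet_stoppingCore hm
            (mem_stoppingSets.1 (Finset.mem_filter.1 hF).1).1
    _ ≤ 2 * μ R := by
        gcongr
        exact Set.iUnion₂_subset fun F hF =>
          (stoppingCore_subset F).trans (Finset.mem_filter.1 hF).2

theorem setLAverage_lt_measure_le (u : X → ℝ≥0∞) (hu : Measurable u) {F : Set X} (hF : μ F ≠ ∞)
    (hFm : MeasurableSet F) :
    μ {x ∈ F | 4 * (⨍⁻ y in F, u y ∂μ) < u x} ≤ μ F / 4 := by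
  set m := ⨍⁻ y in F, u y ∂μ with hm
  rcases eq_or_ne m ∞ with h | h
  · simp [h]
  have hset : MeasurableSet {x | 4 * m < u x} := measurableSet_lt measurable_const hu
  have h1 : 4 * m * μ {x ∈ F | 4 * m < u x} ≤ m * μ F := by
    rw [hm, setLAverage_mul_measure u hF, ← hm]
    calc _ = ∫⁻ x in {x ∈ F | 4 * m < u x}, 4 * m ∂μ := (setLIntegral_const _ _).symm
      _ ≤ ∫⁻ x in {x ∈ F | 4 * m < u x}, u x ∂μ :=
        setLIntegral_mono' (hFm.inter hset) fun x hx => hx.2.le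
      _ ≤ _ := lintegral_mono_set fun x hx => hx.1
  rcases eq_or_ne m 0 with h0 | h0
  · have h2 : ∫⁻ x in F, u x ∂μ = 0 := by rw [← setLAverage_mul_measure u hF, ← hm, h0, zero_mul]
    rw [lintegral_eq_zero_iff hu] at h2
    have h3 : μ.restrict F {x | 4 * m < u x} = 0 := by
      refine measure_mono_null ?_ h2
      intro x hx
      exact (lt_of_le_of_lt zero_le hx).ne'
    rw [Measure.restrict_apply hset] at h3
    rw [Set.inter_comm] at h3
    change μ (F ∩ {x | 4 * m < u x}) ≤ _
    rw [h3]; exact zero_le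
  · rw [ENNReal.le_div_iff_mul_le (by simp) (by simp), mul_comm]
    refine (ENNReal.mul_le_mul_iff_right h0 h).1 ?_
    rwa [← mul_assoc, mul_comm m 4]

open Classical in
theorem IsLaminar.measure_stopped_average_le (h : IsLaminar 𝒟) (hm : ∀ Q ∈ 𝒟, MeasurableSet Q)
    (u : X → ℝ≥0∞) {F : Set X} (hF : μ F ≠ ∞) (hu : ⨍⁻ x in F, u x ∂μ ≠ ∞) :
    μ (⋃ Q ∈ 𝒟.filter fun Q => Q ⊆ F ∧ 4 * (⨍⁻ x in F, u x ∂μ) < ⨍⁻ x in Q, u x ∂μ, Q)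
      ≤ μ F / 4 := by
  set m := ⨍⁻ y in F, u y ∂μ with hmdef
  set 𝒮 := 𝒟.filter fun Q => Q ⊆ F ∧ 4 * m < ⨍⁻ x in Q, u x ∂μ with h𝒮
  have hsub : 𝒮 ⊆ 𝒟 := Finset.filter_subset _ _
  have hUF : ⋃ Q ∈ 𝒮, Q ⊆ F := Set.iUnion₂_subset fun Q hQ => (Finset.mem_filter.1 hQ).2.1
  have h1 : 4 * m * μ (⋃ Q ∈ 𝒮, Q) ≤ m * μ F := by
    refine ((h.mono hsub).mul_measure_biUnion_le (fun Q hQ => hm Q (hsub hQ)) (u := u) ?_).trans ?_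
    · exact fun Q hQ => mul_measure_le_of_lt_setLAverage (Finset.mem_filter.1 hQ).2.2
    · rw [hmdef, setLAverage_mul_measure u hF]
      exact lintegral_mono_set hUF
  rcases eq_or_ne m 0 with h0 | h0
  · -- Here `u` vanishes on `F`, so that nothing is stopped.
    have : 𝒮 = ∅ := by
      refine Finset.filter_eq_empty_iff.2 fun Q hQ hQ' => ?_
      have h2 : ∫⁻ x in F, u x ∂μ = 0 := by
        rw [← setLAverage_mul_measure u hF, ← hmdef, h0, zero_mul]
      have h3 : ∫⁻ x in Q, u x ∂μ = 0 := le_antisymm ((lintegral_mono_set hQ'.1).trans h2.le) zero_le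
      have := hQ'.2
      rw [setLAverage_eq, h3] at this
      simp at this
    simp [this]
  · rw [ENNReal.le_div_iff_mul_le (by simp) (by simp), mul_comm]
    rw [mul_comm 4 m, mul_assoc] at h1
    exact (ENNReal.mul_le_mul_iff_right h0 hu).1 h1

open Classical in
/-- The Carleson embedding theorem for stopping sets. -/
theorem IsLaminar.sum_stoppingSets_le (h : IsLaminar 𝒟)
    (hm : ∀ Q ∈ 𝒟, MeasurableSet Q) (hfin : ∀ Q ∈ 𝒟, μ Q ≠ ∞)
    (hpack : ∀ R ∈ 𝒟, ∑ F ∈ stoppingSets 𝒟 π with F ⊆ R, μ F ≤ 2 * μ R)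
    {u : X → ℝ≥0} (hu : Measurable u) (hui : ∀ Q ∈ 𝒟, ⨍⁻ x in Q, u x ∂μ ≠ ∞)
    {p : ℝ} (hp : 1 < p) :
    ∑ F ∈ stoppingSets 𝒟 π, (⨍⁻ x in F, u x ∂μ) ^ p * μ F ≤
      2 * carlesonConst p * ∫⁻ x, (u x : ℝ≥0∞) ^ p ∂μ := by
  have hsub : stoppingSets 𝒟 π ⊆ 𝒟 := Finset.filter_subset _ _
  simp_rw [mul_comm _ (μ _)]
  refine (h.mono hsub).carleson_embedding (fun Q hQ => hm Q (hsub hQ))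
    (fun Q hQ => hfin Q (hsub hQ)) (α := μ) (C := 2) ?_ hu (fun Q hQ => hui Q (hsub hQ)) hp
  exact fun R hR => hpack R (hsub hR)

end Stopping

/-! ### Order and norm of a Banach lattice and of its dual -/

section BanachLattice

variable {E : Type*} [NormedAddCommGroup E] [Lattice E] [HasSolidNorm E]
  [IsOrderedAddMonoid E]

theorem enorm_le_enorm_of_nonneg_of_le {a b : E} (h0 : 0 ≤ a) (h : a ≤ b) : ‖a‖ₑ ≤ ‖b‖ₑ := by
  rw [← ofReal_norm, ← ofReal_norm]
  exact ENNReal.ofReal_le_ofReal (norm_le_of_mem_Icc_zero ⟨h0, h⟩)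

theorem enorm_abs_eq (a : E) : ‖|a|‖ₑ = ‖a‖ₑ := by
  rw [← ofReal_norm, norm_abs_eq_norm, ofReal_norm]

/-- The supremum of finitely many elements of a lattice together with `0`. -/
def posSup {ι : Type*} (s : Finset ι) (a : ι → E) : E :=
  if h : s.Nonempty then s.sup' h a ⊔ 0 else 0

theorem posSup_nonneg {ι : Type*} (s : Finset ι) (a : ι → E) : 0 ≤ posSup s a := by
  unfold posSup; split_ifs
  · exact le_sup_right
  · exact le_rfl

theorem le_posSup {ι : Type*} {s : Finset ι} (a : ι → E) {i : ι} (hi : i ∈ s) :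
    a i ≤ posSup s a := by
  rw [posSup, dif_pos ⟨i, hi⟩]
  exact (Finset.le_sup' a hi).trans le_sup_left

theorem posSup_le {ι : Type*} {s : Finset ι} {a : ι → E} {b : E} (hb : 0 ≤ b)
    (h : ∀ i ∈ s, a i ≤ b) : posSup s a ≤ b := by
  unfold posSup; split_ifs with hs
  · exact sup_le (Finset.sup'_le hs a h) hb
  · exact hb

theorem posSup_mono {ι : Type*} {s t : Finset ι} (a : ι → E) (h : s ⊆ t) :
    posSup s a ≤ posSup t a :=
  posSup_le (posSup_nonneg _ _) fun _ hi => le_posSup a (h hi)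

end BanachLattice

section Dual

variable {E : Type*} [NormedAddCommGroup E] [NormedSpace ℝ E] [Lattice E] [HasSolidNorm E]
  [IsOrderedAddMonoid E] [IsOrderedModule ℝ E]

instance : IsOrderedAddMonoid (StrongDual ℝ E) where
  add_le_add_left f g h k x hx := by
    have := h x hx
    simp only [add_apply]
    linarith

instance : IsOrderedModule ℝ (StrongDual ℝ E) where
  smul_le_smul_of_nonneg_left c hc f g h x hx := by
    simpa using mul_le_mul_of_nonneg_left (h x hx) hc
  smul_le_smul_of_nonneg_right f hf a b hab x hx := by
    have : 0 ≤ f x := hf x hx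
    simpa using mul_le_mul_of_nonneg_right hab this

/-- The bound behind `‖|g|‖ ≤ ‖g‖`: on the positive cone `|g| y = sup g (2 z - y)` over
`0 ≤ z ≤ y`, and these arguments satisfy `|2 z - y| ≤ y`. -/
theorem dual_abs_apply_le (g : StrongDual ℝ E) {y : E} (hy : 0 ≤ y) : |g| y ≤ ‖g‖ * ‖y‖ := by
  have e : |g| y = -g y + dualPosAux (g - -g) y := by
    change (-g + dualPos (g - -g)) y = _
    rw [add_apply, dualPos_apply _ hy]
    rfl
  have h1 : dualPosAux (g - -g) y ≤ ‖g‖ * ‖y‖ + g y := by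
    apply dualPosAux_le _ hy
    intro z hz hzy
    have h2 : g (z + z - y) ≤ ‖g‖ * ‖y‖ := by
      refine (le_abs_self _).trans ((g.le_opNorm _).trans ?_)
      gcongr
      apply HasSolidNorm.solid
      rw [abs_of_nonneg hy]
      refine abs_le'.2 ⟨?_, ?_⟩
      · rw [sub_le_iff_le_add]; exact add_le_add hzy hzy
      · rw [neg_sub, sub_le_self_iff]; exact add_nonneg hz hz
    rw [map_sub, map_add] at h2
    rw [sub_apply, neg_apply]
    linarith
  linarith

theorem abs_dual_apply_le (f : StrongDual ℝ E) (x : E) : |f x| ≤ |f| |x| := by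
  have hx : |x| = x⁺ + x⁻ := (posPart_add_negPart x).symm
  have hx' : x = x⁺ - x⁻ := (posPart_sub_negPart x).symm
  have a1 := (le_abs_self f) _ (posPart_nonneg x)
  have a2 := (le_abs_self f) _ (negPart_nonneg x)
  have a3 := (neg_le_abs f) _ (posPart_nonneg x)
  have a4 := (neg_le_abs f) _ (negPart_nonneg x)
  rw [hx, map_add]
  nth_rw 1 [hx']
  rw [map_sub]
  rw [neg_apply] at a3 a4
  rw [abs_le]
  constructor <;> linarith

instance : HasSolidNorm (StrongDual ℝ E) where
  solid f g h := by
    refine f.opNorm_le_bound (norm_nonneg _) fun x => ?_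
    calc ‖f x‖ ≤ |f| |x| := abs_dual_apply_le f x
      _ ≤ |g| |x| := h _ (abs_nonneg x)
      _ ≤ ‖g‖ * ‖x‖ := by
        have := dual_abs_apply_le g (abs_nonneg x)
        rwa [norm_abs_eq_norm] at this

/-- A positive vector is normed by a positive functional, the absolute value of any norming one. -/
theorem exists_nonneg_dual_vector {y : E} (hy : 0 ≤ y) :
    ∃ φ : StrongDual ℝ E, 0 ≤ φ ∧ ‖φ‖ ≤ 1 ∧ φ y = ‖y‖ := by
  obtain ⟨φ, h1, h2⟩ := exists_dual_vector'' ℝ y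
  refine ⟨|φ|, abs_nonneg φ, by rwa [norm_abs_eq_norm], le_antisymm ?_ ?_⟩
  · exact (dual_abs_apply_le φ hy).trans (mul_le_of_le_one_left (norm_nonneg _) h1)
  · have := (le_abs_self φ) y hy
    rw [h2] at this
    simpa using this

variable {F : Type*} [NormedAddCommGroup F] [NormedSpace ℝ F] [Lattice F] [HasSolidNorm F]
  [IsOrderedAddMonoid F] [IsOrderedModule ℝ F]

theorem PositiveLinearMap.abs_map_le (T : E →ₚ[ℝ] F) (x : E) : |T x| ≤ T |x| := by
  refine abs_le'.2 ⟨OrderHomClass.mono T (le_abs_self _), ?_⟩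
  rw [← map_neg]
  exact OrderHomClass.mono T (neg_le_abs _)

end Dual

/-! ### Averages and the maximal function of a laminar family -/

section Averages

variable {X : Type*} [MeasurableSpace X] {μ : Measure X}

open Classical in
/-- A function which depends only on which of finitely many measurable sets contain the point is
strongly measurable. -/
theorem stronglyMeasurable_of_mem_pattern {β : Type*} [TopologicalSpace β] {𝒟 : Finset (Set X)}
    (hm : ∀ Q ∈ 𝒟, MeasurableSet Q) (φ : Finset (Set X) → β) :
    StronglyMeasurable fun x => φ (𝒟.filter fun Q => x ∈ Q) := by
  induction 𝒟 using Finset.induction_on generalizing φ with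
  | empty => simpa using stronglyMeasurable_const
  | insert A 𝒟 hA ih =>
    have h1 := ih (fun Q hQ => hm Q (Finset.mem_insert_of_mem hQ)) fun s => φ (insert A s)
    have h2 := ih (fun Q hQ => hm Q (Finset.mem_insert_of_mem hQ)) φ
    have h3 : StronglyMeasurable fun x => if x ∈ A then φ (insert A (𝒟.filter fun Q => x ∈ Q))
        else φ (𝒟.filter fun Q => x ∈ Q) :=
      StronglyMeasurable.ite (hm A (Finset.mem_insert_self _ _)) h1 h2
    convert h3 using 2 with x
    rw [Finset.filter_insert]
    split_ifs <;> rfl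

open Classical in
theorem exists_bound_of_mem_pattern {β : Type*} [NormedAddCommGroup β] (𝒟 : Finset (Set X))
    (φ : Finset (Set X) → β) : ∃ c : ℝ≥0, ∀ x, ‖φ (𝒟.filter fun Q => x ∈ Q)‖₊ ≤ c :=
  ⟨𝒟.powerset.sup fun s => ‖φ s‖₊, fun _ =>
    Finset.le_sup (f := fun s => ‖φ s‖₊) (Finset.mem_powerset.2 (Finset.filter_subset _ _))⟩

theorem setLAverage_rpow_mul_measure_le {p : ℝ} (hp : 1 ≤ p) {u : X → ℝ≥0∞} (hu : Measurable u)
    {Q : Set X} (hQ : μ Q ≠ ∞) :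
    (⨍⁻ x in Q, u x ∂μ) ^ p * μ Q ≤ ∫⁻ x in Q, u x ^ p ∂μ := by
  have hp0 : 0 < p := by linarith
  rcases eq_or_ne (μ Q) 0 with h0 | h0
  · simp [h0]
  have hne : NeZero (μ.restrict Q) := ⟨by rwa [Ne, Measure.restrict_eq_zero]⟩
  have hfm : IsFiniteMeasure (μ.restrict Q) :=
    ⟨by rw [Measure.restrict_apply_univ]; exact hQ.lt_top⟩
  set P := ((μ.restrict Q) Set.univ)⁻¹ • μ.restrict Q with hP
  have hPp : IsProbabilityMeasure P := by rw [hP]; infer_instance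
  have h1 : eLpNorm u 1 P ≤ eLpNorm u (ENNReal.ofReal p) P :=
    eLpNorm_le_eLpNorm_of_exponent_le (by simpa using hp) hu.aestronglyMeasurable
  rw [eLpNorm_one_eq_lintegral_enorm, eLpNorm_eq_lintegral_rpow_enorm_toReal (by simpa using hp0)
    (by simp), ENNReal.toReal_ofReal hp0.le] at h1
  simp only [enorm_eq_self] at h1
  have h2 := ENNReal.rpow_le_rpow h1 hp0.le
  rw [← ENNReal.rpow_mul, one_div, inv_mul_cancel₀ hp0.ne', ENNReal.rpow_one] at h2
  calc (⨍⁻ x in Q, u x ∂μ) ^ p * μ Q ≤ (⨍⁻ x in Q, u x ^ p ∂μ) * μ Q := by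
        gcongr; exact h2
    _ = _ := setLAverage_mul_measure _ hQ

variable {E : Type*} [NormedAddCommGroup E] [NormedSpace ℝ E]

theorem enorm_setAverage_le (f : X → E) (Q : Set X) :
    ‖⨍ y in Q, f y ∂μ‖ₑ ≤ ⨍⁻ y in Q, ‖f y‖ₑ ∂μ :=
  enorm_integral_le_lintegral_enorm f

theorem measure_toReal_smul_setAverage (f : X → E) {Q : Set X} (hQ : μ Q ≠ ∞) :
    (μ Q).toReal • ⨍ y in Q, f y ∂μ = ∫ y in Q, f y ∂μ :=
  measure_smul_setAverage f hQ

variable [Lattice E] [HasSolidNorm E] [IsOrderedAddMonoid E] [IsOrderedModule ℝ E]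

theorem setAverage_nonneg {f : X → E} (hf : 0 ≤ f) (Q : Set X) : 0 ≤ ⨍ y in Q, f y ∂μ :=
  integral_nonneg hf

theorem abs_integral_le_integral_abs {f : X → E} (hf : Integrable f μ) :
    |∫ x, f x ∂μ| ≤ ∫ x, |f x| ∂μ := by
  have hf' : Integrable (fun x => |f x|) μ :=
    ⟨hf.1.sup hf.1.neg, by
      refine hf.2.congr' (Filter.Eventually.of_forall fun x => ?_)
      rw [norm_abs_eq_norm]⟩
  refine abs_le'.2 ⟨integral_mono hf hf' fun x => le_abs_self _, ?_⟩
  rw [← integral_neg]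
  exact integral_mono hf.neg hf' fun x => neg_le_abs _

open Classical in
/-- The lattice maximal function `sup_{Q ∋ x} ⟨f⟩_Q` (at least `0`) of a finite family of sets,
with averages with respect to `μ`. -/
def maximalFn (μ : Measure X) (𝒟 : Finset (Set X)) (f : X → E) (x : X) : E :=
  posSup (𝒟.filter fun Q => x ∈ Q) fun Q => ⨍ y in Q, f y ∂μ

theorem maximalFn_nonneg (𝒟 : Finset (Set X)) (f : X → E) (x : X) : 0 ≤ maximalFn μ 𝒟 f x :=
  posSup_nonneg _ _

theorem setAverage_le_maximalFn {𝒟 : Finset (Set X)} (f : X → E) {x : X} {Q : Set X}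
    (hQ : Q ∈ 𝒟) (hx : x ∈ Q) : ⨍ y in Q, f y ∂μ ≤ maximalFn μ 𝒟 f x := by
  classical
  exact le_posSup (fun Q => ⨍ y in Q, f y ∂μ) (Finset.mem_filter.2 ⟨hQ, hx⟩)

theorem maximalFn_le {𝒟 : Finset (Set X)} {f : X → E} {x : X} {b : E} (hb : 0 ≤ b)
    (h : ∀ Q ∈ 𝒟, x ∈ Q → ⨍ y in Q, f y ∂μ ≤ b) : maximalFn μ 𝒟 f x ≤ b := by
  classical
  exact posSup_le hb fun Q hQ => h Q (Finset.mem_filter.1 hQ).1 (Finset.mem_filter.1 hQ).2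

theorem maximalFn_eq_zero_of_notMem {𝒟 : Finset (Set X)} {f : X → E} {x : X}
    (hx : x ∉ ⋃ Q ∈ 𝒟, Q) : maximalFn μ 𝒟 f x = 0 :=
  le_antisymm (maximalFn_le le_rfl fun _ hQ hxQ => (hx (Set.mem_biUnion hQ hxQ)).elim)
    (maximalFn_nonneg _ _ _)

theorem stronglyMeasurable_maximalFn {𝒟 : Finset (Set X)} (hm : ∀ Q ∈ 𝒟, MeasurableSet Q)
    (f : X → E) : StronglyMeasurable (maximalFn μ 𝒟 f) :=
  stronglyMeasurable_of_mem_pattern hm fun s => posSup s fun Q => ⨍ y in Q, f y ∂μ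

/-- The lattice maximal operators of all finite laminar families are bounded by `N` on `L^p`, for
all measures on `X` and all nonnegative functions. -/
def MaximalBound (X : Type*) [MeasurableSpace X] (E : Type*) [NormedAddCommGroup E]
    [NormedSpace ℝ E] [Lattice E] (p : ℝ) (N : ℝ≥0∞) : Prop :=
  ∀ (μ : Measure X) (𝒟 : Finset (Set X)), IsLaminar 𝒟 → (∀ Q ∈ 𝒟, MeasurableSet Q) →
    (∀ Q ∈ 𝒟, μ Q ≠ ∞) → ∀ f : X → E, StronglyMeasurable f → 0 ≤ f →
    MemLp f (ENNReal.ofReal p) μ →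
    ∫⁻ x, ‖maximalFn μ 𝒟 f x‖ₑ ^ p ∂μ ≤ N ^ p * ∫⁻ x, ‖f x‖ₑ ^ p ∂μ

theorem MemLp.integrableOn_of_measure_ne_top {f : X → E} {p : ℝ} (hp : 1 ≤ p)
    (hf : MemLp f (ENNReal.ofReal p) μ) {Q : Set X} (hQ : μ Q ≠ ∞) : IntegrableOn f Q μ := by
  have : IsFiniteMeasure (μ.restrict Q) :=
    ⟨by rw [Measure.restrict_apply_univ]; exact hQ.lt_top⟩
  exact (hf.restrict Q).integrable (by simpa using hp)

end Averages

/-! ### Dyadic cubes -/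

namespace DyadicCube

variable {d : ℕ}

theorem mem_toSet_iff {Q : DyadicCube d} {x : Fin d → ℝ} :
    x ∈ Q.toSet ↔ ∀ i, ⌊(2 : ℝ) ^ Q.scale * x i⌋ = Q.index i := by
  refine forall_congr' fun i => ?_
  have h : (0 : ℝ) < 2 ^ Q.scale := by positivity
  rw [Int.floor_eq_iff, zpow_neg, inv_mul_le_iff₀ h, lt_inv_mul_iff₀ h]

theorem toSet_eq_pi (Q : DyadicCube d) : Q.toSet = Set.univ.pi fun i =>
    Set.Ico ((2 : ℝ) ^ (-Q.scale) * Q.index i) ((2 : ℝ) ^ (-Q.scale) * (Q.index i + 1)) := by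
  ext x
  simp only [Set.mem_univ_pi, Set.mem_Ico]
  rfl

theorem measurableSet_toSet (Q : DyadicCube d) : MeasurableSet Q.toSet := by
  rw [toSet_eq_pi]
  exact MeasurableSet.univ_pi fun i => measurableSet_Ico

theorem volume_toSet (Q : DyadicCube d) :
    volume Q.toSet = ENNReal.ofReal ((2 : ℝ) ^ (-Q.scale)) ^ d := by
  rw [toSet_eq_pi, Real.volume_pi_Ico]
  simp [← mul_sub]

theorem volume_real_toSet (Q : DyadicCube d) :
    volume.real Q.toSet = ((2 : ℝ) ^ (-Q.scale)) ^ d := by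
  rw [Measure.real, volume_toSet, ENNReal.toReal_pow, ENNReal.toReal_ofReal (by positivity)]

theorem volume_toSet_ne_top (Q : DyadicCube d) : volume Q.toSet ≠ ∞ := by
  rw [volume_toSet]; exact ENNReal.pow_ne_top ENNReal.ofReal_ne_top

theorem volume_real_toSet_pos (Q : DyadicCube d) : 0 < volume.real Q.toSet := by
  rw [volume_real_toSet]; positivity

theorem measure_toSet_ne_top (Q : DyadicCube d) (μ : Measure (Fin d → ℝ))
    [IsLocallyFiniteMeasure μ] : μ Q.toSet ≠ ∞ := by
  have h : Q.toSet ⊆ Set.Icc (fun i => (2 : ℝ) ^ (-Q.scale) * Q.index i)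
      (fun i => (2 : ℝ) ^ (-Q.scale) * (Q.index i + 1)) :=
    fun x hx => ⟨fun i => (hx i).1, fun i => (hx i).2.le⟩
  exact ((measure_mono h).trans_lt isCompact_Icc.measure_lt_top).ne

theorem floor_two_zpow_mul (k : ℤ) (n : ℕ) (x : ℝ) :
    ⌊(2 : ℝ) ^ k * x⌋ = ⌊(2 : ℝ) ^ (k + n) * x⌋ / ((2 ^ n : ℕ) : ℤ) := by
  rw [← Int.floor_div_natCast]
  congr 1
  rw [zpow_add₀ (by norm_num), zpow_natCast]
  push_cast
  field_simp

theorem subset_of_mem_of_scale_le {Q R : DyadicCube d} {x : Fin d → ℝ} (hQ : x ∈ Q.toSet)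
    (hR : x ∈ R.toSet) (h : Q.scale ≤ R.scale) : R.toSet ⊆ Q.toSet := by
  obtain ⟨n, hn⟩ := Int.le.dest h
  intro y hy
  rw [mem_toSet_iff] at *
  intro i
  rw [← hQ i, floor_two_zpow_mul _ n, floor_two_zpow_mul _ n (x i), hn, hR i, hy i]

theorem subset_or_subset_or_disjoint (Q R : DyadicCube d) :
    Q.toSet ⊆ R.toSet ∨ R.toSet ⊆ Q.toSet ∨ Disjoint Q.toSet R.toSet := by
  by_cases h : Disjoint Q.toSet R.toSet
  · exact Or.inr (Or.inr h)
  · obtain ⟨x, hx, hx'⟩ := Set.not_disjoint_iff.1 h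
    rcases le_total Q.scale R.scale with h1 | h1
    · exact Or.inr (Or.inl (subset_of_mem_of_scale_le hx hx' h1))
    · exact Or.inl (subset_of_mem_of_scale_le hx' hx h1)

theorem toSet_nonempty (Q : DyadicCube d) : Q.toSet.Nonempty :=
  nonempty_of_measure_ne_zero (μ := volume) fun h => by
    have := Q.volume_real_toSet_pos
    simp [Measure.real, h] at this

theorem toSet_injective (hd : 0 < d) : Function.Injective (toSet : DyadicCube d → _) := by
  intro Q R h
  have h1 : Q.scale = R.scale := by
    have := congrArg volume.real h
    rw [volume_real_toSet, volume_real_toSet,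
      pow_left_inj₀ (by positivity) (by positivity) hd.ne'] at this
    have := zpow_right_injective₀ (by norm_num) (by norm_num) this
    omega
  obtain ⟨x, hx⟩ := Q.toSet_nonempty
  have hx' : x ∈ R.toSet := h ▸ hx
  rw [mem_toSet_iff] at hx hx'
  have h2 : Q.index = R.index := by
    funext i
    rw [← hx i, ← hx' i, h1]
  cases Q; cases R
  simp_all

/-- The subcubes of `P` of side length `2 ^ (-m)` times that of `P`. -/
def sub (P : DyadicCube d) (m : ℕ) (t : Fin d → Fin (2 ^ m)) : DyadicCube d where
  scale := P.scale + m
  index i := (2 ^ m : ℕ) * P.index i + (t i : ℕ)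

theorem sub_subset (P : DyadicCube d) (m : ℕ) (t : Fin d → Fin (2 ^ m)) :
    (P.sub m t).toSet ⊆ P.toSet := by
  intro x hx
  rw [mem_toSet_iff] at *
  intro i
  rw [floor_two_zpow_mul _ m]
  have := hx i
  simp only [sub] at this
  rw [this, Int.add_comm, Int.add_mul_ediv_left _ _ (by positivity),
    Int.ediv_eq_zero_of_lt (by positivity) (by exact_mod_cast (t i).2), zero_add]

theorem disjoint_sub (P : DyadicCube d) (m : ℕ) {t t' : Fin d → Fin (2 ^ m)} (h : t ≠ t') :
    Disjoint (P.sub m t).toSet (P.sub m t').toSet := by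
  refine Set.disjoint_left.2 fun x hx hx' => h ?_
  rw [mem_toSet_iff] at *
  funext i
  have h1 := (hx i).symm.trans (hx' i)
  simp only [sub] at h1
  exact Fin.ext (by omega)

theorem volume_real_sub (P : DyadicCube d) (m : ℕ) (t : Fin d → Fin (2 ^ m)) :
    ((2 : ℝ) ^ m) ^ d * volume.real (P.sub m t).toSet = volume.real P.toSet := by
  rw [volume_real_toSet, volume_real_toSet, ← mul_pow, sub]
  congr 1
  rw [neg_add, zpow_add₀ (by norm_num), zpow_neg _ (m : ℤ), zpow_natCast]
  field_simp

end DyadicCube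

/-! ### Simulation of weighted finite families by dyadic cubes -/

section Simulation

variable {d : ℕ} {ι : Type*}

/-- An approximate copy, inside the dyadic cube `P` with Lebesgue measure, of the finite set `A`
with the weights `w` and with the family `𝒜` of subsets: the point `i` is represented by the set
`L i`, and each `B ∈ 𝒜` by dyadic cubes `Q` of the finite set `𝒟` such that the proportion of `L j`
in `Q` is almost that of `j` in `B`. The number `c < 1` is the precision. -/
structure IsSimulation (w : ι → ℝ) (A : Finset ι) (𝒜 : Finset (Finset ι)) (c : ℝ)
    (P : DyadicCube d) (L : ι → Set (Fin d → ℝ)) (𝒟 : Finset (DyadicCube d)) : Prop where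
  meas : ∀ i ∈ A, MeasurableSet (L i)
  subset : ∀ i ∈ A, L i ⊆ P.toSet
  disj : (A : Set ι).PairwiseDisjoint L
  lower : ∀ i ∈ A, c * (w i / ∑ j ∈ A, w j) * volume.real P.toSet ≤ volume.real (L i)
  upper : ∀ i ∈ A, volume.real (L i) ≤ w i / (∑ j ∈ A, w j) * volume.real P.toSet
  avg : ∀ B ∈ 𝒜, ∀ i ∈ B, ∀ x ∈ L i, ∃ Q ∈ 𝒟, x ∈ Q.toSet ∧
    ∀ j ∈ B, c * (w j / ∑ j ∈ B, w j) * volume.real Q.toSet ≤ volume.real (L j ∩ Q.toSet)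

/-- A set with at least two points is split into two parts compatible with a laminar family. -/
theorem exists_laminar_split [DecidableEq ι] {A : Finset ι} (hA : 1 < A.card)
    {𝒜 : Finset (Finset ι)} (hlam : ∀ B ∈ 𝒜, ∀ B' ∈ 𝒜, B ⊆ B' ∨ B' ⊆ B ∨ Disjoint B B')
    (hsub : ∀ B ∈ 𝒜, B ⊆ A ∧ B.Nonempty) :
    ∃ B, B.Nonempty ∧ B ⊂ A ∧ ∀ B' ∈ 𝒜, B' = A ∨ B' ⊆ B ∨ B' ⊆ A \ B := by
  by_cases h : (𝒜.erase A).Nonempty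
  · obtain ⟨B, hB⟩ := Finset.exists_maximal h
    obtain ⟨hBA, hB𝒜⟩ := Finset.mem_erase.1 hB.prop
    refine ⟨B, (hsub B hB𝒜).2, (hsub B hB𝒜).1.ssubset_of_ne hBA, fun B' hB' => ?_⟩
    by_cases h1 : B' = A
    · exact Or.inl h1
    rcases hlam B hB𝒜 B' hB' with h2 | h2 | h2
    · exact Or.inr (Or.inl (hB.eq_of_le (Finset.mem_erase.2 ⟨h1, hB'⟩) h2).ge)
    · exact Or.inr (Or.inl h2)
    · exact Or.inr (Or.inr (Finset.subset_sdiff.2 ⟨(hsub B' hB').1, h2.symm⟩))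
  · obtain ⟨a, ha⟩ := Finset.card_pos.1 (by omega : 0 < A.card)
    refine ⟨{a}, Finset.singleton_nonempty a, ?_, fun B' hB' => Or.inl ?_⟩
    · refine (Finset.singleton_subset_iff.2 ha).ssubset_of_ne ?_
      rintro rfl
      simp at hA
    · by_contra h1
      exact h ⟨B', Finset.mem_erase.2 ⟨h1, hB'⟩⟩

/-- Simulations exist, by induction on `A`: if `A` splits into two parts, then `P` is divided into
fine subcubes, which are distributed among the two parts in proportion to their weights, and each
subcube carries a simulation of its part. -/
theorem exists_isSimulation (hd : 0 < d) (w : ι → ℝ) (hw : ∀ i, 0 < w i) (A : Finset ι)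
    (hA : A.Nonempty) (𝒜 : Finset (Finset ι))
    (hlam : ∀ B ∈ 𝒜, ∀ B' ∈ 𝒜, B ⊆ B' ∨ B' ⊆ B ∨ Disjoint B B')
    (hsub : ∀ B ∈ 𝒜, B ⊆ A ∧ B.Nonempty) (c : ℝ) (hc0 : 0 < c) (hc1 : c < 1)
    (P : DyadicCube d) : ∃ L 𝒟, IsSimulation w A 𝒜 c P L 𝒟 := by
  classical
  induction A using Finset.strongInduction generalizing 𝒜 c P with
  | H A ih =>
  have hvP := P.volume_real_toSet_pos
  rcases (Nat.succ_le_of_lt (Finset.card_pos.2 hA)).eq_or_lt with hcard | hcard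
  · -- A single point is represented by the whole cube.
    obtain ⟨a, rfl⟩ := Finset.card_eq_one.1 hcard.symm
    have hwa := (hw a).ne'
    refine ⟨fun _ => P.toSet, {P}, fun _ _ => P.measurableSet_toSet, fun _ _ => subset_rfl,
      by simp, ?_, ?_, ?_⟩
    · intro i hi
      rw [Finset.mem_singleton.1 hi, Finset.sum_singleton, div_self hwa, mul_one]
      nlinarith
    · intro i hi
      rw [Finset.mem_singleton.1 hi, Finset.sum_singleton, div_self hwa, one_mul]
    · intro B hB i _ x hx
      refine ⟨P, Finset.mem_singleton_self P, hx, fun j hj => ?_⟩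
      have hBa : B = {a} :=
        (Finset.Nonempty.subset_singleton_iff (hsub B hB).2).1 (hsub B hB).1
      subst hBa
      rw [Finset.mem_singleton.1 hj, Finset.sum_singleton, div_self hwa, mul_one, Set.inter_self]
      nlinarith
  obtain ⟨B, hBne, hBA, hsplit⟩ := exists_laminar_split hcard hlam hsub
  set part : Bool → Finset ι := fun b => if b then B else A \ B with hpart
  have hpartne : ∀ b, (part b).Nonempty := by
    rintro (_ | _)
    · exact Finset.sdiff_nonempty.2 hBA.2
    · simpa [hpart] using hBne
  have hpartA : ∀ b, part b ⊂ A := by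
    rintro (_ | _)
    · simpa [hpart] using Finset.sdiff_ssubset hBA.1 hBne
    · simpa [hpart] using hBA
  set side : ι → Bool := fun i => decide (i ∈ B) with hside
  have hmem_side : ∀ i ∈ A, i ∈ part (side i) := by
    intro i hi
    by_cases h : i ∈ B <;> simp [hpart, hside, h, hi]
  have hside_eq : ∀ b, ∀ i ∈ part b, side i = b := by
    rintro (_ | _) i hi <;> simp [hpart] at hi <;> simp [hside, hi]
  set W : Finset ι → ℝ := fun S => ∑ j ∈ S, w j with hW
  have hWpos : ∀ S : Finset ι, S.Nonempty → 0 < W S := fun S hS =>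
    Finset.sum_pos (fun i _ => hw i) hS
  have hWsum : W (part true) + W (part false) = W A := by
    simp only [hW, hpart, if_true, Bool.false_eq_true, if_false]
    rw [add_comm]
    exact Finset.sum_sdiff hBA.1
  have hWA := hWpos A hA
  set θ : Bool → ℝ := fun b => W (part b) / W A with hθ
  have hθpos : ∀ b, 0 < θ b := fun b => div_pos (hWpos _ (hpartne b)) hWA
  have hθsum : θ true + θ false = 1 := by
    simp only [hθ]
    rw [← add_div, hWsum, div_self hWA.ne']
  -- The precision is lost in two steps, each time by the factor `√c`.
  set e := Real.sqrt c with he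
  have he0 : 0 < e := Real.sqrt_pos.2 hc0
  have he1 : e < 1 := by rw [he, Real.sqrt_lt' one_pos]; simpa using hc1
  have hee : e * e = c := Real.mul_self_sqrt hc0.le
  have hce : c ≤ e := by nlinarith
  -- Fine subcubes, so that rounding the proportions `θ b` costs at most the factor `e`.
  obtain ⟨m, hm⟩ : ∃ m : ℕ, ∀ b, 1 ≤ (1 - e) * (θ b * ((2 : ℝ) ^ m) ^ d) := by
    have hpos : ∀ b, 0 < (1 - e) * θ b := fun b => mul_pos (by linarith) (hθpos b)
    obtain ⟨m, hm⟩ := pow_unbounded_of_one_lt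
      (max ((1 - e) * θ true)⁻¹ ((1 - e) * θ false)⁻¹) (one_lt_two (α := ℝ))
    refine ⟨m, fun b => ?_⟩
    have h1 : ((1 - e) * θ b)⁻¹ ≤ (2 : ℝ) ^ m := by
      cases b
      · exact (le_max_right _ _).trans hm.le
      · exact (le_max_left _ _).trans hm.le
    have h2 : (2 : ℝ) ^ m ≤ ((2 : ℝ) ^ m) ^ d :=
      le_self_pow₀ (one_le_pow₀ one_le_two) hd.ne'
    rw [← mul_assoc]
    calc (1 : ℝ) = ((1 - e) * θ b) * ((1 - e) * θ b)⁻¹ := (mul_inv_cancel₀ (hpos b).ne').symm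
      _ ≤ _ := mul_le_mul_of_nonneg_left (h1.trans h2) (hpos b).le
  set M : ℝ := ((2 : ℝ) ^ m) ^ d with hM
  have hMpos : 0 < M := by positivity
  obtain ⟨S, hSdisj, hSle, hSge⟩ : ∃ S : Bool → Finset (Fin d → Fin (2 ^ m)),
      Disjoint (S true) (S false) ∧ (∀ b, ((S b).card : ℝ) ≤ θ b * M) ∧
      ∀ b, e * (θ b * M) ≤ (S b).card := by
    have hcardT : (Finset.univ : Finset (Fin d → Fin (2 ^ m))).card = (2 ^ m) ^ d := by simp
    have hle : ∀ b, ((⌊θ b * M⌋₊ : ℕ) : ℝ) ≤ θ b * M := fun b =>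
      Nat.floor_le (mul_pos (hθpos b) hMpos).le
    have hge : ∀ b, e * (θ b * M) ≤ (⌊θ b * M⌋₊ : ℕ) := fun b => by
      have h1 := (Nat.sub_one_lt_floor (θ b * M)).le
      have h2 := hm b
      linarith
    have hsum : ⌊θ true * M⌋₊ + ⌊θ false * M⌋₊ ≤ (2 ^ m) ^ d := by
      have h1 := add_le_add (hle true) (hle false)
      rw [← add_mul, hθsum, one_mul] at h1
      have hMn : M = (((2 ^ m) ^ d : ℕ) : ℝ) := by simp [hM]
      exact_mod_cast h1.trans_eq hMn
    obtain ⟨S₁, -, hS₁⟩ := Finset.exists_subset_card_eq (s := Finset.univ)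
      (n := ⌊θ true * M⌋₊) (by rw [hcardT]; omega)
    obtain ⟨S₂, hS₂', hS₂⟩ := Finset.exists_subset_card_eq (s := Finset.univ \ S₁)
      (n := ⌊θ false * M⌋₊) (by
        rw [Finset.card_sdiff_of_subset (Finset.subset_univ _), hcardT, hS₁]; omega)
    refine ⟨fun b => if b then S₁ else S₂, ?_, ?_, ?_⟩
    · simpa using (Finset.subset_sdiff.1 hS₂').2.symm
    · rintro (_ | _)
      · simpa [hS₂] using hle false
      · simpa [hS₁] using hle true
    · rintro (_ | _)
      · simpa [hS₂] using hge false
      · simpa [hS₁] using hge true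
  have hSdisj' : ∀ b b', b ≠ b' → ∀ t ∈ S b, ∀ t' ∈ S b', t ≠ t' := by
    rintro (_ | _) (_ | _) hb t ht t' ht' rfl
    · exact hb rfl
    · exact Finset.disjoint_left.1 hSdisj ht' ht
    · exact Finset.disjoint_left.1 hSdisj ht ht'
    · exact hb rfl
  have hih : ∀ b t, ∃ L 𝒟, IsSimulation w (part b) (𝒜.filter (· ⊆ part b)) e (P.sub m t) L 𝒟 :=
    fun b t => ih (part b) (hpartA b) (hpartne b) _
      (fun B hB B' hB' => hlam B (Finset.mem_filter.1 hB).1 B' (Finset.mem_filter.1 hB').1)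
      (fun B hB => ⟨(Finset.mem_filter.1 hB).2, (hsub B (Finset.mem_filter.1 hB).1).2⟩)
      e he0 he1 _
  choose L 𝒟 hL using hih
  have hLsub : ∀ b t, ∀ i ∈ part b, L b t i ⊆ (P.sub m t).toSet := fun b t => (hL b t).subset
  have hvol : ∀ t, volume.real (P.sub m t).toSet = volume.real P.toSet / M := fun t => by
    rw [← P.volume_real_sub m t, mul_div_cancel_left₀ _ hMpos.ne']
  have hfinL : ∀ b t, ∀ i ∈ part b, volume (L b t i) ≠ ∞ := fun b t i hi =>
    ((measure_mono (hLsub b t i hi)).trans_lt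
      (DyadicCube.volume_toSet_ne_top _).lt_top).ne
  set L' : ι → Set (Fin d → ℝ) := fun i => ⋃ t ∈ S (side i), L (side i) t i with hL'
  have hL'P : ∀ i ∈ A, L' i ⊆ P.toSet := fun i hi =>
    Set.iUnion₂_subset fun t _ => (hLsub _ t i (hmem_side i hi)).trans (P.sub_subset m t)
  have hmeas : ∀ i ∈ A, MeasurableSet (L' i) := fun i hi =>
    Finset.measurableSet_biUnion _ fun t _ => (hL _ t).meas i (hmem_side i hi)
  have hLvol : ∀ i ∈ A, volume.real (L' i) = ∑ t ∈ S (side i), volume.real (L (side i) t i) := by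
    intro i hi
    refine measureReal_biUnion_finset ?_ (fun t _ => (hL _ t).meas i (hmem_side i hi))
      (fun t _ => hfinL _ t i (hmem_side i hi))
    intro t _ t' _ hne
    exact (P.disjoint_sub m hne).mono (hLsub _ t i (hmem_side i hi))
      (hLsub _ t' i (hmem_side i hi))
  have hlow : ∀ i ∈ A, c * (w i / W A) * volume.real P.toSet ≤ volume.real (L' i) := by
    intro i hi
    have hi' := hmem_side i hi
    have hWp := hWpos _ (hpartne (side i))
    rw [hLvol i hi]
    calc c * (w i / W A) * volume.real P.toSet
        = e * (θ (side i) * M) * (e * (w i / W (part (side i))) * (volume.real P.toSet / M)) := by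
          rw [← hee]; simp only [hθ]; field_simp
      _ ≤ (S (side i)).card * (e * (w i / W (part (side i))) * (volume.real P.toSet / M)) := by
          have := hw i
          gcongr
          exact hSge _
      _ = ∑ t ∈ S (side i), e * (w i / W (part (side i))) * volume.real (P.sub m t).toSet := by
          simp_rw [hvol]; rw [Finset.sum_const, nsmul_eq_mul]
      _ ≤ _ := Finset.sum_le_sum fun t _ => (hL _ t).lower i hi'
  have hupp : ∀ i ∈ A, volume.real (L' i) ≤ w i / W A * volume.real P.toSet := by
    intro i hi
    have hi' := hmem_side i hi
    have hWp := hWpos _ (hpartne (side i))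
    rw [hLvol i hi]
    calc ∑ t ∈ S (side i), volume.real (L (side i) t i)
        ≤ ∑ t ∈ S (side i), w i / W (part (side i)) * volume.real (P.sub m t).toSet :=
          Finset.sum_le_sum fun t _ => (hL _ t).upper i hi'
      _ = (S (side i)).card * (w i / W (part (side i)) * (volume.real P.toSet / M)) := by
          simp_rw [hvol]; rw [Finset.sum_const, nsmul_eq_mul]
      _ ≤ θ (side i) * M * (w i / W (part (side i)) * (volume.real P.toSet / M)) := by
          have := hw i
          gcongr
          exact hSle _
      _ = w i / W A * volume.real P.toSet := by simp only [hθ]; field_simp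
  refine ⟨L', insert P (Finset.univ.biUnion fun b => (S b).biUnion (𝒟 b)), hmeas, hL'P, ?_,
    hlow, hupp, ?_⟩
  · intro i hi j hj hij
    refine Set.disjoint_left.2 fun x hx hx' => ?_
    obtain ⟨t, ht, hxt⟩ := Set.mem_iUnion₂.1 hx
    obtain ⟨t', ht', hxt'⟩ := Set.mem_iUnion₂.1 hx'
    have hi' := hmem_side i hi
    have hj' := hmem_side j hj
    by_cases htt : t = t'
    · subst htt
      have hs : side i = side j := by
        by_contra hs
        exact hSdisj' _ _ hs t ht t ht' rfl
      rw [← hs] at hj' hxt'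
      exact Set.disjoint_left.1 ((hL (side i) t).disj hi' hj' hij) hxt hxt'
    · exact Set.disjoint_left.1 (P.disjoint_sub m htt) (hLsub _ t i hi' hxt)
        (hLsub _ t' j hj' hxt')
  · intro B₀ hB₀ i hi x hx
    rcases eq_or_ne B₀ A with rfl | hne
    · refine ⟨P, Finset.mem_insert_self _ _, hL'P i hi hx, fun j hj => ?_⟩
      rw [Set.inter_eq_left.2 (hL'P j hj)]
      exact hlow j hj
    · obtain ⟨b, hb⟩ : ∃ b, B₀ ⊆ part b := by
        rcases hsplit B₀ hB₀ with h | h | h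
        · exact (hne h).elim
        · exact ⟨true, by simpa [hpart] using h⟩
        · exact ⟨false, by simpa [hpart] using h⟩
      have hsb : ∀ j ∈ B₀, side j = b := fun j hj => hside_eq b j (hb hj)
      obtain ⟨t, ht, hxt⟩ := Set.mem_iUnion₂.1 hx
      rw [hsb i hi] at ht hxt
      obtain ⟨Q, hQ, hxQ, hQj⟩ :=
        (hL b t).avg B₀ (Finset.mem_filter.2 ⟨hB₀, hb⟩) i hi x hxt
      refine ⟨Q, Finset.mem_insert_of_mem (Finset.mem_biUnion.2 ⟨b, Finset.mem_univ b,
        Finset.mem_biUnion.2 ⟨t, ht, hQ⟩⟩), hxQ, fun j hj => ?_⟩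
      have hWB := hWpos B₀ (hsub B₀ hB₀).2
      have hwj := hw j
      calc c * (w j / W B₀) * volume.real Q.toSet ≤ e * (w j / W B₀) * volume.real Q.toSet := by
            gcongr
        _ ≤ volume.real (L b t j ∩ Q.toSet) := hQj j hj
        _ ≤ volume.real (L' j ∩ Q.toSet) := by
            refine measureReal_mono (Set.inter_subset_inter_left _ ?_)
              ((measure_mono Set.inter_subset_right).trans_lt Q.volume_toSet_ne_top.lt_top).ne
            rw [← hsb j hj] at ht ⊢
            exact Set.subset_biUnion_of_mem (u := fun t => L (side j) t j) ht

end Simulation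

/-! ### Transference of the maximal inequality from Lebesgue measure to arbitrary measures -/

section Transference

variable {E : Type*} [NormedAddCommGroup E] [NormedSpace ℝ E] [CompleteSpace E]
  [Lattice E] [HasSolidNorm E] [IsOrderedAddMonoid E] [IsOrderedModule ℝ E] {d : ℕ}

open Classical in
theorem latticeMaximal_eq_maximalFn (𝒟 : Finset (DyadicCube d)) {f : (Fin d → ℝ) → E}
    (hf : 0 ≤ f) : latticeMaximal 𝒟 f = maximalFn volume (𝒟.image DyadicCube.toSet) f := by
  funext x
  unfold latticeMaximal
  split_ifs with h
  · have hav : ∀ Q : DyadicCube d, 0 ≤ ⨍ y in Q.toSet, f y := fun Q => setAverage_nonneg hf _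
    apply le_antisymm
    · refine Finset.sup'_le _ _ fun Q hQ => ?_
      by_cases hx : x ∈ Q.toSet
      · rw [Set.indicator_of_mem hx]
        exact setAverage_le_maximalFn f (Finset.mem_image_of_mem _ hQ) hx
      · rw [Set.indicator_of_notMem hx]
        exact posSup_nonneg _ _
    · refine maximalFn_le ?_ fun S hS hx => ?_
      · obtain ⟨Q, hQ⟩ := h
        refine le_trans ?_ (Finset.le_sup' _ hQ)
        exact Set.indicator_nonneg (fun _ _ => hav Q) x
      · obtain ⟨Q, hQ, rfl⟩ := Finset.mem_image.1 hS
        have := Finset.le_sup' (fun Q : DyadicCube d =>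
          Q.toSet.indicator (fun _ => ⨍ y in Q.toSet, f y) x) hQ
        rwa [Set.indicator_of_mem hx] at this
  · rw [Finset.not_nonempty_iff_eq_empty] at h
    subst h
    simp [maximalFn, posSup]

theorem eLpNorm_rpow_eq_lintegral {X F : Type*} [MeasurableSpace X] [NormedAddCommGroup F]
    {μ : Measure X} {p : ℝ} (hp : 0 < p) (f : X → F) :
    eLpNorm f (ENNReal.ofReal p) μ ^ p = ∫⁻ x, ‖f x‖ₑ ^ p ∂μ := by
  rw [eLpNorm_eq_lintegral_rpow_enorm_toReal (by simpa using hp) (by simp),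
    ENNReal.toReal_ofReal hp.le, ← ENNReal.rpow_mul, one_div, inv_mul_cancel₀ hp.ne',
    ENNReal.rpow_one]

/-- The maximal inequality for a finite set with weights, obtained by simulation. -/
theorem weighted_maximal_le (hd : 0 < d) {p : ℝ} (hp : 1 < p) {N : ℝ≥0∞}
    (hN : ∀ (𝒟 : Finset (DyadicCube d)) (f : (Fin d → ℝ) → E), MemLp f (ENNReal.ofReal p) volume →
      eLpNorm (latticeMaximal 𝒟 f) (ENNReal.ofReal p) volume ≤
        N * eLpNorm f (ENNReal.ofReal p) volume)
    {ι : Type*} [DecidableEq ι] (w : ι → ℝ) (hw : ∀ i, 0 < w i) (A : Finset ι)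
    (𝒜 : Finset (Finset ι))
    (hlam : ∀ B ∈ 𝒜, ∀ B' ∈ 𝒜, B ⊆ B' ∨ B' ⊆ B ∨ Disjoint B B')
    (hsub : ∀ B ∈ 𝒜, B ⊆ A ∧ B.Nonempty) (F : ι → E) (hF : 0 ≤ F) :
    ∑ i ∈ A, ENNReal.ofReal (w i) * ‖posSup (𝒜.filter (i ∈ ·))
        fun B => (∑ j ∈ B, w j)⁻¹ • ∑ j ∈ B, w j • F j‖ₑ ^ p ≤
      (4 * N) ^ p * ∑ i ∈ A, ENNReal.ofReal (w i) * ‖F i‖ₑ ^ p := by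
  have hp0 : 0 < p := by linarith
  rcases A.eq_empty_or_nonempty with rfl | hA
  · simp
  obtain ⟨L, 𝒟, hL⟩ := exists_isSimulation hd w hw A hA 𝒜 hlam hsub (1 / 2) (by norm_num)
    (by norm_num) (⟨0, 0⟩ : DyadicCube d)
  set P : DyadicCube d := ⟨0, 0⟩
  have hvP : volume.real P.toSet = 1 := by rw [DyadicCube.volume_real_toSet]; simp [P]
  set W := ∑ j ∈ A, w j with hW
  have hWpos : 0 < W := Finset.sum_pos (fun i _ => hw i) hA
  have hLfin : ∀ i ∈ A, volume (L i) ≠ ∞ := fun i hi =>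
    ((measure_mono (hL.subset i hi)).trans_lt P.volume_toSet_ne_top.lt_top).ne
  set m : ι → E := fun i => posSup (𝒜.filter (i ∈ ·))
    fun B => (∑ j ∈ B, w j)⁻¹ • ∑ j ∈ B, w j • F j with hm
  set f : (Fin d → ℝ) → E := fun x => ∑ i ∈ A, (L i).indicator (fun _ => F i) x with hf
  have hf0 : 0 ≤ f := fun x => Finset.sum_nonneg fun i _ =>
    Set.indicator_nonneg (fun _ _ => hF i) x
  have hfmem : MemLp f (ENNReal.ofReal p) volume := by
    refine memLp_finsetSum _ fun i hi => ?_
    exact memLp_indicator_const _ (hL.meas i hi) _ (Or.inr (hLfin i hi))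
  have hfint : Integrable f := by
    refine integrable_finsetSum _ fun i hi => ?_
    exact (integrable_indicator_iff (hL.meas i hi)).2 (integrableOn_const (hLfin i hi))
  have hfnorm : ∀ x, ‖f x‖ₑ ^ p = ∑ i ∈ A, (L i).indicator (fun _ => ‖F i‖ₑ ^ p) x := by
    intro x
    by_cases hx : ∃ i ∈ A, x ∈ L i
    · obtain ⟨i, hi, hxi⟩ := hx
      have hother : ∀ j ∈ A, j ≠ i → x ∉ L j := fun j hj hji hxj =>
        Set.disjoint_left.1 (hL.disj hj hi hji) hxj hxi
      have e1 : f x = F i := by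
        simp only [hf]
        rw [Finset.sum_eq_single_of_mem i hi fun j hj hji =>
          Set.indicator_of_notMem (hother j hj hji) _, Set.indicator_of_mem hxi]
      rw [e1, Finset.sum_eq_single_of_mem i hi fun j hj hji =>
          Set.indicator_of_notMem (hother j hj hji) _, Set.indicator_of_mem hxi]
    · push Not at hx
      have e1 : f x = 0 := Finset.sum_eq_zero fun i hi => Set.indicator_of_notMem (hx i hi) _
      rw [e1, enorm_zero, ENNReal.zero_rpow_of_pos hp0]
      exact (Finset.sum_eq_zero fun i hi => Set.indicator_of_notMem (hx i hi) _).symm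
  have hvol : ∀ i ∈ A, volume (L i) = ENNReal.ofReal (volume.real (L i)) := fun i hi =>
    (ENNReal.ofReal_toReal (hLfin i hi)).symm
  -- The upper bound for the norm of the simulating function.
  have hup : ∫⁻ x, ‖f x‖ₑ ^ p ≤ ENNReal.ofReal W⁻¹ * ∑ i ∈ A, ENNReal.ofReal (w i) * ‖F i‖ₑ ^ p := by
    simp_rw [hfnorm]
    rw [lintegral_finsetSum' _ fun i hi => (measurable_const.indicator (hL.meas i hi)).aemeasurable,
      Finset.mul_sum]
    refine Finset.sum_le_sum fun i hi => ?_
    rw [lintegral_indicator_const (hL.meas i hi), hvol i hi, mul_comm, ← mul_assoc,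
      ← ENNReal.ofReal_mul (by positivity)]
    gcongr
    have := hL.upper i hi
    rw [hvP, mul_one, div_eq_inv_mul] at this
    exact this
  -- The maximal function of the simulating function dominates half of the weighted one.
  have hmax : ∀ i ∈ A, ∀ x ∈ L i, m i ≤ (2 : ℝ) • latticeMaximal 𝒟 f x := by
    intro i _ x hx
    rw [latticeMaximal_eq_maximalFn 𝒟 hf0]
    refine posSup_le (smul_nonneg (by norm_num) (maximalFn_nonneg _ _ _)) fun B hB => ?_
    obtain ⟨hB, hiB⟩ := Finset.mem_filter.1 hB
    obtain ⟨Q, hQ, hxQ, hQj⟩ := hL.avg B hB i hiB x hx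
    have hvQ := Q.volume_real_toSet_pos
    refine le_trans ?_ (smul_le_smul_of_nonneg_left (setAverage_le_maximalFn f
      (Finset.mem_image_of_mem _ hQ) hxQ) (by norm_num))
    have h1 : ∫ y in Q.toSet, f y = ∑ j ∈ A, volume.real (L j ∩ Q.toSet) • F j := by
      simp only [hf]
      rw [integral_finsetSum]
      · refine Finset.sum_congr rfl fun j hj => ?_
        rw [integral_indicator_const _ (hL.meas j hj), measureReal_restrict_apply (hL.meas j hj)]
      · intro j hj
        exact ((integrable_indicator_iff (hL.meas j hj)).2
          (integrableOn_const (hLfin j hj))).integrableOn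
    have h2 : ∑ j ∈ B, (1 / 2 * (w j / ∑ j ∈ B, w j) * volume.real Q.toSet) • F j ≤
        ∫ y in Q.toSet, f y := by
      rw [h1]
      calc _ ≤ ∑ j ∈ B, volume.real (L j ∩ Q.toSet) • F j :=
            Finset.sum_le_sum fun j hj => smul_le_smul_of_nonneg_right (hQj j hj) (hF j)
        _ ≤ _ := Finset.sum_le_sum_of_subset_of_nonneg (hsub B hB).1 fun j _ _ =>
            smul_nonneg measureReal_nonneg (hF j)
    rw [setAverage_eq]
    have h3 := smul_le_smul_of_nonneg_left h2
      (show (0 : ℝ) ≤ 2 * (volume.real Q.toSet)⁻¹ by positivity)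
    rw [mul_smul 2 _ (∫ y in Q.toSet, f y)] at h3
    refine le_trans (le_of_eq ?_) h3
    rw [Finset.smul_sum, Finset.smul_sum]
    refine Finset.sum_congr rfl fun j _ => ?_
    rw [smul_smul, smul_smul]
    congr 1
    field_simp
  have hmax' : ∀ i ∈ A, ∀ x ∈ L i, ‖m i‖ₑ ^ p ≤ 2 ^ p * ‖latticeMaximal 𝒟 f x‖ₑ ^ p := by
    intro i hi x hx
    rw [← ENNReal.mul_rpow_of_nonneg _ _ hp0.le]
    refine ENNReal.rpow_le_rpow ?_ hp0.le
    refine (enorm_le_enorm_of_nonneg_of_le (posSup_nonneg _ _) (hmax i hi x hx)).trans ?_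
    rw [enorm_smul]
    gcongr
    rw [← ofReal_norm]; norm_num
  have hlow : ENNReal.ofReal W⁻¹ * ∑ i ∈ A, ENNReal.ofReal (w i) * ‖m i‖ₑ ^ p ≤
      2 * 2 ^ p * ∫⁻ x, ‖latticeMaximal 𝒟 f x‖ₑ ^ p := by
    calc _ = ∑ i ∈ A, ENNReal.ofReal (W⁻¹ * w i) * ‖m i‖ₑ ^ p := by
          rw [Finset.mul_sum]
          refine Finset.sum_congr rfl fun i _ => ?_
          rw [← mul_assoc, ENNReal.ofReal_mul (by positivity)]
      _ ≤ ∑ i ∈ A, 2 * (volume (L i) * ‖m i‖ₑ ^ p) := by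
          refine Finset.sum_le_sum fun i hi => ?_
          rw [← mul_assoc]
          gcongr
          rw [hvol i hi, ← ENNReal.ofReal_ofNat 2, ← ENNReal.ofReal_mul (by norm_num)]
          refine ENNReal.ofReal_le_ofReal ?_
          have := hL.lower i hi
          rw [hvP, mul_one, div_eq_inv_mul (w i)] at this
          linarith
      _ ≤ ∑ i ∈ A, 2 * ∫⁻ x in L i, 2 ^ p * ‖latticeMaximal 𝒟 f x‖ₑ ^ p := by
          gcongr with i hi
          rw [mul_comm, ← setLIntegral_const]
          exact setLIntegral_mono' (hL.meas i hi) (hmax' i hi)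
      _ = 2 * ∫⁻ x in ⋃ i ∈ A, L i, 2 ^ p * ‖latticeMaximal 𝒟 f x‖ₑ ^ p := by
          rw [lintegral_biUnion_finset hL.disj hL.meas, Finset.mul_sum]
      _ ≤ 2 * ∫⁻ x, 2 ^ p * ‖latticeMaximal 𝒟 f x‖ₑ ^ p := by
          gcongr
          exact Measure.restrict_le_self
      _ = _ := by rw [lintegral_const_mul' _ _ (by simp), mul_assoc]
  have hW0 : ENNReal.ofReal W⁻¹ ≠ 0 := by simpa using hWpos
  have hkey : ∫⁻ x, ‖latticeMaximal 𝒟 f x‖ₑ ^ p ≤ N ^ p * ∫⁻ x, ‖f x‖ₑ ^ p := by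
    rw [← eLpNorm_rpow_eq_lintegral hp0, ← eLpNorm_rpow_eq_lintegral hp0,
      ← ENNReal.mul_rpow_of_nonneg _ _ hp0.le]
    exact ENNReal.rpow_le_rpow (hN 𝒟 f hfmem) hp0.le
  refine (ENNReal.mul_le_mul_iff_right hW0 ENNReal.ofReal_ne_top).1 ?_
  calc _ ≤ 2 * 2 ^ p * ∫⁻ x, ‖latticeMaximal 𝒟 f x‖ₑ ^ p := hlow
    _ ≤ 2 ^ p * 2 ^ p * (N ^ p * (ENNReal.ofReal W⁻¹ *
          ∑ i ∈ A, ENNReal.ofReal (w i) * ‖F i‖ₑ ^ p)) := by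
        gcongr
        · exact ENNReal.le_rpow_self_of_one_le (by norm_num) hp.le
        · exact hkey.trans (by gcongr)
    _ = _ := by
        rw [ENNReal.mul_rpow_of_nonneg 4 N hp0.le, ← ENNReal.mul_rpow_of_nonneg 2 2 hp0.le]
        norm_num
        ring

variable {X : Type*}

theorem mem_stoppingCore_id_iff {𝒟 : Finset (Set X)} {A : Set X} {x : X} :
    x ∈ stoppingCore 𝒟 id A ↔ x ∈ A ∧ ∀ B ∈ 𝒟, B ⊂ A → x ∉ B := by
  simp only [stoppingCore, Set.mem_sdiff, Set.mem_iUnion, not_exists, mem_stoppingBelow]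
  constructor
  · exact fun h => ⟨h.1, fun B hB hBA hx => h.2 B ⟨⟨hB, rfl⟩, hBA⟩ hx⟩
  · exact fun h => ⟨h.1, fun B hB hx => h.2 B hB.1.1 hB.2 hx⟩

theorem stoppingSets_id (𝒟 : Finset (Set X)) : stoppingSets 𝒟 id = 𝒟 := by
  ext; simp [mem_stoppingSets]

open Classical in
/-- Each set of a finite family is the union of the atoms below it. -/
theorem biUnion_stoppingCore_id {𝒟 : Finset (Set X)} {Q : Set X} (hQ : Q ∈ 𝒟) :
    ⋃ A ∈ 𝒟.filter (· ⊆ Q), stoppingCore 𝒟 id A = Q := by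
  apply Set.Subset.antisymm
  · exact Set.iUnion₂_subset fun A hA => (stoppingCore_subset A).trans (Finset.mem_filter.1 hA).2
  · intro x hx
    obtain ⟨A, hA⟩ := Finset.exists_minimal (s := 𝒟.filter fun A => A ⊆ Q ∧ x ∈ A)
      ⟨Q, Finset.mem_filter.2 ⟨hQ, subset_rfl, hx⟩⟩
    obtain ⟨hA1, hA2, hA3⟩ := Finset.mem_filter.1 hA.prop
    refine Set.mem_biUnion (Finset.mem_filter.2 ⟨hA1, hA2⟩)
      (mem_stoppingCore_id_iff.2 ⟨hA3, fun B hB hBA hxB => ?_⟩)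
    exact hBA.2 (hA.le_of_le (Finset.mem_filter.2 ⟨hB, hBA.1.trans hA2, hxB⟩) hBA.1)

/-- A maximal inequality for Lebesgue measure and dyadic cubes implies one for all measures and all
finite laminar families, with a comparable constant. The maximal function is constant on the atoms
of the family, the parts of its members outside the smaller members, so that only the finite set
of atoms, weighted by their measure, matters. -/
theorem maximalBound_of_lebesgue (hd : 0 < d) {p : ℝ} (hp : 1 < p) {N : ℝ≥0∞}
    (hN : ∀ (𝒟 : Finset (DyadicCube d)) (f : (Fin d → ℝ) → E), MemLp f (ENNReal.ofReal p) volume →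
      eLpNorm (latticeMaximal 𝒟 f) (ENNReal.ofReal p) volume ≤
        N * eLpNorm f (ENNReal.ofReal p) volume)
    [MeasurableSpace X] : MaximalBound X E p (4 * N) := by
  classical
  intro μ 𝒟 h hm hfin f hfm hf0 hf
  have hp0 : 0 < p := by linarith
  set core := stoppingCore 𝒟 id with hcore
  have hcm : ∀ A ∈ 𝒟, MeasurableSet (core A) := fun A hA => measurableSet_stoppingCore hm hA
  have hcd : (𝒟 : Set (Set X)).PairwiseDisjoint core := by
    have := h.pairwiseDisjoint_stoppingCore (π := id)
    rwa [stoppingSets_id] at this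
  have hcf : ∀ A ∈ 𝒟, μ (core A) ≠ ∞ := fun A hA =>
    ((measure_mono (stoppingCore_subset A)).trans_lt (hfin A hA).lt_top).ne
  set G := 𝒟.filter fun A => μ (core A) ≠ 0 with hG
  -- Outside `G` the weight is irrelevant; the value `1` makes it positive.
  set w : Set X → ℝ := fun A => if A ∈ G then (μ (core A)).toReal else 1 with hw
  have hwG : ∀ A ∈ G, w A = (μ (core A)).toReal := fun A hA => if_pos hA
  have hwpos : ∀ A, 0 < w A := by
    intro A
    simp only [hw]
    split_ifs with hA
    · exact ENNReal.toReal_pos (Finset.mem_filter.1 hA).2 (hcf A (Finset.mem_filter.1 hA).1)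
    · exact one_pos
  set below : Set X → Finset (Set X) := fun Q => G.filter (· ⊆ Q) with hbelow
  set 𝒜 := (𝒟.image below).erase ∅ with h𝒜
  set F : Set X → E := fun A => ⨍ y in core A, f y ∂μ with hFdef
  have hlam : ∀ B ∈ 𝒜, ∀ B' ∈ 𝒜, B ⊆ B' ∨ B' ⊆ B ∨ Disjoint B B' := by
    intro B hB B' hB'
    obtain ⟨Q, hQ, rfl⟩ := Finset.mem_image.1 (Finset.mem_of_mem_erase hB)
    obtain ⟨Q', hQ', rfl⟩ := Finset.mem_image.1 (Finset.mem_of_mem_erase hB')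
    rcases h Q hQ Q' hQ' with h1 | h1 | h1
    · exact Or.inl (Finset.monotone_filter_right _ fun A _ hA => hA.trans h1)
    · exact Or.inr (Or.inl (Finset.monotone_filter_right _ fun A _ hA => hA.trans h1))
    · refine Or.inr (Or.inr (Finset.disjoint_left.2 fun A hA hA' => ?_))
      obtain ⟨hAG, hAQ⟩ := Finset.mem_filter.1 hA
      obtain ⟨x, hx⟩ := nonempty_of_measure_ne_zero (Finset.mem_filter.1 hAG).2
      have hxA := stoppingCore_subset A hx
      exact Set.disjoint_left.1 h1 (hAQ hxA) ((Finset.mem_filter.1 hA').2 hxA)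
  have hsub : ∀ B ∈ 𝒜, B ⊆ G ∧ B.Nonempty := by
    intro B hB
    obtain ⟨hne, hB⟩ := Finset.mem_erase.1 hB
    obtain ⟨Q, hQ, rfl⟩ := Finset.mem_image.1 hB
    exact ⟨Finset.filter_subset _ _, Finset.nonempty_iff_ne_empty.2 hne⟩
  have hint : ∀ Q ∈ 𝒟, IntegrableOn f Q μ := fun Q hQ =>
    MemLp.integrableOn_of_measure_ne_top hp.le hf (hfin Q hQ)
  -- The averages over `Q ∈ 𝒟` are weighted averages over the atoms in `Q`.
  have havg : ∀ Q ∈ 𝒟, (∑ A ∈ below Q, w A)⁻¹ • ∑ A ∈ below Q, w A • F A = ⨍ y in Q, f y ∂μ := by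
    intro Q hQ
    have hsubQ : below Q ⊆ 𝒟.filter (· ⊆ Q) := by
      intro A hA
      obtain ⟨h1, h2⟩ := Finset.mem_filter.1 hA
      exact Finset.mem_filter.2 ⟨(Finset.mem_filter.1 h1).1, h2⟩
    have hzero : ∀ A ∈ 𝒟.filter (· ⊆ Q), A ∉ below Q → μ (core A) = 0 := by
      intro A hA hA'
      obtain ⟨h1, h2⟩ := Finset.mem_filter.1 hA
      by_contra h3
      exact hA' (Finset.mem_filter.2 ⟨Finset.mem_filter.2 ⟨h1, h3⟩, h2⟩)
    have hD : ∀ A ∈ 𝒟.filter (· ⊆ Q), A ∈ 𝒟 := fun A hA => (Finset.mem_filter.1 hA).1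
    have hdisj : ((𝒟.filter (· ⊆ Q) : Finset (Set X)) : Set (Set X)).PairwiseDisjoint core :=
      hcd.subset fun A hA => hD A hA
    have e1 : ∑ A ∈ below Q, w A = μ.real Q := by
      conv_rhs => rw [← biUnion_stoppingCore_id hQ]
      rw [measureReal_biUnion_finset hdisj
        (fun A hA => hcm A (hD A hA)) (fun A hA => hcf A (hD A hA)),
        ← Finset.sum_subset hsubQ fun A hA hA' => by
          rw [Measure.real]; rw [hcore] at hzero; rw [hzero A hA hA']; rfl]
      exact Finset.sum_congr rfl fun A hA => hwG A (Finset.mem_filter.1 hA).1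
    have e2 : ∑ A ∈ below Q, w A • F A = ∫ y in Q, f y ∂μ := by
      conv_rhs => rw [← biUnion_stoppingCore_id hQ]
      rw [integral_biUnion_finset _ (fun A hA => hcm A (hD A hA)) hdisj
        (fun A hA => (hint A (hD A hA)).mono_set (stoppingCore_subset A)),
        ← Finset.sum_subset hsubQ fun A hA hA' => by
          rw [Measure.restrict_eq_zero.2 (hzero A hA hA'), integral_zero_measure]]
      refine Finset.sum_congr rfl fun A hA => ?_
      rw [hwG A (Finset.mem_filter.1 hA).1]
      exact measure_toReal_smul_setAverage f (hcf A (hD A (hsubQ hA)))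
    rw [e1, e2, setAverage_eq]
  have key := weighted_maximal_le hd hp hN w hwpos G 𝒜 hlam hsub F fun A => setAverage_nonneg hf0 _
  have hwμ : ∀ A ∈ G, ENNReal.ofReal (w A) = μ (core A) := fun A hA => by
    rw [hwG A hA, ENNReal.ofReal_toReal (hcf A (Finset.mem_filter.1 hA).1)]
  have hUD : ⋃ Q ∈ 𝒟, Q = ⋃ A ∈ 𝒟, core A := by
    apply Set.Subset.antisymm
    · refine Set.iUnion₂_subset fun Q hQ => ?_
      rw [← biUnion_stoppingCore_id hQ]
      exact Set.biUnion_subset_biUnion_left (Finset.filter_subset _ _)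
    · exact Set.iUnion₂_mono fun A _ => stoppingCore_subset A
  calc ∫⁻ x, ‖maximalFn μ 𝒟 f x‖ₑ ^ p ∂μ
      = ∫⁻ x in ⋃ A ∈ 𝒟, core A, ‖maximalFn μ 𝒟 f x‖ₑ ^ p ∂μ := by
        refine (setLIntegral_eq_of_support_subset fun x hx => ?_).symm
        rw [← hUD]
        by_contra h1
        rw [Function.mem_support, maximalFn_eq_zero_of_notMem h1, enorm_zero,
          ENNReal.zero_rpow_of_pos hp0] at hx
        exact hx rfl
    _ = ∑ A ∈ 𝒟, ∫⁻ x in core A, ‖maximalFn μ 𝒟 f x‖ₑ ^ p ∂μ :=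
        lintegral_biUnion_finset hcd hcm _
    _ = ∑ A ∈ G, ∫⁻ x in core A, ‖maximalFn μ 𝒟 f x‖ₑ ^ p ∂μ := by
        refine (Finset.sum_subset (Finset.filter_subset _ _) fun A hA hA' => ?_).symm
        have : μ (core A) = 0 := by
          by_contra h1
          exact hA' (Finset.mem_filter.2 ⟨hA, h1⟩)
        rw [Measure.restrict_eq_zero.2 this, lintegral_zero_measure]
    _ ≤ ∑ A ∈ G, ENNReal.ofReal (w A) * ‖posSup (𝒜.filter (A ∈ ·))
          fun B => (∑ j ∈ B, w j)⁻¹ • ∑ j ∈ B, w j • F j‖ₑ ^ p := by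
        refine Finset.sum_le_sum fun A hA => ?_
        have hAD := (Finset.mem_filter.1 hA).1
        rw [hwμ A hA, mul_comm, ← setLIntegral_const]
        refine setLIntegral_mono' (hcm A hAD) fun x hx => ?_
        refine ENNReal.rpow_le_rpow ?_ hp0.le
        refine enorm_le_enorm_of_nonneg_of_le (maximalFn_nonneg _ _ _) ?_
        refine maximalFn_le (posSup_nonneg _ _) fun Q hQ hxQ => ?_
        obtain ⟨hxA, hxmin⟩ := mem_stoppingCore_id_iff.1 hx
        have hAQ : A ⊆ Q := by
          rcases h A hAD Q hQ with h1 | h1 | h1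
          · exact h1
          · by_contra h2
            exact hxmin Q hQ ⟨h1, h2⟩ hxQ
          · exact (Set.disjoint_left.1 h1 hxA hxQ).elim
        have hAb : A ∈ below Q := Finset.mem_filter.2 ⟨hA, hAQ⟩
        rw [← havg Q hQ]
        exact le_posSup (fun B => (∑ j ∈ B, w j)⁻¹ • ∑ j ∈ B, w j • F j)
          (Finset.mem_filter.2 ⟨Finset.mem_erase.2
            ⟨Finset.nonempty_iff_ne_empty.1 ⟨A, hAb⟩, Finset.mem_image_of_mem _ hQ⟩, hAb⟩)
    _ ≤ (4 * N) ^ p * ∑ A ∈ G, ENNReal.ofReal (w A) * ‖F A‖ₑ ^ p := key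
    _ ≤ (4 * N) ^ p * ∫⁻ x, ‖f x‖ₑ ^ p ∂μ := by
        gcongr
        calc ∑ A ∈ G, ENNReal.ofReal (w A) * ‖F A‖ₑ ^ p
            ≤ ∑ A ∈ G, ∫⁻ x in core A, ‖f x‖ₑ ^ p ∂μ := by
              refine Finset.sum_le_sum fun A hA => ?_
              rw [hwμ A hA, mul_comm]
              refine le_trans ?_ (setLAverage_rpow_mul_measure_le hp.le hfm.enorm
                (hcf A (Finset.mem_filter.1 hA).1))
              gcongr
              exact enorm_setAverage_le f _
          _ = ∫⁻ x in ⋃ A ∈ G, core A, ‖f x‖ₑ ^ p ∂μ :=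
              (lintegral_biUnion_finset (hcd.subset (by exact_mod_cast Finset.filter_subset _ _))
                (fun A hA => hcm A (Finset.mem_filter.1 hA).1) _).symm
          _ ≤ _ := setLIntegral_le_lintegral _ _

end Transference

/-! ### Sparse operators -/

section Sparse

theorem ENNReal.le_rpow_of_le_mul_rpow {p q : ℝ} (hpq : p.HolderConjugate q) {Y B : ℝ≥0∞}
    (hY : Y ≠ ∞) (h : Y ≤ B * Y ^ (1 / q)) : Y ≤ B ^ p := by
  rcases eq_or_ne Y 0 with h0 | h0
  · simp [h0]
  have e : Y = Y ^ (1 / p) * Y ^ (1 / q) := by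
    rw [← ENNReal.rpow_add _ _ h0 hY, one_div, one_div, hpq.inv_add_inv_eq_one, ENNReal.rpow_one]
  have h1 : Y ^ (1 / q) ≠ 0 := by simp [h0, hY]
  have h2 : Y ^ (1 / q) ≠ ∞ := ENNReal.rpow_ne_top_of_nonneg hpq.symm.one_div_nonneg hY
  nth_rw 1 [e] at h
  have h3 := (ENNReal.mul_le_mul_iff_left h1 h2).1 h
  rw [one_div] at h3
  exact (ENNReal.rpow_inv_le_iff hpq.pos).1 h3

theorem ENNReal.sum_mul_mul_le_Lp_mul_Lq {ι : Type*} (s : Finset ι) (a b m : ι → ℝ≥0∞) {p q : ℝ}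
    (hpq : p.HolderConjugate q) : ∑ i ∈ s, a i * b i * m i ≤
      (∑ i ∈ s, a i ^ p * m i) ^ (1 / p) * (∑ i ∈ s, b i ^ q * m i) ^ (1 / q) := by
  have h := ENNReal.inner_le_Lp_mul_Lq s (fun i => a i * m i ^ (1 / p))
    (fun i => b i * m i ^ (1 / q)) hpq
  have e : ∀ i, a i * m i ^ (1 / p) * (b i * m i ^ (1 / q)) = a i * b i * m i := fun i => by
    rw [mul_mul_mul_comm, ← ENNReal.rpow_add_of_nonneg _ _ hpq.one_div_nonneg
      hpq.symm.one_div_nonneg, one_div, one_div, hpq.inv_add_inv_eq_one, ENNReal.rpow_one]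
  have e' : ∀ (c x : ℝ≥0∞) (r : ℝ), 0 < r → (c * x ^ (1 / r)) ^ r = c ^ r * x := fun c x r hr => by
    rw [ENNReal.mul_rpow_of_nonneg _ _ hr.le, ← ENNReal.rpow_mul, one_div, inv_mul_cancel₀ hr.ne',
      ENNReal.rpow_one]
  simp_rw [e, e' _ _ _ hpq.pos, e' _ _ _ hpq.symm.pos] at h
  exact h

variable {X : Type*} [MeasurableSpace X] {μ : Measure X} {𝒟 : Finset (Set X)} {π : Set X → Set X}

open Classical in
/-- The sparse operator `∑_F ⟨u⟩_F 1_F` over stopping sets is bounded on `L^p`. -/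
theorem IsLaminar.lintegral_sparse_rpow_le (h : IsLaminar 𝒟)
    (hm : ∀ Q ∈ 𝒟, MeasurableSet Q) (hfin : ∀ Q ∈ 𝒟, μ Q ≠ ∞)
    (hpack : ∀ R ∈ 𝒟, ∑ F ∈ stoppingSets 𝒟 π with F ⊆ R, μ F ≤ 2 * μ R)
    {u : X → ℝ≥0} (hu : Measurable u) (hui : ∀ Q ∈ 𝒟, ⨍⁻ x in Q, u x ∂μ ≠ ∞)
    {p q : ℝ} (hpq : p.HolderConjugate q) :
    ∫⁻ x, (∑ F ∈ stoppingSets 𝒟 π, F.indicator (fun _ => ⨍⁻ y in F, u y ∂μ) x) ^ p ∂μ ≤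
      ((2 * carlesonConst p) ^ (1 / p) * (2 * carlesonConst q) ^ (1 / q)) ^ p *
        ∫⁻ x, (u x : ℝ≥0∞) ^ p ∂μ := by
  have hsub : ∀ F ∈ stoppingSets 𝒟 π, F ∈ 𝒟 := fun F hF => (mem_stoppingSets.1 hF).1
  set S : X → ℝ≥0∞ := fun x => ∑ F ∈ stoppingSets 𝒟 π, F.indicator (fun _ => ⨍⁻ y in F, u y ∂μ) x
    with hS
  have hSm : Measurable S := Finset.measurable_fun_sum _ fun F hF =>
    measurable_const.indicator (hm F (hsub F hF))
  set A : ℝ≥0∞ := ∑ F ∈ stoppingSets 𝒟 π, ⨍⁻ y in F, u y ∂μ with hA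
  have hAfin : A ≠ ∞ := ENNReal.sum_ne_top.2 fun F hF => hui F (hsub F hF)
  have hSA : ∀ x, S x ≤ A := fun x => Finset.sum_le_sum fun F _ => Set.indicator_le_self _ _ x
  have hSfin : ∀ x, S x ≠ ∞ := fun x => ((hSA x).trans_lt hAfin.lt_top).ne
  have hp1 : 0 < p - 1 := hpq.sub_one_pos
  set v : X → ℝ≥0 := fun x => (S x ^ (p - 1)).toNNReal with hv
  have hvS : ∀ x, (v x : ℝ≥0∞) = S x ^ (p - 1) := fun x =>
    ENNReal.coe_toNNReal (ENNReal.rpow_ne_top_of_nonneg hp1.le (hSfin x))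
  have hvm : Measurable v := (hSm.pow_const _).ennreal_toNNReal
  have hvq : ∀ x, (v x : ℝ≥0∞) ^ q = S x ^ p := fun x => by
    rw [hvS, ← ENNReal.rpow_mul, hpq.sub_one_mul_conj]
  have hvav : ∀ Q ∈ 𝒟, ⨍⁻ x in Q, v x ∂μ ≠ ∞ := by
    intro Q hQ
    rcases eq_or_ne (μ Q) 0 with h0 | h0
    · rw [setLAverage_eq, Measure.restrict_eq_zero.2 h0]; simp
    rw [setLAverage_eq]
    refine ENNReal.div_ne_top ?_ h0
    refine ne_top_of_le_ne_top (ENNReal.mul_ne_top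
      (ENNReal.rpow_ne_top_of_nonneg hp1.le hAfin) (hfin Q hQ)) ?_
    rw [← setLIntegral_const]
    exact setLIntegral_mono' (hm Q hQ) fun x _ => by
      rw [hvS]; exact ENNReal.rpow_le_rpow (hSA x) hp1.le
  set Y := ∫⁻ x, S x ^ p ∂μ with hY
  have hYfin : Y ≠ ∞ := by
    have hsupp : (fun x => S x ^ p).support ⊆ ⋃ F ∈ stoppingSets 𝒟 π, F := by
      intro x hx
      by_contra h1
      apply hx
      have : S x = 0 := Finset.sum_eq_zero fun F hF =>
        Set.indicator_of_notMem (fun hxF => h1 (Set.mem_biUnion hF hxF)) _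
      simp [this, hpq.pos]
    rw [hY, ← setLIntegral_eq_of_support_subset hsupp]
    refine ne_top_of_le_ne_top (ENNReal.mul_ne_top
      (ENNReal.rpow_ne_top_of_nonneg hpq.nonneg hAfin)
      (measure_biUnion_lt_top (Finset.finite_toSet _) fun F hF =>
        (hfin F (hsub F hF)).lt_top).ne) ?_
    rw [← setLIntegral_const]
    exact lintegral_mono fun x => ENNReal.rpow_le_rpow (hSA x) hpq.nonneg
  have hYeq : Y = ∑ F ∈ stoppingSets 𝒟 π, (⨍⁻ x in F, u x ∂μ) * (⨍⁻ x in F, v x ∂μ) * μ F := by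
    have e : ∀ x, S x ^ p =
        ∑ F ∈ stoppingSets 𝒟 π, (⨍⁻ y in F, u y ∂μ) * F.indicator (fun x => (v x : ℝ≥0∞)) x := by
      intro x
      have : S x ^ p = S x * v x := by
        rw [hvS]
        conv_rhs => rw [← ENNReal.rpow_one (S x), ← ENNReal.rpow_mul, one_mul]
        rw [← ENNReal.rpow_add_of_nonneg _ _ zero_le_one hp1.le, add_sub_cancel]
      rw [this, hS, Finset.sum_mul]
      refine Finset.sum_congr rfl fun F _ => ?_
      by_cases hx : x ∈ F <;> simp [hx]
    simp_rw [hY, e]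
    have hmv : ∀ F ∈ stoppingSets 𝒟 π, Measurable (F.indicator fun x => (v x : ℝ≥0∞)) :=
      fun F hF => hvm.coe_nnreal_ennreal.indicator (hm F (hsub F hF))
    rw [lintegral_finsetSum' _ fun F hF => ((hmv F hF).const_mul _).aemeasurable]
    refine Finset.sum_congr rfl fun F hF => ?_
    rw [lintegral_const_mul _ (hmv F hF), lintegral_indicator (hm F (hsub F hF)), mul_assoc,
      setLAverage_mul_measure (fun x => (v x : ℝ≥0∞)) (hfin F (hsub F hF))]
  have h1 := h.sum_stoppingSets_le hm hfin hpack hu hui hpq.lt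
  have h2 := h.sum_stoppingSets_le hm hfin hpack hvm hvav hpq.symm.lt
  simp_rw [hvq] at h2
  set U := ∫⁻ x, (u x : ℝ≥0∞) ^ p ∂μ with hU
  have h3 : Y ≤ ((2 * carlesonConst p) ^ (1 / p) * (2 * carlesonConst q) ^ (1 / q) *
      U ^ (1 / p)) * Y ^ (1 / q) := by
    calc Y ≤ _ := hYeq.le.trans (ENNReal.sum_mul_mul_le_Lp_mul_Lq _ _ _ _ hpq)
      _ ≤ (2 * carlesonConst p * U) ^ (1 / p) * (2 * carlesonConst q * Y) ^ (1 / q) := by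
        gcongr
        · exact hpq.one_div_nonneg
        · exact hpq.symm.one_div_nonneg
      _ = _ := by
        rw [ENNReal.mul_rpow_of_nonneg _ U hpq.one_div_nonneg,
          ENNReal.mul_rpow_of_nonneg _ Y hpq.symm.one_div_nonneg]
        ring
  refine (ENNReal.le_rpow_of_le_mul_rpow hpq hYfin h3).trans_eq ?_
  rw [ENNReal.mul_rpow_of_nonneg _ (U ^ (1 / p)) hpq.nonneg, ← ENNReal.rpow_mul, one_div,
    inv_mul_cancel₀ hpq.pos.ne', ENNReal.rpow_one]

end Sparse

/-! ### Independence of the exponent -/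

section Exponent

variable {X : Type*} [MeasurableSpace X] {E : Type*} [NormedAddCommGroup E] [NormedSpace ℝ E]
  [CompleteSpace E] [Lattice E] [HasSolidNorm E] [IsOrderedAddMonoid E] [IsOrderedModule ℝ E]

/-- If the averages of `‖f‖` over the sets in `𝒩` are comparable to that over `F`, then the `L^r`
bound for bounded functions controls the maximal function of `f` over `𝒩`. The bound is applied to
the bounded function `f / t` and the measure `t μ`, where `t = max 1 (‖f‖ / (4 ⟨‖f‖⟩_F))`; this
change of measure at most doubles the measure of the sets in `𝒩`. -/
theorem MaximalBound.lintegral_le_of_average_le {r : ℝ} {N : ℝ≥0∞} (hr : 1 < r)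
    (hN : MaximalBound X E r N) {μ : Measure X} {𝒩 : Finset (Set X)} (h : IsLaminar 𝒩)
    (hm : ∀ Q ∈ 𝒩, MeasurableSet Q) {f : X → E} (hfm : StronglyMeasurable f) (hf0 : 0 ≤ f)
    {F : Set X} (hF : MeasurableSet F) (hFfin : μ F ≠ ∞) (hFu : ⨍⁻ x in F, ‖f x‖ₑ ∂μ ≠ ∞)
    (hsub : ∀ Q ∈ 𝒩, Q ⊆ F)
    (hav : ∀ Q ∈ 𝒩, ⨍⁻ x in Q, ‖f x‖ₑ ∂μ ≤ 4 * ⨍⁻ x in F, ‖f x‖ₑ ∂μ) :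
    ∫⁻ x in F, ‖maximalFn μ 𝒩 f x‖ₑ ^ r ∂μ ≤
      2 * (8 * N * ⨍⁻ x in F, ‖f x‖ₑ ∂μ) ^ r * μ F := by
  have hr0 : 0 < r := by linarith
  have hNfin : ∀ Q ∈ 𝒩, μ Q ≠ ∞ := fun Q hQ =>
    ((measure_mono (hsub Q hQ)).trans_lt hFfin.lt_top).ne
  set m := ⨍⁻ x in F, ‖f x‖ₑ ∂μ with hmdef
  rcases eq_or_ne m 0 with hm0 | hm0
  · have hz : ∀ x, maximalFn μ 𝒩 f x = 0 := by
      intro x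
      refine le_antisymm (maximalFn_le le_rfl fun Q hQ _ => ?_) (maximalFn_nonneg _ _ _)
      have := (enorm_setAverage_le (μ := μ) f Q).trans (hav Q hQ)
      rw [hm0, mul_zero, nonpos_iff_eq_zero, enorm_eq_zero] at this
      exact this.le
    simp [hz, hr0]
  obtain ⟨k, hk⟩ : ∃ k : ℝ≥0, (k : ℝ≥0∞) = 4 * m :=
    ⟨(4 * m).toNNReal, ENNReal.coe_toNNReal (ENNReal.mul_ne_top (by simp) hFu)⟩
  have hk0 : k ≠ 0 := by
    rintro rfl
    simp [hm0] at hk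
  have hkpos : 0 < k := pos_iff_ne_zero.2 hk0
  set t : X → ℝ≥0 := fun x => max 1 (‖f x‖₊ / k) with ht
  have htm : Measurable t := measurable_const.max (hfm.nnnorm.measurable.div_const k)
  have ht1 : ∀ x, 1 ≤ t x := fun x => le_max_left _ _
  have htpos : ∀ x, 0 < t x := fun x => one_pos.trans_le (ht1 x)
  set μ' := (μ.restrict F).withDensity fun x => (t x : ℝ≥0∞) with hμ'
  set g : X → E := fun x => (t x : ℝ)⁻¹ • f x with hg
  have hgm : StronglyMeasurable g := htm.coe_nnreal_real.inv.stronglyMeasurable.smul hfm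
  have hg0 : 0 ≤ g := fun x => smul_nonneg (by positivity : (0 : ℝ) ≤ (t x : ℝ)⁻¹) (hf0 x)
  have hgk : ∀ x, ‖g x‖₊ ≤ k := fun x => by
    rw [hg, nnnorm_smul, nnnorm_inv, NNReal.nnnorm_eq]
    rw [inv_mul_le_iff₀ (htpos x), mul_comm, ← div_le_iff₀' hkpos]
    exact le_max_right _ _
  have hμ'le : ∀ R, MeasurableSet R → R ⊆ F → (⨍⁻ x in R, ‖f x‖ₑ ∂μ ≤ 4 * m) →
      μ' R ≤ 2 * μ R := by
    intro R hR hRF hRav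
    rw [hμ', withDensity_apply _ hR, Measure.restrict_restrict hR, Set.inter_eq_left.2 hRF]
    have hRfin : μ R ≠ ∞ := ((measure_mono hRF).trans_lt hFfin.lt_top).ne
    calc ∫⁻ x in R, (t x : ℝ≥0∞) ∂μ ≤ ∫⁻ x in R, (1 + (k : ℝ≥0∞)⁻¹ * ‖f x‖ₑ) ∂μ := by
          refine lintegral_mono fun x => ?_
          have : t x ≤ 1 + k⁻¹ * ‖f x‖₊ := by
            refine max_le le_self_add ?_
            rw [div_eq_inv_mul]; exact le_add_self
          calc (t x : ℝ≥0∞) ≤ ((1 + k⁻¹ * ‖f x‖₊ : ℝ≥0) : ℝ≥0∞) := by exact_mod_cast this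
            _ = _ := by push_cast [ENNReal.coe_inv hk0]; rfl
      _ = μ R + (k : ℝ≥0∞)⁻¹ * ∫⁻ x in R, ‖f x‖ₑ ∂μ := by
          rw [lintegral_add_left measurable_const, setLIntegral_const, one_mul,
            lintegral_const_mul _ hfm.enorm]
      _ ≤ μ R + (k : ℝ≥0∞)⁻¹ * (k * μ R) := by
          gcongr
          rw [← setLAverage_mul_measure _ hRfin, hk]
          gcongr
      _ = 2 * μ R := by
          rw [ENNReal.inv_mul_cancel_left (by simpa using hk0) ENNReal.coe_ne_top, two_mul]
  have hle : μ.restrict F ≤ μ' := by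
    calc μ.restrict F = (μ.restrict F).withDensity 1 := withDensity_one.symm
      _ ≤ μ' := withDensity_mono (Filter.Eventually.of_forall fun x => by
        simpa using ht1 x)
  have hμ'univ : μ' Set.univ ≤ 2 * μ F := by
    have h1 : μ' Fᶜ = 0 := by
      rw [hμ', withDensity_apply _ hF.compl, Measure.restrict_restrict hF.compl]
      simp
    calc μ' Set.univ ≤ μ' F + μ' Fᶜ := by
          rw [← Set.union_compl_self F]; exact measure_union_le _ _
      _ ≤ 2 * μ F := by
          rw [h1, add_zero]
          refine hμ'le F hF subset_rfl ?_
          rw [← hmdef]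
          exact le_mul_of_one_le_left zero_le (by norm_num)
  have hμ'fin : IsFiniteMeasure μ' :=
    ⟨hμ'univ.trans_lt (ENNReal.mul_lt_top (by simp) hFfin.lt_top)⟩
  have hgmem : MemLp g (ENNReal.ofReal r) μ' :=
    MemLp.of_bound hgm.aestronglyMeasurable k (Filter.Eventually.of_forall hgk)
  have key := hN μ' 𝒩 h hm (fun Q _ => measure_ne_top μ' Q) g hgm hg0 hgmem
  have hmax : ∀ x, maximalFn μ 𝒩 f x ≤ (2 : ℝ) • maximalFn μ' 𝒩 g x := by
    intro x
    refine maximalFn_le (smul_nonneg (by norm_num) (maximalFn_nonneg _ _ _)) fun Q hQ hx => ?_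
    refine le_trans ?_ (smul_le_smul_of_nonneg_left (setAverage_le_maximalFn g hQ hx)
      (by norm_num))
    have hI : ∫ y in Q, g y ∂μ' = ∫ y in Q, f y ∂μ := by
      rw [hμ', restrict_withDensity (hm Q hQ), Measure.restrict_restrict (hm Q hQ),
        Set.inter_eq_left.2 (hsub Q hQ), integral_withDensity_eq_integral_smul htm]
      refine integral_congr_ae (Filter.Eventually.of_forall fun x => ?_)
      exact smul_inv_smul₀ (NNReal.coe_ne_zero.2 (htpos x).ne') _
    rw [setAverage_eq, setAverage_eq, hI, smul_smul]
    refine smul_le_smul_of_nonneg_right ?_ (integral_nonneg hf0)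
    rcases eq_or_ne (μ Q) 0 with h0 | h0
    · rw [Measure.real, h0]; simp
    have h1 : 0 < μ.real Q := ENNReal.toReal_pos h0 (hNfin Q hQ)
    have h2 : μ'.real Q ≤ 2 * μ.real Q := by
      have := ENNReal.toReal_mono (ENNReal.mul_ne_top (by simp) (hNfin Q hQ))
        (hμ'le Q (hm Q hQ) (hsub Q hQ) (hav Q hQ))
      simpa [Measure.real] using this
    have h3 : 0 < μ'.real Q := by
      refine h1.trans_le (ENNReal.toReal_mono (measure_ne_top μ' Q) ?_)
      have := hle Q
      rwa [Measure.restrict_apply (hm Q hQ), Set.inter_eq_left.2 (hsub Q hQ)] at this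
    rw [← div_eq_mul_inv, le_div_iff₀ h3, inv_mul_le_iff₀ h1, mul_comm]
    exact h2
  calc ∫⁻ x in F, ‖maximalFn μ 𝒩 f x‖ₑ ^ r ∂μ
      ≤ ∫⁻ x in F, 2 ^ r * ‖maximalFn μ' 𝒩 g x‖ₑ ^ r ∂μ := by
        refine lintegral_mono fun x => ?_
        rw [← ENNReal.mul_rpow_of_nonneg _ _ hr0.le]
        refine ENNReal.rpow_le_rpow ?_ hr0.le
        refine (enorm_le_enorm_of_nonneg_of_le (maximalFn_nonneg _ _ _) (hmax x)).trans_eq ?_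
        rw [enorm_smul]
        congr 1
        rw [← ofReal_norm]; norm_num
    _ ≤ ∫⁻ x, 2 ^ r * ‖maximalFn μ' 𝒩 g x‖ₑ ^ r ∂μ' := lintegral_mono' hle le_rfl
    _ = 2 ^ r * ∫⁻ x, ‖maximalFn μ' 𝒩 g x‖ₑ ^ r ∂μ' := lintegral_const_mul' _ _ (by simp)
    _ ≤ 2 ^ r * (N ^ r * ∫⁻ x, ‖g x‖ₑ ^ r ∂μ') := by gcongr
    _ ≤ 2 ^ r * (N ^ r * ((4 * m) ^ r * (2 * μ F))) := by
        gcongr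
        calc ∫⁻ x, ‖g x‖ₑ ^ r ∂μ' ≤ ∫⁻ x, (4 * m) ^ r ∂μ' := by
              refine lintegral_mono fun x => ENNReal.rpow_le_rpow ?_ hr0.le
              rw [← hk]
              exact ENNReal.coe_le_coe.2 (hgk x)
          _ = (4 * m) ^ r * μ' Set.univ := lintegral_const _
          _ ≤ _ := by gcongr
    _ = _ := by
        rw [show (8 : ℝ≥0∞) * N * m = 2 * (N * (4 * m)) by ring,
          ENNReal.mul_rpow_of_nonneg 2 _ hr0.le, ENNReal.mul_rpow_of_nonneg N _ hr0.le]
        ring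

/-- Boundedness of the lattice maximal operators on one `L^r` implies boundedness on all `L^p`, by
domination of the maximal function by a sparse operator. -/
theorem MaximalBound.exists_of_exponent {r : ℝ} {N : ℝ≥0} (hr : 1 < r)
    (hN : MaximalBound X E r N) {p : ℝ} (hp : 1 < p) : ∃ N' : ℝ≥0, MaximalBound X E p N' := by
  classical
  have hr0 : 0 < r := by linarith
  have hp0 : 0 < p := by linarith
  have hpq := Real.HolderConjugate.conjExponent hp
  set q := p.conjExponent
  -- So large that, by Chebyshev's inequality, exceeding `A` times the average of the norm over a
  -- stopping set happens on at most a quarter of that set.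
  set A : ℝ≥0 := 64 * (N + 1) with hA
  have hA1 : 1 ≤ A := by
    rw [hA]
    calc (1 : ℝ≥0) ≤ 64 * 1 := by norm_num
      _ ≤ _ := by gcongr; exact le_add_self
  have hK : ((2 * carlesonConst p : ℝ≥0∞) ^ (1 / p) * (2 * carlesonConst q) ^ (1 / q)) ≠ ∞ :=
    ENNReal.mul_ne_top
      (ENNReal.rpow_ne_top_of_nonneg hpq.one_div_nonneg (ENNReal.mul_ne_top (by simp) (by simp)))
      (ENNReal.rpow_ne_top_of_nonneg hpq.symm.one_div_nonneg
        (ENNReal.mul_ne_top (by simp) (by simp)))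
  obtain ⟨K, hK'⟩ : ∃ K : ℝ≥0, (K : ℝ≥0∞) = _ := ⟨_, ENNReal.coe_toNNReal hK⟩
  refine ⟨A * K, ?_⟩
  intro μ 𝒟₀ h₀ hm₀ hfin₀ f hfm hf0 hf
  -- Empty sets do not contribute to the maximal function.
  set 𝒟 := 𝒟₀.filter Set.Nonempty with h𝒟
  have hsub : 𝒟 ⊆ 𝒟₀ := Finset.filter_subset _ _
  have h : IsLaminar 𝒟 := h₀.mono hsub
  have hm : ∀ Q ∈ 𝒟, MeasurableSet Q := fun Q hQ => hm₀ Q (hsub hQ)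
  have hfin : ∀ Q ∈ 𝒟, μ Q ≠ ∞ := fun Q hQ => hfin₀ Q (hsub hQ)
  have hmax𝒟 : ∀ x, maximalFn μ 𝒟₀ f x ≤ maximalFn μ 𝒟 f x := fun x =>
    maximalFn_le (maximalFn_nonneg _ _ _) fun Q hQ hx =>
      setAverage_le_maximalFn f (Finset.mem_filter.2 ⟨hQ, ⟨x, hx⟩⟩) hx
  set u : X → ℝ≥0 := fun x => ‖f x‖₊ with hu
  have hum : Measurable u := hfm.nnnorm.measurable
  have hui : ∀ Q ∈ 𝒟, ⨍⁻ x in Q, (u x : ℝ≥0∞) ∂μ ≠ ∞ := by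
    intro Q hQ
    rcases eq_or_ne (μ Q) 0 with h0 | h0
    · rw [setLAverage_eq, Measure.restrict_eq_zero.2 h0]; simp
    rw [setLAverage_eq]
    exact ENNReal.div_ne_top
      (MemLp.integrableOn_of_measure_ne_top hp.le hf (hfin Q hQ)).2.ne h0
  set av : Set X → ℝ≥0∞ := fun Q => ⨍⁻ x in Q, (u x : ℝ≥0∞) ∂μ with hav
  set good : Set X → Finset (Set X) := fun F => 𝒟.filter fun R => R ⊆ F ∧ av R ≤ 4 * av F
    with hgood
  set s : Set X → Set X → Prop := fun F Q => 4 * av F < av Q ∨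
    A * av F < ‖posSup ((good F).filter (Q ⊆ ·)) fun R => ⨍ y in R, f y ∂μ‖ₑ with hs
  obtain ⟨π, hπ⟩ := h.exists_isStoppingProjection (fun Q hQ => (Finset.mem_filter.1 hQ).2) s
  have hpack : ∀ R ∈ 𝒟, ∑ F ∈ stoppingSets 𝒟 π with F ⊆ R, μ F ≤ 2 * μ R := by
    intro R _
    refine hπ.sum_measure_le h hm hfin (fun F hF => ?_) R
    set B := {x ∈ F | A * av F < ‖maximalFn μ (good F) f x‖ₑ} with hB
    refine ⟨(⋃ Q ∈ 𝒟.filter fun Q => Q ⊆ F ∧ 4 * av F < av Q, Q) ∪ B, ?_, ?_⟩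
    · have h1 : μ (⋃ Q ∈ 𝒟.filter fun Q => Q ⊆ F ∧ 4 * av F < av Q, Q) ≤ μ F / 4 :=
        h.measure_stopped_average_le hm (fun x => (u x : ℝ≥0∞)) (hfin F hF) (hui F hF)
      have h2 : μ B ≤ μ F / 4 := by
        have hgs : good F ⊆ 𝒟 := Finset.filter_subset _ _
        have key := hN.lintegral_le_of_average_le hr (h.mono hgs) (fun Q hQ => hm Q (hgs hQ)) hfm
          hf0 (hm F hF) (hfin F hF) (hui F hF) (fun Q hQ => (Finset.mem_filter.1 hQ).2.1)
          (fun Q hQ => (Finset.mem_filter.1 hQ).2.2)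
        have hmm := stronglyMeasurable_maximalFn (μ := μ) (fun Q hQ => hm Q (hgs hQ)) f
        rcases eq_or_ne (av F) 0 with h0 | h0
        · have hBe : B = ∅ := by
            refine Set.eq_empty_of_forall_notMem fun x hx => ?_
            have h1 : maximalFn μ (good F) f x = 0 := by
              refine le_antisymm (maximalFn_le le_rfl fun Q hQ _ => ?_) (maximalFn_nonneg _ _ _)
              have := (enorm_setAverage_le (μ := μ) f Q).trans (Finset.mem_filter.1 hQ).2.2
              rw [h0, mul_zero, nonpos_iff_eq_zero, enorm_eq_zero] at this
              exact this.le
            have := hx.2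
            rw [h1] at this
            simp at this
          simp [hBe]
        have hAF0 : (A * av F) ^ r ≠ 0 := by
          have : (A : ℝ≥0∞) ≠ 0 := by
            simpa using (one_pos.trans_le hA1).ne'
          simp [this, h0, hr0, hr0.le]
        have hAFt : (A * av F) ^ r ≠ ∞ := ENNReal.rpow_ne_top_of_nonneg hr0.le
          (ENNReal.mul_ne_top ENNReal.coe_ne_top (hui F hF))
        rw [ENNReal.le_div_iff_mul_le (by simp) (by simp), mul_comm]
        refine (ENNReal.mul_le_mul_iff_right hAF0 hAFt).1 ?_
        calc (A * av F) ^ r * (4 * μ B) = 4 * ∫⁻ _ in B, (A * av F) ^ r ∂μ := by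
              rw [setLIntegral_const]; ring
          _ ≤ 4 * ∫⁻ x in B, ‖maximalFn μ (good F) f x‖ₑ ^ r ∂μ := by
              gcongr 4 * ?_
              refine setLIntegral_mono' ((hm F hF).inter
                (measurableSet_lt measurable_const hmm.enorm)) fun x hx => ?_
              exact ENNReal.rpow_le_rpow hx.2.le hr0.le
          _ ≤ 4 * ∫⁻ x in F, ‖maximalFn μ (good F) f x‖ₑ ^ r ∂μ := by
              gcongr
              exact fun x hx => hx.1
          _ ≤ 4 * (2 * (8 * N * av F) ^ r * μ F) := by gcongr; exact key
          _ = 8 * (8 * N * av F) ^ r * μ F := by ring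
          _ ≤ 8 ^ r * (8 * N * av F) ^ r * μ F := by
              gcongr
              exact ENNReal.le_rpow_self_of_one_le (by norm_num) hr.le
          _ = (64 * N * av F) ^ r * μ F := by
              rw [← ENNReal.mul_rpow_of_nonneg _ _ hr0.le]
              congr 2
              ring
          _ ≤ (A * av F) ^ r * μ F := by
              gcongr
              rw [hA]
              push_cast
              gcongr
              exact le_self_add
      calc _ ≤ μ F / 4 + μ F / 4 := (measure_union_le _ _).trans (add_le_add h1 h2)
        _ = μ F / 2 := by
          rw [← two_mul, ← mul_div_assoc, mul_comm, show (4 : ℝ≥0∞) = 2 * 2 by norm_num]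
          exact ENNReal.mul_div_mul_right _ _ (by simp) (by simp)
    · intro Q hQ hQF hsFQ
      rcases hsFQ with h1 | h1
      · exact fun x hx => Or.inl (Set.mem_biUnion
          (Finset.mem_filter.2 ⟨hQ, hQF.1, h1⟩) hx)
      · refine fun x hx => Or.inr ⟨hQF.1 hx, h1.trans_le ?_⟩
        refine enorm_le_enorm_of_nonneg_of_le (posSup_nonneg _ _) ?_
        refine posSup_le (maximalFn_nonneg _ _ _) fun R hR => ?_
        exact setAverage_le_maximalFn f (Finset.mem_filter.1 hR).1 ((Finset.mem_filter.1 hR).2 hx)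
  -- Domination by the sparse operator.
  have hdom : ∀ x, ‖maximalFn μ 𝒟 f x‖ₑ ≤
      A * ∑ F ∈ stoppingSets 𝒟 π, F.indicator (fun _ => av F) x := by
    intro x
    set piece : Set X → E := fun F =>
      posSup (𝒟.filter fun R => π R = F ∧ x ∈ R) fun R => ⨍ y in R, f y ∂μ with hpiece
    have h1 : maximalFn μ 𝒟 f x ≤ ∑ F ∈ stoppingSets 𝒟 π, piece F := by
      have hnn : ∀ F ∈ stoppingSets 𝒟 π, 0 ≤ piece F := fun F _ => posSup_nonneg _ _
      refine maximalFn_le (Finset.sum_nonneg hnn) fun R hR hx => ?_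
      refine le_trans ?_ (Finset.single_le_sum hnn
        (mem_stoppingSets.2 ⟨hπ.mem R hR, hπ.idem R hR⟩))
      exact le_posSup (fun R => ⨍ y in R, f y ∂μ) (Finset.mem_filter.2 ⟨hR, rfl, hx⟩)
    have h2 : ∀ F ∈ stoppingSets 𝒟 π, ‖piece F‖ₑ ≤ A * F.indicator (fun _ => av F) x := by
      intro F hF
      obtain ⟨hFD, hFF⟩ := mem_stoppingSets.1 hF
      rcases (𝒟.filter fun R => π R = F ∧ x ∈ R).eq_empty_or_nonempty with he | hne
      · have : piece F = 0 := by simp [hpiece, he, posSup]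
        simp [this]
      obtain ⟨Q, hQ⟩ := Finset.exists_minimal hne
      obtain ⟨hQD, hQF, hxQ⟩ := Finset.mem_filter.1 hQ.prop
      have hQleF : Q ⊆ F := hQF ▸ hπ.le Q hQD
      have hQR : ∀ R ∈ 𝒟, π R = F → x ∈ R → Q ⊆ R := by
        intro R hR hRF hxR
        rcases h Q hQD R hR with h3 | h3 | h3
        · exact h3
        · exact hQ.le_of_le (Finset.mem_filter.2 ⟨hR, hRF, hxR⟩) h3
        · exact (Set.disjoint_left.1 h3 hxQ hxR).elim
      rw [Set.indicator_of_mem (hQleF hxQ)]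
      by_cases hQeq : Q = F
      · have h3 : piece F ≤ ⨍ y in F, f y ∂μ := by
          refine posSup_le (setAverage_nonneg hf0 F) fun R hR => ?_
          obtain ⟨hR, hRF, hxR⟩ := Finset.mem_filter.1 hR
          have : R = F := Set.Subset.antisymm (hRF ▸ hπ.le R hR) (hQeq ▸ hQR R hR hRF hxR)
          rw [this]
        calc ‖piece F‖ₑ ≤ av F := (enorm_le_enorm_of_nonneg_of_le (posSup_nonneg _ _) h3).trans
              (enorm_setAverage_le f F)
          _ ≤ A * av F := le_mul_of_one_le_left zero_le (by exact_mod_cast hA1)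
      · have hns : ¬ s F Q := hQF ▸ hπ.not_stop Q hQD (by rw [hQF]; exact Ne.symm hQeq)
        refine le_trans ?_ (not_lt.1 (not_or.1 hns).2)
        refine enorm_le_enorm_of_nonneg_of_le (posSup_nonneg _ _) (posSup_mono _ fun R hR => ?_)
        obtain ⟨hR, hRF, hxR⟩ := Finset.mem_filter.1 hR
        refine Finset.mem_filter.2 ⟨Finset.mem_filter.2 ⟨hR, hRF ▸ hπ.le R hR, ?_⟩,
          hQR R hR hRF hxR⟩
        by_cases hReq : R = F
        · rw [hReq]
          exact le_mul_of_one_le_left zero_le (by norm_num)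
        · have := hπ.not_stop R hR (by rw [hRF]; exact Ne.symm hReq)
          rw [hRF] at this
          exact not_lt.1 (not_or.1 this).1
    calc ‖maximalFn μ 𝒟 f x‖ₑ ≤ ‖∑ F ∈ stoppingSets 𝒟 π, piece F‖ₑ :=
          enorm_le_enorm_of_nonneg_of_le (maximalFn_nonneg _ _ _) h1
      _ ≤ ∑ F ∈ stoppingSets 𝒟 π, ‖piece F‖ₑ := enorm_sum_le _ _
      _ ≤ _ := by rw [Finset.mul_sum]; exact Finset.sum_le_sum h2
  calc ∫⁻ x, ‖maximalFn μ 𝒟₀ f x‖ₑ ^ p ∂μ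
      ≤ ∫⁻ x, (A : ℝ≥0∞) ^ p *
          (∑ F ∈ stoppingSets 𝒟 π, F.indicator (fun _ => av F) x) ^ p ∂μ := by
        refine lintegral_mono fun x => ?_
        rw [← ENNReal.mul_rpow_of_nonneg _ _ hp0.le]
        exact ENNReal.rpow_le_rpow ((enorm_le_enorm_of_nonneg_of_le (maximalFn_nonneg _ _ _)
          (hmax𝒟 x)).trans (hdom x)) hp0.le
    _ = (A : ℝ≥0∞) ^ p *
          ∫⁻ x, (∑ F ∈ stoppingSets 𝒟 π, F.indicator (fun _ => av F) x) ^ p ∂μ :=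
        lintegral_const_mul' _ _ (ENNReal.rpow_ne_top_of_nonneg hp0.le ENNReal.coe_ne_top)
    _ ≤ (A : ℝ≥0∞) ^ p * ((K : ℝ≥0∞) ^ p * ∫⁻ x, (u x : ℝ≥0∞) ^ p ∂μ) := by
        gcongr
        rw [hK']
        exact h.lintegral_sparse_rpow_le hm hfin hpack hum hui hpq
    _ = _ := by
        rw [← mul_assoc, ← ENNReal.mul_rpow_of_nonneg _ _ hp0.le]
        push_cast
        rfl

theorem abs_setAverage_le {μ : Measure X} {f : X → E} {Q : Set X} (hf : IntegrableOn f Q μ) :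
    |⨍ y in Q, f y ∂μ| ≤ ⨍ y in Q, |f y| ∂μ :=
  abs_integral_le_integral_abs hf.to_average

/-- Every function has a strongly measurable nonnegative version of its absolute value. -/
theorem exists_stronglyMeasurable_abs {μ : Measure X} {f : X → E}
    (hf : AEStronglyMeasurable f μ) :
    ∃ g : X → E, StronglyMeasurable g ∧ 0 ≤ g ∧ (fun x => |f x|) =ᵐ[μ] g := by
  refine ⟨fun x => |hf.mk f x|, ?_, fun x => abs_nonneg _, ?_⟩
  · exact hf.stronglyMeasurable_mk.sup hf.stronglyMeasurable_mk.neg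
  · filter_upwards [hf.ae_eq_mk] with x hx
    rw [hx]

theorem ENNReal.le_sInf_mul {ι : Type*} {P : ι → Prop} {a b : ι → ℝ≥0∞}
    (hb : ∀ i, P i → b i ≠ ∞) (hne : sInf {K : ℝ≥0∞ | ∀ i, P i → a i ≤ K * b i} ≠ ∞) {i : ι}
    (hi : P i) : a i ≤ sInf {K : ℝ≥0∞ | ∀ i, P i → a i ≤ K * b i} * b i := by
  rcases eq_or_ne (b i) 0 with h0 | h0
  · obtain ⟨K, hK, -⟩ := sInf_lt_iff.1 hne.lt_top
    have := hK i hi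
    rw [h0, mul_zero] at this ⊢
    exact this
  · rw [← ENNReal.div_le_iff h0 (hb i hi)]
    exact le_sInf fun K hK => (ENNReal.div_le_iff h0 (hb i hi)).2 (hK i hi)

variable {d : ℕ}

theorem eLpNorm_le_operatorNorm_mul {F : Type*} [NormedAddCommGroup F] [NormedSpace ℝ F]
    [Lattice F] {p q : ℝ} {μ ν : Measure (Fin d → ℝ)}
    {T : ((Fin d → ℝ) → E) → ((Fin d → ℝ) → F)} (h : operatorNorm p q μ ν T ≠ ∞)
    {f : (Fin d → ℝ) → E} (hf : MemLp f (ENNReal.ofReal p) μ) :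
    eLpNorm (T f) (ENNReal.ofReal q) ν ≤
      operatorNorm p q μ ν T * eLpNorm f (ENNReal.ofReal p) μ :=
  ENNReal.le_sInf_mul (P := fun f : (Fin d → ℝ) → E => MemLp f (ENNReal.ofReal p) μ)
    (fun _ hf => hf.2.ne) h hf

theorem eLpNorm_latticeMaximal_le {p : ℝ} (hp : 1 < p) {N : ℝ≥0∞}
    (hN : MaximalBound (Fin d → ℝ) E p N) (𝒟 : Finset (DyadicCube d)) {f : (Fin d → ℝ) → E}
    (hf : MemLp f (ENNReal.ofReal p) volume) :
    eLpNorm (latticeMaximal 𝒟 f) (ENNReal.ofReal p) volume ≤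
      N * eLpNorm f (ENNReal.ofReal p) volume := by
  classical
  have hp0 : 0 < p := by linarith
  obtain ⟨g, hgm, hg0, hgf⟩ := exists_stronglyMeasurable_abs hf.1
  have hgnorm : eLpNorm g (ENNReal.ofReal p) volume = eLpNorm f (ENNReal.ofReal p) volume := by
    rw [← eLpNorm_congr_ae hgf]
    exact eLpNorm_congr_norm_ae (Filter.Eventually.of_forall fun x => norm_abs_eq_norm _)
  have hgmem : MemLp g (ENNReal.ofReal p) volume :=
    ⟨hgm.aestronglyMeasurable, by rw [hgnorm]; exact hf.2⟩
  set 𝒟' := 𝒟.image DyadicCube.toSet with h𝒟'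
  have hprop : ∀ S ∈ 𝒟', MeasurableSet S ∧ volume S ≠ ∞ := by
    intro S hS
    obtain ⟨Q, -, rfl⟩ := Finset.mem_image.1 hS
    exact ⟨Q.measurableSet_toSet, Q.volume_toSet_ne_top⟩
  have hlam : IsLaminar 𝒟' := by
    intro S hS S' hS'
    obtain ⟨Q, -, rfl⟩ := Finset.mem_image.1 hS
    obtain ⟨Q', -, rfl⟩ := Finset.mem_image.1 hS'
    exact Q.subset_or_subset_or_disjoint Q'
  have key := hN volume 𝒟' hlam (fun S hS => (hprop S hS).1) (fun S hS => (hprop S hS).2) g hgm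
    hg0 hgmem
  have hle : ∀ x, |latticeMaximal 𝒟 f x| ≤ maximalFn volume 𝒟' g x := by
    intro x
    have hQ : ∀ Q ∈ 𝒟, |Q.toSet.indicator (fun _ => ⨍ y in Q.toSet, f y) x| ≤
        maximalFn volume 𝒟' g x := by
      intro Q hQ
      by_cases hx : x ∈ Q.toSet
      · rw [Set.indicator_of_mem hx]
        refine (abs_setAverage_le (MemLp.integrableOn_of_measure_ne_top hp.le hf
          Q.volume_toSet_ne_top)).trans ?_
        rw [average_congr (ae_restrict_of_ae hgf)]
        exact setAverage_le_maximalFn g (Finset.mem_image_of_mem _ hQ) hx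
      · rw [Set.indicator_of_notMem hx, abs_zero]
        exact maximalFn_nonneg _ _ _
    unfold latticeMaximal
    split_ifs with hne
    · obtain ⟨Q, hQD⟩ := hne
      refine abs_le'.2 ⟨Finset.sup'_le _ _ fun Q hQD => (le_abs_self _).trans (hQ Q hQD), ?_⟩
      refine le_trans (neg_le_neg ?_) ((neg_le_abs _).trans (hQ Q hQD))
      exact Finset.le_sup' (fun Q : DyadicCube d =>
        Q.toSet.indicator (fun _ => ⨍ y in Q.toSet, f y) x) hQD
    · rw [abs_zero]
      exact maximalFn_nonneg _ _ _
  rw [← ENNReal.rpow_le_rpow_iff hp0, ENNReal.mul_rpow_of_nonneg _ _ hp0.le, ← hgnorm,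
    eLpNorm_rpow_eq_lintegral hp0, eLpNorm_rpow_eq_lintegral hp0]
  refine le_trans (lintegral_mono fun x => ENNReal.rpow_le_rpow ?_ hp0.le) key
  rw [← enorm_abs_eq]
  exact enorm_le_enorm_of_nonneg_of_le (abs_nonneg _) (hle x)

theorem latticeMaximalNorm_lt_top (hd : 0 < d) (hE : HasDyadicHardyLittlewood d E) {p : ℝ}
    (hp : 1 < p) : latticeMaximalNorm d E p < ∞ := by
  obtain ⟨r, hr, K, hK⟩ := hE
  have h1 : MaximalBound (Fin d → ℝ) E r (4 * K : ℝ≥0) := by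
    rw [ENNReal.coe_mul]
    refine maximalBound_of_lebesgue hd hr fun 𝒟 f hf => ?_
    refine (eLpNorm_le_operatorNorm_mul ((hK 𝒟).trans_lt ENNReal.coe_lt_top).ne hf).trans ?_
    gcongr
    exact hK 𝒟
  obtain ⟨N', hN'⟩ := h1.exists_of_exponent hr hp
  refine lt_of_le_of_lt (iSup_le fun 𝒟 => sInf_le ?_) (ENNReal.coe_lt_top (r := N'))
  exact fun f hf => eLpNorm_latticeMaximal_le hp hN' 𝒟 hf

theorem maximalBound_latticeMaximalNorm (hd : 0 < d) {p : ℝ} (hp : 1 < p)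
    (h : latticeMaximalNorm d E p < ∞) : MaximalBound X E p (4 * latticeMaximalNorm d E p) := by
  refine maximalBound_of_lebesgue hd hp fun 𝒟 f hf => ?_
  have h1 := le_iSup (fun 𝒟 : Finset (DyadicCube d) => operatorNorm p p volume volume
    (latticeMaximal 𝒟 : ((Fin d → ℝ) → E) → ((Fin d → ℝ) → E))) 𝒟
  refine (eLpNorm_le_operatorNorm_mul (h1.trans_lt h).ne hf).trans ?_
  gcongr
  exact h1

end Exponent

/-! ### Parallel stopping sets -/

section Parallel

theorem ENNReal.sum_rpow_le_rpow_sum {ι : Type*} (s : Finset ι) (a : ι → ℝ≥0∞) {r : ℝ}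
    (hr : 1 ≤ r) : ∑ i ∈ s, a i ^ r ≤ (∑ i ∈ s, a i) ^ r := by
  classical
  induction s using Finset.induction_on with
  | empty => simp
  | insert i s hi ih =>
    rw [Finset.sum_insert hi, Finset.sum_insert hi]
    exact (add_le_add le_rfl ih).trans (ENNReal.add_rpow_le_rpow_add _ _ hr)

variable {X : Type*} {𝒟 : Finset (Set X)} {s s' : Set X → Set X → Prop} {π ρ : Set X → Set X}

/-- The maximal stopping sets strictly contained in `F`. -/
def stoppingChildren (𝒟 : Finset (Set X)) (π : Set X → Set X) (F : Set X) : Finset (Set X) :=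
  maximalSets (stoppingBelow 𝒟 π F)

theorem mem_of_mem_stoppingChildren {F F' : Set X} (h : F' ∈ stoppingChildren 𝒟 π F) :
    (F' ∈ 𝒟 ∧ π F' = F') ∧ F' ⊂ F :=
  mem_stoppingBelow.1 (maximalSets_subset _ h)

theorem IsLaminar.pairwiseDisjoint_stoppingChildren (h : IsLaminar 𝒟) (F : Set X) :
    (stoppingChildren 𝒟 π F : Set (Set X)).PairwiseDisjoint id :=
  (h.mono fun _ hQ => (mem_stoppingBelow.1 hQ).1.1).pairwiseDisjoint_maximalSets

theorem subset_of_mem_stoppingChildren {F F' G : Set X} (h : F' ∈ stoppingChildren 𝒟 π F)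
    (hG : G ∈ 𝒟) (hGG : π G = G) (hF'G : F' ⊂ G) (hGF : G ⊆ F) : F ⊆ G := by
  by_contra h1
  exact hF'G.2 ((mem_maximalSets.1 h).le_of_ge
    (mem_stoppingBelow.2 ⟨⟨hG, hGG⟩, hGF, h1⟩) hF'G.1)

theorem IsLaminar.eq_of_mem_stoppingChildren (h : IsLaminar 𝒟) (hne : ∀ Q ∈ 𝒟, Q.Nonempty)
    {F₁ F₂ F' : Set X} (hF₁ : F₁ ∈ stoppingSets 𝒟 π) (hF₂ : F₂ ∈ stoppingSets 𝒟 π)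
    (h₁ : F' ∈ stoppingChildren 𝒟 π F₁) (h₂ : F' ∈ stoppingChildren 𝒟 π F₂) : F₁ = F₂ := by
  obtain ⟨a₁, b₁⟩ := mem_stoppingSets.1 hF₁
  obtain ⟨a₂, b₂⟩ := mem_stoppingSets.1 hF₂
  obtain ⟨⟨a, -⟩, c₁⟩ := mem_of_mem_stoppingChildren h₁
  have c₂ := (mem_of_mem_stoppingChildren h₂).2
  rcases h F₁ a₁ F₂ a₂ with h3 | h3 | h3
  · exact h3.antisymm (subset_of_mem_stoppingChildren h₂ a₁ b₁ c₁ h3)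
  · exact (subset_of_mem_stoppingChildren h₁ a₂ b₂ c₂ h3).antisymm h3
  · obtain ⟨x, hx⟩ := hne F' a
    exact (Set.disjoint_left.1 h3 (c₁.1 hx) (c₂.1 hx)).elim

variable [MeasurableSpace X] {σ ω : Measure X}

open Classical in
/-- The bookkeeping for two stopping projections `π` and `ρ`: if `r F` consists of `π`-children `F'`
of `F` with `ρ F' ⊆ F`, then the children associated with a fixed `ρ`-stopping set `G` are either
equal to `G` or pairwise disjoint subsets of `G` with a common parent. -/
theorem IsLaminar.sum_children_le (h : IsLaminar 𝒟) (hne : ∀ Q ∈ 𝒟, Q.Nonempty)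
    (hm : ∀ Q ∈ 𝒟, MeasurableSet Q) (hπ : IsStoppingProjection 𝒟 s π)
    (hρ : IsStoppingProjection 𝒟 s' ρ) (r : Set X → Finset (Set X))
    (hr : ∀ F, r F ⊆ stoppingChildren 𝒟 π F) (hrρ : ∀ F ∈ stoppingSets 𝒟 π, ∀ F' ∈ r F, ρ F' ⊆ F)
    {G : Set X} (hG : G ∈ 𝒟) :
    ∑ F ∈ stoppingSets 𝒟 π, ∑ F' ∈ r F with ρ F' = G, ω F' ≤ 2 * ω G := by
  have hsplit : ∀ F ∈ stoppingSets 𝒟 π, ∑ F' ∈ r F with ρ F' = G, ω F' ≤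
      (if G ∈ r F then ω G else 0) +
      (if F = π G then ∑ F' ∈ stoppingChildren 𝒟 π F with F' ⊆ G, ω F' else 0) := by
    intro F hF
    obtain ⟨hFD, hFF⟩ := mem_stoppingSets.1 hF
    rw [← Finset.sum_filter_add_sum_filter_not _ (· = G)]
    refine add_le_add ?_ ?_
    · split_ifs with hGr
      · calc _ ≤ ∑ F' ∈ {G}, ω F' := Finset.sum_le_sum_of_subset fun F' hF' =>
              Finset.mem_singleton.2 (Finset.mem_filter.1 hF').2
          _ = _ := Finset.sum_singleton _ _
      · refine (Finset.sum_eq_zero fun F' hF' => ?_).le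
        obtain ⟨h1, rfl⟩ := Finset.mem_filter.1 hF'
        exact (hGr (Finset.mem_filter.1 h1).1).elim
    · have hFG : ∀ F' ∈ ((r F).filter (ρ · = G)).filter (¬ · = G),
          F' ∈ stoppingChildren 𝒟 π F ∧ F' ⊆ G ∧ F = π G := by
        intro F' hF'
        obtain ⟨h1, hne'⟩ := Finset.mem_filter.1 hF'
        obtain ⟨h1, hρG⟩ := Finset.mem_filter.1 h1
        have hch := hr F h1
        obtain ⟨⟨a, b⟩, c⟩ := mem_of_mem_stoppingChildren hch
        have h2 : F' ⊆ G := hρG ▸ hρ.le F' a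
        have h3 : G ⊆ F := hρG ▸ hrρ F hF F' h1
        have h4 : π G ⊆ F := hFF ▸ hπ.mono G hG F hFD h3
        refine ⟨hch, h2, Set.Subset.antisymm ?_ h4⟩
        exact subset_of_mem_stoppingChildren hch (hπ.mem G hG) (hπ.idem G hG)
          ((h2.ssubset_of_ne hne').trans_subset (hπ.le G hG)) h4
      split_ifs with hFeq
      · exact Finset.sum_le_sum_of_subset fun F' hF' =>
          Finset.mem_filter.2 ⟨(hFG F' hF').1, (hFG F' hF').2.1⟩
      · exact (Finset.sum_eq_zero fun F' hF' => (hFeq (hFG F' hF').2.2).elim).le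
  refine (Finset.sum_le_sum hsplit).trans ?_
  rw [Finset.sum_add_distrib, two_mul]
  refine add_le_add ?_ ?_
  · rw [← Finset.sum_filter, Finset.sum_const]
    have hcard : ((stoppingSets 𝒟 π).filter (G ∈ r ·)).card ≤ 1 := by
      refine Finset.card_le_one.2 fun F₁ h₁ F₂ h₂ => ?_
      obtain ⟨a₁, b₁⟩ := Finset.mem_filter.1 h₁
      obtain ⟨a₂, b₂⟩ := Finset.mem_filter.1 h₂
      exact h.eq_of_mem_stoppingChildren hne a₁ a₂ (hr _ b₁) (hr _ b₂)
    exact (nsmul_le_nsmul_left zero_le hcard).trans_eq (one_nsmul _)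
  · rw [Finset.sum_ite_eq' (stoppingSets 𝒟 π) (π G),
      if_pos (mem_stoppingSets.2 ⟨hπ.mem G hG, hπ.idem G hG⟩)]
    have hd : (((stoppingChildren 𝒟 π (π G)).filter (· ⊆ G) : Finset (Set X)) :
        Set (Set X)).PairwiseDisjoint id :=
      (h.pairwiseDisjoint_stoppingChildren (π G)).subset
        (by exact_mod_cast Finset.filter_subset _ _)
    have h1 := measure_biUnion_finset (μ := ω) hd fun F' hF' =>
      hm F' (mem_of_mem_stoppingChildren (Finset.mem_filter.1 hF').1).1.1
    calc _ = ω (⋃ F' ∈ (stoppingChildren 𝒟 π (π G)).filter (· ⊆ G), id F') := h1.symm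
      _ ≤ ω G := measure_mono (Set.iUnion₂_subset fun F' hF' => (Finset.mem_filter.1 hF').2)

variable {E F : Type*} [NormedAddCommGroup E] [NormedSpace ℝ E]
  [CompleteSpace E] [Lattice E] [HasSolidNorm E] [IsOrderedAddMonoid E] [IsOrderedModule ℝ E]
  [NormedAddCommGroup F] [NormedSpace ℝ F]
  [Lattice F] [HasSolidNorm F] [IsOrderedAddMonoid F] [IsOrderedModule ℝ F]

/-- The positive operator `∑_Q Λ_Q (∫_Q f dσ) 1_Q` over a finite family of sets. -/
def positiveOp (𝒟 : Finset (Set X)) (Λ : Set X → E →ₚ[ℝ] F) (σ : Measure X) (f : X → E) (x : X) :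
    F :=
  ∑ Q ∈ 𝒟, Q.indicator (fun _ => Λ Q (∫ y in Q, f y ∂σ)) x

theorem stronglyMeasurable_positiveOp (hm : ∀ Q ∈ 𝒟, MeasurableSet Q) (Λ : Set X → E →ₚ[ℝ] F)
    (f : X → E) : StronglyMeasurable (positiveOp 𝒟 Λ σ f) :=
  Finset.stronglyMeasurable_fun_sum _ fun Q hQ => stronglyMeasurable_const.indicator (hm Q hQ)

theorem positiveOp_nonneg (𝒟 : Finset (Set X)) (Λ : Set X → E →ₚ[ℝ] F) {f : X → E} (hf : 0 ≤ f)
    (x : X) : 0 ≤ positiveOp 𝒟 Λ σ f x :=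
  Finset.sum_nonneg fun Q _ => Set.indicator_nonneg
    (fun _ _ => map_nonneg (Λ Q) (integral_nonneg hf)) x

open Classical in
/-- The testing condition for the localizations of a positive operator to the sets of the family,
for nonnegative functions. -/
def PositiveTesting (𝒟 : Finset (Set X)) (Λ : Set X → E →ₚ[ℝ] F) (p q : ℝ) (σ ω : Measure X)
    (T : ℝ≥0∞) : Prop :=
  ∀ R ∈ 𝒟, ∀ φ : X → E, 0 ≤ φ → MemLp φ ∞ (σ.restrict R) →
    eLpNorm (positiveOp (𝒟.filter (· ⊆ R)) Λ σ φ) (ENNReal.ofReal q) ω ≤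
      T * eLpNorm φ ∞ (σ.restrict R) * σ R ^ (1 / p)

open Classical in
/-- The part of the operator carried by one stopping set `A` is controlled by testing: `f` is
replaced by the supremum of its averages over the sets with projection `A`, a bounded function. -/
theorem IsLaminar.eLpNorm_positiveOp_stopping_le (h : IsLaminar 𝒟)
    (hm : ∀ Q ∈ 𝒟, MeasurableSet Q) (hσ : ∀ Q ∈ 𝒟, σ Q ≠ ∞) {Λ : Set X → E →ₚ[ℝ] F} {p q : ℝ}
    {T : ℝ≥0∞} (hT : PositiveTesting 𝒟 Λ p q σ ω T) (hπ : IsStoppingProjection 𝒟 s π)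
    {f : X → E} (hf0 : 0 ≤ f) {𝒟₁ : Finset (Set X)} (h𝒟₁ : 𝒟₁ ⊆ 𝒟) {A : Set X} (hA : A ∈ 𝒟)
    {b : ℝ≥0∞} (hb : b ≠ ∞) (hfb : ∀ Q ∈ 𝒟, π Q = A →
      ‖posSup (𝒟.filter (Q ⊆ ·)) fun R => ⨍ y in R, f y ∂σ‖ₑ ≤ b) :
    eLpNorm (positiveOp (𝒟₁.filter (π · = A)) Λ σ f) (ENNReal.ofReal q) ω ≤
      T * b * σ A ^ (1 / p) := by
  -- On each `Q` with `π Q = A` the function `φ` is at least the average of `f` over `Q`.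
  set φ : X → E := fun x =>
    posSup ((𝒟.filter fun Q => x ∈ Q).filter (π · = A)) fun R => ⨍ y in R, f y ∂σ with hφ
  have hφm : StronglyMeasurable φ := stronglyMeasurable_of_mem_pattern hm
    fun S => posSup (S.filter (π · = A)) fun R => ⨍ y in R, f y ∂σ
  have hφ0 : 0 ≤ φ := fun x => posSup_nonneg _ _
  have hφb : ∀ x, ‖φ x‖ₑ ≤ b := by
    intro x
    rcases ((𝒟.filter fun Q => x ∈ Q).filter (π · = A)).eq_empty_or_nonempty with he | hne
    · have : φ x = 0 := by simp [hφ, he, posSup]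
      simp [this]
    obtain ⟨Q, hQ⟩ := Finset.exists_minimal hne
    obtain ⟨hQ1, hQA⟩ := Finset.mem_filter.1 hQ.prop
    obtain ⟨hQD, hxQ⟩ := Finset.mem_filter.1 hQ1
    refine le_trans (enorm_le_enorm_of_nonneg_of_le (posSup_nonneg _ _)
      (posSup_mono _ fun R hR => ?_)) (hfb Q hQD hQA)
    obtain ⟨hR1, hRA⟩ := Finset.mem_filter.1 hR
    obtain ⟨hRD, hxR⟩ := Finset.mem_filter.1 hR1
    refine Finset.mem_filter.2 ⟨hRD, ?_⟩
    rcases h Q hQD R hRD with h3 | h3 | h3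
    · exact h3
    · exact hQ.le_of_le hR h3
    · exact (Set.disjoint_left.1 h3 hxQ hxR).elim
  have hφtop : ∀ μ : Measure X, MemLp φ ∞ μ := fun μ =>
    memLp_top_of_bound hφm.aestronglyMeasurable b.toReal (Filter.Eventually.of_forall fun x => by
      rw [← toReal_enorm]; exact ENNReal.toReal_mono hb (hφb x))
  have hle : ∀ x, positiveOp (𝒟₁.filter (π · = A)) Λ σ f x ≤
      positiveOp (𝒟.filter (· ⊆ A)) Λ σ φ x := by
    intro x
    have hterm : ∀ Q ∈ 𝒟₁.filter (π · = A), Q.indicator (fun _ => Λ Q (∫ y in Q, f y ∂σ)) x ≤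
        Q.indicator (fun _ => Λ Q (∫ y in Q, φ y ∂σ)) x := by
      intro Q hQ
      obtain ⟨hQ1, hQA⟩ := Finset.mem_filter.1 hQ
      have hQD := h𝒟₁ hQ1
      have : IsFiniteMeasure (σ.restrict Q) :=
        ⟨by rw [Measure.restrict_apply_univ]; exact (hσ Q hQD).lt_top⟩
      refine Set.indicator_le_indicator (OrderHomClass.mono (Λ Q) ?_)
      calc ∫ y in Q, f y ∂σ = ∫ _ in Q, (⨍ y in Q, f y ∂σ) ∂σ := by
            rw [setIntegral_const, Measure.real, measure_toReal_smul_setAverage f (hσ Q hQD)]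
        _ ≤ ∫ y in Q, φ y ∂σ := by
            refine setIntegral_mono_on (integrable_const _) ((hφtop _).integrable le_top)
              (hm Q hQD) fun y hy => ?_
            exact le_posSup (fun R => ⨍ y in R, f y ∂σ)
              (Finset.mem_filter.2 ⟨Finset.mem_filter.2 ⟨hQD, hy⟩, hQA⟩)
    refine (Finset.sum_le_sum hterm).trans ?_
    refine Finset.sum_le_sum_of_subset_of_nonneg (fun Q hQ => ?_) fun Q _ _ =>
      Set.indicator_nonneg (fun _ _ => map_nonneg (Λ Q) (integral_nonneg hφ0)) x
    obtain ⟨hQ1, hQA⟩ := Finset.mem_filter.1 hQ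
    exact Finset.mem_filter.2 ⟨h𝒟₁ hQ1, hQA ▸ hπ.le Q (h𝒟₁ hQ1)⟩
  calc _ ≤ eLpNorm (positiveOp (𝒟.filter (· ⊆ A)) Λ σ φ) (ENNReal.ofReal q) ω :=
        eLpNorm_mono_enorm fun x =>
          enorm_le_enorm_of_nonneg_of_le (positiveOp_nonneg _ _ hf0 x) (hle x)
    _ ≤ T * eLpNorm φ ∞ (σ.restrict A) * σ A ^ (1 / p) := hT A hA φ hφ0 (hφtop _)
    _ ≤ _ := by
        gcongr
        rw [eLpNorm_exponent_top]
        exact essSup_le_of_ae_le _ (Filter.Eventually.of_forall hφb)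

open Classical in
/-- Pairing the part of the operator carried by one stopping set `A` with a weight `v`: since this
part is constant on the children of `A`, the weight may be averaged over the children on which the
part does not vanish. -/
theorem IsLaminar.lintegral_positiveOp_stopping_mul_le (h : IsLaminar 𝒟)
    (hm : ∀ Q ∈ 𝒟, MeasurableSet Q) (hω : ∀ Q ∈ 𝒟, ω Q ≠ ∞) (Λ : Set X → E →ₚ[ℝ] F) {q q' : ℝ}
    (hq : q.HolderConjugate q') (hπ : IsStoppingProjection 𝒟 s π) (f : X → E)
    {𝒟₁ : Finset (Set X)} (h𝒟₁ : 𝒟₁ ⊆ 𝒟) {A : Set X} (hA : A ∈ stoppingSets 𝒟 π) {v : X → ℝ≥0}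
    (hv : Measurable v) :
    ∫⁻ x, ‖positiveOp (𝒟₁.filter (π · = A)) Λ σ f x‖ₑ * v x ∂ω ≤
      2 * eLpNorm (positiveOp (𝒟₁.filter (π · = A)) Λ σ f) (ENNReal.ofReal q) ω *
      (∫⁻ x in stoppingCore 𝒟 π A, (v x : ℝ≥0∞) ^ q' ∂ω +
        ∑ A' ∈ stoppingChildren 𝒟 π A with ∃ Q ∈ 𝒟₁, π Q = A ∧ A' ⊆ Q,
          (⨍⁻ x in A', v x ∂ω) ^ q' * ω A') ^ (1 / q') := by
  obtain ⟨hAD, hAA⟩ := mem_stoppingSets.1 hA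
  have hqp := hq.pos
  set S := positiveOp (𝒟₁.filter (π · = A)) Λ σ f with hS
  have hSm : StronglyMeasurable S := stronglyMeasurable_positiveOp
    (fun Q hQ => hm Q (h𝒟₁ (Finset.mem_filter.1 hQ).1)) Λ f
  set rel := (stoppingChildren 𝒟 π A).filter fun A' => ∃ Q ∈ 𝒟₁, π Q = A ∧ A' ⊆ Q with hrel
  set core := stoppingCore 𝒟 π A with hcore
  have hrelD : ∀ A' ∈ rel, A' ∈ 𝒟 := fun A' hA' =>
    (mem_of_mem_stoppingChildren (Finset.mem_filter.1 hA').1).1.1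
  have hreld : (rel : Set (Set X)).PairwiseDisjoint id :=
    (h.pairwiseDisjoint_stoppingChildren A).subset (by exact_mod_cast Finset.filter_subset _ _)
  set V := ∫⁻ x in core, (v x : ℝ≥0∞) ^ q' ∂ω + ∑ A' ∈ rel, (⨍⁻ x in A', v x ∂ω) ^ q' * ω A'
    with hV
  -- The constant value of `S` on a child.
  set c : Set X → F := fun A' =>
    ∑ Q ∈ (𝒟₁.filter (π · = A)).filter (A' ⊆ ·), Λ Q (∫ y in Q, f y ∂σ) with hc
  have hSc : ∀ A' ∈ stoppingChildren 𝒟 π A, ∀ x ∈ A', S x = c A' := by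
    intro A' hA' x hx
    obtain ⟨⟨a, b⟩, e⟩ := mem_of_mem_stoppingChildren hA'
    refine Eq.trans ?_ (Finset.sum_filter (A' ⊆ ·) _).symm
    refine Finset.sum_congr rfl fun Q hQ => ?_
    obtain ⟨hQ1, hQA⟩ := Finset.mem_filter.1 hQ
    by_cases hAQ : A' ⊆ Q
    · rw [if_pos hAQ, Set.indicator_of_mem (hAQ hx)]
    · rw [if_neg hAQ]
      refine Set.indicator_of_notMem (fun hxQ => ?_) _
      rcases h A' a Q (h𝒟₁ hQ1) with h3 | h3 | h3
      · exact hAQ h3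
      · have := hπ.mono Q (h𝒟₁ hQ1) A' a h3
        rw [hQA, b] at this
        exact e.2 this
      · exact Set.disjoint_left.1 h3 hx hxQ
  have hsupp : (fun x => ‖S x‖ₑ * (v x : ℝ≥0∞)).support ⊆ core ∪ ⋃ A' ∈ rel, A' := by
    intro x hx
    have hSx : S x ≠ 0 := by
      intro h0
      simp [h0] at hx
    obtain ⟨Q, hQ, hQx⟩ := Finset.exists_ne_zero_of_sum_ne_zero hSx
    have hxQ : x ∈ Q := by
      by_contra h0
      exact hQx (Set.indicator_of_notMem h0 _)
    obtain ⟨hQ1, hQA⟩ := Finset.mem_filter.1 hQ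
    have hxA : x ∈ A := hQA ▸ hπ.le Q (h𝒟₁ hQ1) hxQ
    by_cases hxc : x ∈ core
    · exact Or.inl hxc
    right
    have h1 : x ∈ ⋃ A' ∈ stoppingBelow 𝒟 π A, A' := by
      by_contra h2
      exact hxc ⟨hxA, h2⟩
    rw [← biUnion_maximalSets] at h1
    obtain ⟨A', hA', hxA'⟩ := Set.mem_iUnion₂.1 h1
    refine Set.mem_biUnion (Finset.mem_filter.2 ⟨hA', ?_⟩) hxA'
    by_contra hno
    refine hSx ((hSc A' hA' x hxA').trans (Finset.sum_eq_zero fun R hR => ?_))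
    obtain ⟨hR1, hR2⟩ := Finset.mem_filter.1 hR
    exact (hno ⟨R, (Finset.mem_filter.1 hR1).1, (Finset.mem_filter.1 hR1).2, hR2⟩).elim
  have hN : eLpNorm S (ENNReal.ofReal q) ω = (∫⁻ x, ‖S x‖ₑ ^ q ∂ω) ^ (1 / q) := by
    rw [← eLpNorm_rpow_eq_lintegral hqp, ← ENNReal.rpow_mul, mul_one_div_cancel hqp.ne',
      ENNReal.rpow_one]
  have h1 : ∫⁻ x in core, ‖S x‖ₑ * v x ∂ω ≤ eLpNorm S (ENNReal.ofReal q) ω * V ^ (1 / q') := by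
    refine (ENNReal.lintegral_mul_le_Lp_mul_Lq _ hq hSm.enorm.aemeasurable
      hv.coe_nnreal_ennreal.aemeasurable).trans ?_
    rw [hN]
    gcongr
    · exact Measure.restrict_le_self
    · exact hq.symm.one_div_nonneg
    · exact le_self_add
  have h2 : ∫⁻ x in ⋃ A' ∈ rel, A', ‖S x‖ₑ * v x ∂ω ≤
      eLpNorm S (ENNReal.ofReal q) ω * V ^ (1 / q') := by
    have hrm : ∀ A' ∈ rel, MeasurableSet (id A') := fun A' hA' => hm A' (hrelD A' hA')
    calc ∫⁻ x in ⋃ A' ∈ rel, A', ‖S x‖ₑ * v x ∂ω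
        = ∑ A' ∈ rel, ∫⁻ x in A', ‖S x‖ₑ * v x ∂ω :=
          lintegral_biUnion_finset (t := id) hreld hrm _
      _ = ∑ A' ∈ rel, ‖c A'‖ₑ * (⨍⁻ x in A', v x ∂ω) * ω A' := by
          refine Finset.sum_congr rfl fun A' hA' => ?_
          rw [mul_assoc, setLAverage_mul_measure (fun x => (v x : ℝ≥0∞)) (hω A' (hrelD A' hA')),
            ← lintegral_const_mul _ hv.coe_nnreal_ennreal]
          exact setLIntegral_congr_fun (hrm A' hA') fun x hx => by
            rw [hSc A' (Finset.mem_filter.1 hA').1 x hx]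
      _ ≤ (∑ A' ∈ rel, ‖c A'‖ₑ ^ q * ω A') ^ (1 / q) *
          (∑ A' ∈ rel, (⨍⁻ x in A', v x ∂ω) ^ q' * ω A') ^ (1 / q') :=
          ENNReal.sum_mul_mul_le_Lp_mul_Lq _ _ _ _ hq
      _ ≤ _ := by
          rw [hN]
          gcongr
          · calc ∑ A' ∈ rel, ‖c A'‖ₑ ^ q * ω A' = ∑ A' ∈ rel, ∫⁻ x in A', ‖S x‖ₑ ^ q ∂ω := by
                  refine Finset.sum_congr rfl fun A' hA' => ?_
                  rw [← setLIntegral_const]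
                  exact setLIntegral_congr_fun (hrm A' hA') fun x hx => by
                    rw [hSc A' (Finset.mem_filter.1 hA').1 x hx]
              _ = ∫⁻ x in ⋃ A' ∈ rel, A', ‖S x‖ₑ ^ q ∂ω :=
                  (lintegral_biUnion_finset (t := id) hreld hrm _).symm
              _ ≤ _ := setLIntegral_le_lintegral _ _
          · exact hq.symm.one_div_nonneg
          · exact le_add_self
  calc ∫⁻ x, ‖S x‖ₑ * v x ∂ω = ∫⁻ x in core ∪ ⋃ A' ∈ rel, A', ‖S x‖ₑ * v x ∂ω :=
        (setLIntegral_eq_of_support_subset hsupp).symm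
    _ ≤ ∫⁻ x in core, ‖S x‖ₑ * v x ∂ω + ∫⁻ x in ⋃ A' ∈ rel, A', ‖S x‖ₑ * v x ∂ω :=
        lintegral_union_le _ _ _
    _ ≤ _ := add_le_add h1 h2
    _ = _ := by ring

/-- The constant in the estimate of one half of the bilinear form. -/
def parallelConst (p q' : ℝ) : ℝ≥0∞ :=
  8 * (2 * carlesonConst p) ^ (1 / p) * (1 + 4 ^ q' * (4 * carlesonConst q')) ^ (1 / q')

theorem parallelConst_ne_top {p q' : ℝ} (hp : 0 < p) (hq' : 0 < q') : parallelConst p q' ≠ ∞ := by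
  have h1 : ∀ r : ℝ, (2 * carlesonConst r : ℝ≥0∞) ≠ ∞ := fun r =>
    ENNReal.mul_ne_top (by simp) (by simp)
  refine ENNReal.mul_ne_top (ENNReal.mul_ne_top (by simp)
    (ENNReal.rpow_ne_top_of_nonneg (by positivity) (h1 p)))
    (ENNReal.rpow_ne_top_of_nonneg (by positivity) (ENNReal.add_ne_top.2 ⟨by simp, ?_⟩))
  exact ENNReal.mul_ne_top (ENNReal.rpow_ne_top_of_nonneg hq'.le (by simp))
    (ENNReal.mul_ne_top (by simp) (by simp))

open Classical in
/-- The estimate of one half of the bilinear form by parallel stopping sets: those sets `Q` for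
which the stopping set `ρ Q` of the weight is contained in the stopping set `π Q` of the
function. -/
theorem IsLaminar.sum_lintegral_positiveOp_mul_le (h : IsLaminar 𝒟) (hne : ∀ Q ∈ 𝒟, Q.Nonempty)
    (hm : ∀ Q ∈ 𝒟, MeasurableSet Q) (hσ : ∀ Q ∈ 𝒟, σ Q ≠ ∞) (hω : ∀ Q ∈ 𝒟, ω Q ≠ ∞)
    {Λ : Set X → E →ₚ[ℝ] F} {p q q' : ℝ} (hp : 1 < p) (hpq : p ≤ q) (hq : q.HolderConjugate q')
    {T : ℝ≥0∞} (hT : PositiveTesting 𝒟 Λ p q σ ω T) (hπ : IsStoppingProjection 𝒟 s π)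
    (hρ : IsStoppingProjection 𝒟 s' ρ)
    (hπpack : ∀ R ∈ 𝒟, ∑ A ∈ stoppingSets 𝒟 π with A ⊆ R, σ A ≤ 2 * σ R)
    (hρpack : ∀ R ∈ 𝒟, ∑ A ∈ stoppingSets 𝒟 ρ with A ⊆ R, ω A ≤ 2 * ω R)
    {f : X → E} (hf0 : 0 ≤ f) {k v : X → ℝ≥0} (hk : Measurable k) (hv : Measurable v)
    (hki : ∀ Q ∈ 𝒟, ⨍⁻ x in Q, k x ∂σ ≠ ∞) (hvi : ∀ Q ∈ 𝒟, ⨍⁻ x in Q, v x ∂ω ≠ ∞)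
    (hfk : ∀ Q ∈ 𝒟, ‖posSup (𝒟.filter (Q ⊆ ·)) fun R => ⨍ y in R, f y ∂σ‖ₑ ≤
      4 * ⨍⁻ x in π Q, k x ∂σ)
    (hvρ : ∀ Q ∈ 𝒟, ⨍⁻ x in Q, v x ∂ω ≤ 4 * ⨍⁻ x in ρ Q, v x ∂ω)
    {𝒟₁ : Finset (Set X)} (h𝒟₁ : 𝒟₁ ⊆ 𝒟) (hρπ : ∀ Q ∈ 𝒟₁, ρ Q ⊆ π Q) :
    ∑ A ∈ stoppingSets 𝒟 π, ∫⁻ x, ‖positiveOp (𝒟₁.filter (π · = A)) Λ σ f x‖ₑ * v x ∂ω ≤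
      parallelConst p q' * T * (∫⁻ x, (k x : ℝ≥0∞) ^ p ∂σ) ^ (1 / p) *
        (∫⁻ x, (v x : ℝ≥0∞) ^ q' ∂ω) ^ (1 / q') := by
  have hp0 : 0 < p := by linarith
  have hq0 : 0 < q := hq.pos
  have hq'0 : 0 < q' := hq.symm.pos
  set 𝓕 := stoppingSets 𝒟 π with h𝓕
  set U := ∫⁻ x, (k x : ℝ≥0∞) ^ p ∂σ with hU
  set W := ∫⁻ x, (v x : ℝ≥0∞) ^ q' ∂ω with hW
  set N : Set X → ℝ≥0∞ := fun A =>
    eLpNorm (positiveOp (𝒟₁.filter (π · = A)) Λ σ f) (ENNReal.ofReal q) ω with hN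
  set rel : Set X → Finset (Set X) := fun A =>
    (stoppingChildren 𝒟 π A).filter fun A' => ∃ Q ∈ 𝒟₁, π Q = A ∧ A' ⊆ Q with hrel
  set V : Set X → ℝ≥0∞ := fun A => ∫⁻ x in stoppingCore 𝒟 π A, (v x : ℝ≥0∞) ^ q' ∂ω +
    ∑ A' ∈ rel A, (⨍⁻ x in A', v x ∂ω) ^ q' * ω A' with hV
  have hNle : ∀ A ∈ 𝓕, N A ≤ 4 * T * ((⨍⁻ x in A, k x ∂σ) ^ p * σ A) ^ (1 / p) := by
    intro A hA
    obtain ⟨hAD, hAA⟩ := mem_stoppingSets.1 hA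
    refine (h.eLpNorm_positiveOp_stopping_le hm hσ hT hπ hf0 h𝒟₁ hAD
      (b := 4 * ⨍⁻ x in A, k x ∂σ) (ENNReal.mul_ne_top (by simp) (hki A hAD))
      fun Q hQ hQA => hQA ▸ hfk Q hQ).trans_eq ?_
    rw [ENNReal.mul_rpow_of_nonneg _ _ (by positivity : 0 ≤ 1 / p), ← ENNReal.rpow_mul,
      mul_one_div_cancel hp0.ne', ENNReal.rpow_one]
    ring
  have hNsum : (∑ A ∈ 𝓕, N A ^ q) ^ (1 / q) ≤ 4 * T * (2 * carlesonConst p * U) ^ (1 / p) := by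
    have hqp : 1 ≤ q / p := (one_le_div hp0).2 hpq
    have e : ∑ A ∈ 𝓕, N A ^ q ≤
        (4 * T) ^ q * (∑ A ∈ 𝓕, (⨍⁻ x in A, k x ∂σ) ^ p * σ A) ^ (q / p) := by
      refine le_trans ?_ (mul_le_mul_right (ENNReal.sum_rpow_le_rpow_sum _ _ hqp) _)
      rw [Finset.mul_sum]
      refine Finset.sum_le_sum fun A hA => ?_
      refine (ENNReal.rpow_le_rpow (hNle A hA) hq0.le).trans_eq ?_
      rw [ENNReal.mul_rpow_of_nonneg _ _ hq0.le, ← ENNReal.rpow_mul]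
      congr 2
      ring
    refine (ENNReal.rpow_le_rpow e hq.one_div_nonneg).trans ?_
    rw [ENNReal.mul_rpow_of_nonneg _ _ hq.one_div_nonneg, ← ENNReal.rpow_mul,
      mul_one_div_cancel hq0.ne', ENNReal.rpow_one, ← ENNReal.rpow_mul,
      show q / p * (1 / q) = 1 / p by field_simp]
    gcongr
    exact h.sum_stoppingSets_le hm hσ hπpack hk hki hp
  -- Here the hypothesis `ρ Q ⊆ π Q` enters: it keeps the `ρ`-stopping sets of the children
  -- inside `A`.
  have hrelρ : ∀ A ∈ 𝓕, ∀ A' ∈ rel A, ρ A' ⊆ A := by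
    intro A _ A' hA'
    obtain ⟨hch, Q, hQ, hQA, hA'Q⟩ := Finset.mem_filter.1 hA'
    exact (hρ.mono A' (mem_of_mem_stoppingChildren hch).1.1 Q (h𝒟₁ hQ) hA'Q).trans
      (hQA ▸ hρπ Q hQ)
  have hVsum : ∑ A ∈ 𝓕, V A ≤ (1 + 4 ^ q' * (4 * carlesonConst q')) * W := by
    have h1 : ∑ A ∈ 𝓕, ∫⁻ x in stoppingCore 𝒟 π A, (v x : ℝ≥0∞) ^ q' ∂ω ≤ W := by
      rw [← lintegral_biUnion_finset h.pairwiseDisjoint_stoppingCore fun A hA =>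
        measurableSet_stoppingCore hm (mem_stoppingSets.1 hA).1]
      exact setLIntegral_le_lintegral _ _
    have h2 : ∑ A ∈ 𝓕, ∑ A' ∈ rel A, (⨍⁻ x in A', v x ∂ω) ^ q' * ω A' ≤
        4 ^ q' * (4 * carlesonConst q') * W := by
      have hrelD : ∀ A, ∀ A' ∈ rel A, A' ∈ 𝒟 := fun A A' hA' =>
        (mem_of_mem_stoppingChildren (Finset.mem_filter.1 hA').1).1.1
      calc ∑ A ∈ 𝓕, ∑ A' ∈ rel A, (⨍⁻ x in A', v x ∂ω) ^ q' * ω A'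
          ≤ ∑ A ∈ 𝓕, ∑ A' ∈ rel A, 4 ^ q' * ((⨍⁻ x in ρ A', v x ∂ω) ^ q' * ω A') := by
            refine Finset.sum_le_sum fun A _ => Finset.sum_le_sum fun A' hA' => ?_
            rw [← mul_assoc, ← ENNReal.mul_rpow_of_nonneg _ _ hq'0.le]
            gcongr
            exact hvρ A' (hrelD A A' hA')
        _ = ∑ A ∈ 𝓕, ∑ G ∈ stoppingSets 𝒟 ρ, ∑ A' ∈ rel A with ρ A' = G,
              4 ^ q' * ((⨍⁻ x in ρ A', v x ∂ω) ^ q' * ω A') := by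
            refine Finset.sum_congr rfl fun A hA => ?_
            refine (Finset.sum_fiberwise_of_maps_to (fun A' hA' => ?_) _).symm
            exact mem_stoppingSets.2 ⟨hρ.mem A' (hrelD A A' hA'), hρ.idem A' (hrelD A A' hA')⟩
        _ = ∑ G ∈ stoppingSets 𝒟 ρ, 4 ^ q' * ((⨍⁻ x in G, v x ∂ω) ^ q' *
              ∑ A ∈ 𝓕, ∑ A' ∈ rel A with ρ A' = G, ω A') := by
            rw [Finset.sum_comm]
            refine Finset.sum_congr rfl fun G _ => ?_
            rw [Finset.mul_sum, Finset.mul_sum]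
            refine Finset.sum_congr rfl fun A _ => ?_
            rw [Finset.mul_sum, Finset.mul_sum]
            refine Finset.sum_congr rfl fun A' hA' => ?_
            rw [(Finset.mem_filter.1 hA').2]
        _ ≤ ∑ G ∈ stoppingSets 𝒟 ρ, 4 ^ q' * ((⨍⁻ x in G, v x ∂ω) ^ q' * (2 * ω G)) := by
            gcongr with G hG
            exact h.sum_children_le hne hm hπ hρ rel (fun A => Finset.filter_subset _ _) hrelρ
              (mem_stoppingSets.1 hG).1
        _ = 4 ^ q' * 2 * ∑ G ∈ stoppingSets 𝒟 ρ, (⨍⁻ x in G, v x ∂ω) ^ q' * ω G := by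
            rw [Finset.mul_sum]
            refine Finset.sum_congr rfl fun G _ => ?_
            ring
        _ ≤ 4 ^ q' * 2 * (2 * carlesonConst q' * W) := by
            gcongr
            exact h.sum_stoppingSets_le hm hω hρpack hv hvi hq.symm.lt
        _ = _ := by ring
    rw [hV, Finset.sum_add_distrib, add_mul, one_mul]
    exact add_le_add h1 h2
  calc ∑ A ∈ 𝓕, ∫⁻ x, ‖positiveOp (𝒟₁.filter (π · = A)) Λ σ f x‖ₑ * v x ∂ω
      ≤ ∑ A ∈ 𝓕, 2 * (N A * V A ^ (1 / q')) := by
        refine Finset.sum_le_sum fun A hA => ?_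
        rw [← mul_assoc]
        exact h.lintegral_positiveOp_stopping_mul_le hm hω Λ hq hπ f h𝒟₁ hA hv
    _ = 2 * ∑ A ∈ 𝓕, N A * V A ^ (1 / q') := Finset.mul_sum _ _ _ |>.symm
    _ ≤ 2 * ((∑ A ∈ 𝓕, N A ^ q) ^ (1 / q) *
          (∑ A ∈ 𝓕, (V A ^ (1 / q')) ^ q') ^ (1 / q')) := by
        gcongr
        exact ENNReal.inner_le_Lp_mul_Lq _ _ _ hq
    _ ≤ 2 * (4 * T * (2 * carlesonConst p * U) ^ (1 / p) *
          ((1 + 4 ^ q' * (4 * carlesonConst q')) * W) ^ (1 / q')) := by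
        simp_rw [← ENNReal.rpow_mul, one_div_mul_cancel hq'0.ne', ENNReal.rpow_one]
        gcongr
    _ = _ := by
        rw [ENNReal.mul_rpow_of_nonneg _ U (by positivity : 0 ≤ 1 / p),
          ENNReal.mul_rpow_of_nonneg _ W hq.symm.one_div_nonneg, parallelConst]
        ring

end Parallel

/-! ### Pairing step functions with their duals -/

section Pairing

variable {X : Type*} [MeasurableSpace X] {μ : Measure X} {𝒟 : Finset (Set X)}

/-- The step function `∑_Q a_Q 1_Q` over a finite family of sets. -/
def indicatorSum {A : Type*} [AddCommMonoid A] (𝒟 : Finset (Set X)) (a : Set X → A) (x : X) : A :=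
  ∑ Q ∈ 𝒟, Q.indicator (fun _ => a Q) x

variable {A B : Type*} [NormedAddCommGroup A] [NormedSpace ℝ A] [NormedAddCommGroup B]
  [NormedSpace ℝ B]

open Classical in
theorem indicatorSum_eq_sum_filter {A : Type*} [AddCommMonoid A] (𝒟 : Finset (Set X))
    (a : Set X → A) (x : X) : indicatorSum 𝒟 a x = ∑ Q ∈ 𝒟.filter (x ∈ ·), a Q := by
  rw [indicatorSum, Finset.sum_filter]
  exact Finset.sum_congr rfl fun Q _ => Set.indicator_apply _ _ _

theorem map_indicatorSum (b : A →L[ℝ] B) (𝒟 : Finset (Set X)) (a : Set X → A) (x : X) :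
    b (indicatorSum 𝒟 a x) = indicatorSum 𝒟 (fun Q => b (a Q)) x := by
  classical
  rw [indicatorSum_eq_sum_filter, indicatorSum_eq_sum_filter, map_sum]

theorem indicatorSum_apply (a : Set X → StrongDual ℝ B) (f : X → B) (x : X) :
    indicatorSum 𝒟 a x (f x) = ∑ Q ∈ 𝒟, Q.indicator (fun y => a Q (f y)) x := by
  rw [indicatorSum, sum_apply]
  refine Finset.sum_congr rfl fun Q _ => ?_
  by_cases hx : x ∈ Q <;> simp [hx]

theorem integrable_indicatorSum_apply (hm : ∀ Q ∈ 𝒟, MeasurableSet Q) (a : Set X → StrongDual ℝ B)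
    {f : X → B} (hf : ∀ Q ∈ 𝒟, IntegrableOn f Q μ) :
    Integrable (fun x => indicatorSum 𝒟 a x (f x)) μ := by
  simp_rw [indicatorSum_apply]
  exact integrable_finsetSum _ fun Q hQ =>
    (integrable_indicator_iff (hm Q hQ)).2 ((a Q).integrable_comp (hf Q hQ))

theorem integral_indicatorSum_apply [CompleteSpace B] (hm : ∀ Q ∈ 𝒟, MeasurableSet Q)
    (a : Set X → StrongDual ℝ B) {f : X → B} (hf : ∀ Q ∈ 𝒟, IntegrableOn f Q μ) :
    ∫ x, indicatorSum 𝒟 a x (f x) ∂μ = ∑ Q ∈ 𝒟, a Q (∫ x in Q, f x ∂μ) := by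
  simp_rw [indicatorSum_apply]
  rw [integral_finsetSum _ fun Q hQ =>
    (integrable_indicator_iff (hm Q hQ)).2 ((a Q).integrable_comp (hf Q hQ))]
  refine Finset.sum_congr rfl fun Q hQ => ?_
  rw [integral_indicator (hm Q hQ), (a Q).integral_comp_comm (hf Q hQ)]

theorem ofReal_sum_apply_setIntegral_le [CompleteSpace B] (hm : ∀ Q ∈ 𝒟, MeasurableSet Q)
    (a : Set X → StrongDual ℝ B) {f : X → B} (hf : ∀ Q ∈ 𝒟, IntegrableOn f Q μ) :
    ENNReal.ofReal (∑ Q ∈ 𝒟, a Q (∫ x in Q, f x ∂μ)) ≤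
      ∫⁻ x, ‖indicatorSum 𝒟 a x‖ₑ * ‖f x‖ₑ ∂μ := by
  rw [← integral_indicatorSum_apply hm a hf]
  calc _ ≤ ‖∫ x, indicatorSum 𝒟 a x (f x) ∂μ‖ₑ := by
        rw [← ofReal_norm]; exact ENNReal.ofReal_le_ofReal (le_abs_self _)
    _ ≤ ∫⁻ x, ‖indicatorSum 𝒟 a x (f x)‖ₑ ∂μ := enorm_integral_le_lintegral_enorm _
    _ ≤ _ := lintegral_mono fun x => ContinuousLinearMap.le_opENorm _ _

theorem ofReal_sum_setIntegral_apply_le (hm : ∀ Q ∈ 𝒟, MeasurableSet Q)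
    (a : Set X → B) {g : X → StrongDual ℝ B} (hg : ∀ Q ∈ 𝒟, IntegrableOn g Q μ) :
    ENNReal.ofReal (∑ Q ∈ 𝒟, (∫ x in Q, g x ∂μ) (a Q)) ≤
      ∫⁻ x, ‖indicatorSum 𝒟 a x‖ₑ * ‖g x‖ₑ ∂μ := by
  have h := ofReal_sum_apply_setIntegral_le hm
    (fun Q => NormedSpace.inclusionInDoubleDual ℝ B (a Q)) hg
  simp_rw [← map_indicatorSum] at h
  refine h.trans (lintegral_mono fun x => ?_)
  gcongr
  rw [← ofReal_norm, ← ofReal_norm]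
  exact ENNReal.ofReal_le_ofReal ((NormedSpace.inclusionInDoubleDualLi ℝ (E := B)).norm_map _).le

/-- The `L^q` norm of a step function by duality: if `ν y` is a vector of the unit ball
which norms `y` up to the factor `c`, then it suffices to test with functions that are
pointwise nonnegative multiples of `ν` of the step function. -/
theorem mul_eLpNorm_indicatorSum_le [CompleteSpace B] (hm : ∀ Q ∈ 𝒟, MeasurableSet Q)
    (hfin : ∀ Q ∈ 𝒟, μ Q ≠ ∞) {q q' : ℝ} (hq : q.HolderConjugate q') (a : Set X → A)
    (b : A →L[ℝ] StrongDual ℝ B) {c : ℝ} {ν : A → B}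
    (hν : ∀ x, ‖ν (indicatorSum 𝒟 a x)‖ ≤ 1)
    (hνc : ∀ x, c * ‖indicatorSum 𝒟 a x‖ ≤ b (indicatorSum 𝒟 a x) (ν (indicatorSum 𝒟 a x)))
    {K : ℝ≥0∞} (H : ∀ G : X → B, (∀ x, ∃ t : ℝ, 0 ≤ t ∧ G x = t • ν (indicatorSum 𝒟 a x)) →
      StronglyMeasurable G → MemLp G (ENNReal.ofReal q') μ →
      ENNReal.ofReal (∑ Q ∈ 𝒟, b (a Q) (∫ x in Q, G x ∂μ)) ≤
        K * eLpNorm G (ENNReal.ofReal q') μ) :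
    ENNReal.ofReal c * eLpNorm (indicatorSum 𝒟 a) (ENNReal.ofReal q) μ ≤ K := by
  classical
  set S := indicatorSum 𝒟 a with hS
  -- The equality case of Hölder's inequality.
  set G : X → B := fun x => ‖S x‖ ^ (q - 1) • ν (S x) with hG
  have hq1 : 0 < q - 1 := hq.sub_one_pos
  have hGm : StronglyMeasurable G := by
    have := stronglyMeasurable_of_mem_pattern hm
      fun s => ‖∑ Q ∈ s, a Q‖ ^ (q - 1) • ν (∑ Q ∈ s, a Q)
    simpa only [hG, hS, indicatorSum_eq_sum_filter] using this
  have hSm : StronglyMeasurable S :=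
    Finset.stronglyMeasurable_fun_sum _ fun Q hQ => stronglyMeasurable_const.indicator (hm Q hQ)
  obtain ⟨C, hC⟩ := exists_bound_of_mem_pattern 𝒟 fun s => ∑ Q ∈ s, a Q
  simp_rw [← indicatorSum_eq_sum_filter] at hC
  set Y := ∫⁻ x, ‖S x‖ₑ ^ q ∂μ with hY
  have hYfin : Y ≠ ∞ := by
    have hsupp : (fun x => ‖S x‖ₑ ^ q).support ⊆ ⋃ Q ∈ 𝒟, Q := by
      intro x hx
      by_contra h1
      apply hx
      have : S x = 0 := Finset.sum_eq_zero fun Q hQ =>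
        Set.indicator_of_notMem (fun hxQ => h1 (Set.mem_biUnion hQ hxQ)) _
      simp [this, hq.pos]
    rw [hY, ← setLIntegral_eq_of_support_subset hsupp]
    refine ne_top_of_le_ne_top (ENNReal.mul_ne_top
      (ENNReal.rpow_ne_top_of_nonneg hq.nonneg (ENNReal.coe_ne_top (r := C)))
      (measure_biUnion_lt_top 𝒟.finite_toSet fun Q hQ => (hfin Q hQ).lt_top).ne) ?_
    rw [← setLIntegral_const]
    exact lintegral_mono fun x => ENNReal.rpow_le_rpow (ENNReal.coe_le_coe.2 (hC x)) hq.nonneg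
  have hGq : ∀ x, ‖G x‖ₑ ^ q' ≤ ‖S x‖ₑ ^ q := by
    intro x
    have h1 : ‖G x‖ₑ ≤ ‖S x‖ₑ ^ (q - 1) := by
      rw [← ofReal_norm, ← ofReal_norm, ENNReal.ofReal_rpow_of_nonneg (norm_nonneg _) hq1.le, hG,
        norm_smul, Real.norm_of_nonneg (by positivity)]
      exact ENNReal.ofReal_le_ofReal (mul_le_of_le_one_right (by positivity) (hν x))
    refine (ENNReal.rpow_le_rpow h1 hq.symm.nonneg).trans_eq ?_
    rw [← ENNReal.rpow_mul, hq.sub_one_mul_conj]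
  have hGY : eLpNorm G (ENNReal.ofReal q') μ ≤ Y ^ (1 / q') := by
    rw [one_div, ENNReal.le_rpow_inv_iff hq.symm.pos, eLpNorm_rpow_eq_lintegral hq.symm.pos]
    exact lintegral_mono hGq
  have hGmem : MemLp G (ENNReal.ofReal q') μ := ⟨hGm.aestronglyMeasurable,
    hGY.trans_lt (ENNReal.rpow_lt_top_of_nonneg hq.symm.one_div_nonneg hYfin)⟩
  have hGi : ∀ Q ∈ 𝒟, IntegrableOn G Q μ := fun Q hQ => by
    have : IsFiniteMeasure (μ.restrict Q) :=
      ⟨by rw [Measure.restrict_apply_univ]; exact (hfin Q hQ).lt_top⟩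
    exact (hGmem.restrict Q).integrable (by simpa using hq.symm.lt.le)
  have hpair := H G (fun x => ⟨_, by positivity, rfl⟩) hGm hGmem
  rw [← integral_indicatorSum_apply hm (fun Q => b (a Q)) hGi] at hpair
  have hle : ENNReal.ofReal c * Y ≤ K * Y ^ (1 / q') := by
    refine le_trans ?_ (hpair.trans (mul_le_mul_right hGY K))
    have hi := integrable_indicatorSum_apply hm (fun Q => b (a Q)) hGi
    rcases le_total c 0 with hc | hc
    · simp [ENNReal.ofReal_of_nonpos hc]
    have hpt : ∀ x, c * ‖S x‖ ^ q ≤ indicatorSum 𝒟 (fun Q => b (a Q)) x (G x) := by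
      intro x
      rw [← map_indicatorSum, ← hS, hG, map_smul, smul_eq_mul]
      calc c * ‖S x‖ ^ q = ‖S x‖ ^ (q - 1) * (c * ‖S x‖) := by
            rcases eq_or_ne ‖S x‖ 0 with h0 | h0
            · rw [h0, Real.zero_rpow hq.pos.ne']; simp
            · rw [Real.rpow_sub_one h0]; field_simp
        _ ≤ _ := mul_le_mul_of_nonneg_left (hνc x) (by positivity)
    rw [ofReal_integral_eq_lintegral_ofReal hi
      (Filter.Eventually.of_forall fun x => le_trans (by positivity) (hpt x)), hY,
      ← lintegral_const_mul' _ _ ENNReal.ofReal_ne_top]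
    refine lintegral_mono fun x => ?_
    rw [← ofReal_norm, ENNReal.ofReal_rpow_of_nonneg (norm_nonneg _) hq.nonneg,
      ← ENNReal.ofReal_mul hc]
    exact ENNReal.ofReal_le_ofReal (hpt x)
  have hN : eLpNorm S (ENNReal.ofReal q) μ = Y ^ (1 / q) := by
    rw [hY, ← eLpNorm_rpow_eq_lintegral hq.pos, ← ENNReal.rpow_mul, mul_one_div_cancel hq.pos.ne',
      ENNReal.rpow_one]
  rw [hN]
  rcases eq_or_ne Y 0 with h0 | h0
  · simp [h0, hq.pos]
  have e : Y = Y ^ (1 / q) * Y ^ (1 / q') := by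
    rw [← ENNReal.rpow_add _ _ h0 hYfin, one_div, one_div, hq.inv_add_inv_eq_one, ENNReal.rpow_one]
  have h1 : Y ^ (1 / q') ≠ 0 := by simp [h0, hYfin]
  have h2 : Y ^ (1 / q') ≠ ∞ := ENNReal.rpow_ne_top_of_nonneg hq.symm.one_div_nonneg hYfin
  rw [← ENNReal.mul_le_mul_iff_left h1 h2, mul_assoc, ← e]
  exact hle

end Pairing

/-! ### The bilinear estimate -/

section Bilinear

variable {X : Type*} [MeasurableSpace X] {μ : Measure X} {𝒟 : Finset (Set X)}

theorem setLAverage_ne_top {p : ℝ} (hp : 1 ≤ p) {u : X → ℝ≥0∞} (hu : Measurable u) {Q : Set X}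
    (hQ : μ Q ≠ ∞) (hQ0 : μ Q ≠ 0) (h : ∫⁻ x, u x ^ p ∂μ ≠ ∞) : ⨍⁻ x in Q, u x ∂μ ≠ ∞ := by
  intro h1
  have h2 := setLAverage_rpow_mul_measure_le hp hu hQ
  rw [h1, ENNReal.top_rpow_of_pos (by linarith), ENNReal.top_mul hQ0, top_le_iff] at h2
  exact h (top_le_iff.1 (h2 ▸ setLIntegral_le_lintegral _ _))

section Stopping

variable {E : Type*} [NormedAddCommGroup E] [NormedSpace ℝ E] [CompleteSpace E] [Lattice E]
  [HasSolidNorm E] [IsOrderedAddMonoid E] [IsOrderedModule ℝ E]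

open Classical in
/-- The stopping construction: below a stopping set the lattice suprema of averages are controlled
by the average of the maximal function, and the averages of the norm by the average of the norm. -/
theorem IsLaminar.exists_stopping_maximalFn (h : IsLaminar 𝒟) (hm : ∀ Q ∈ 𝒟, MeasurableSet Q)
    (hfin : ∀ Q ∈ 𝒟, μ Q ≠ ∞) (h0 : ∀ Q ∈ 𝒟, μ Q ≠ 0) {f : X → E}
    (hui : ∀ Q ∈ 𝒟, ⨍⁻ x in Q, ‖f x‖₊ ∂μ ≠ ∞) :
    ∃ (s : Set X → Set X → Prop) (π : Set X → Set X), IsStoppingProjection 𝒟 s π ∧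
      (∀ R ∈ 𝒟, ∑ A ∈ stoppingSets 𝒟 π with A ⊆ R, μ A ≤ 2 * μ R) ∧
      (∀ Q ∈ 𝒟, ‖posSup (𝒟.filter (Q ⊆ ·)) fun R => ⨍ y in R, f y ∂μ‖ₑ ≤
        4 * ⨍⁻ x in π Q, ‖maximalFn μ 𝒟 f x‖₊ ∂μ) ∧
      ∀ Q ∈ 𝒟, ⨍⁻ x in Q, ‖f x‖₊ ∂μ ≤ 4 * ⨍⁻ x in π Q, ‖f x‖₊ ∂μ := by
  set k : X → ℝ≥0∞ := fun x => ‖maximalFn μ 𝒟 f x‖₊ with hk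
  have hkm : Measurable k := (stronglyMeasurable_maximalFn hm f).enorm
  set a : Set X → ℝ≥0∞ := fun Q => ‖posSup (𝒟.filter (Q ⊆ ·)) fun R => ⨍ y in R, f y ∂μ‖ₑ with ha
  have hak : ∀ Q ∈ 𝒟, ∀ x ∈ Q, a Q ≤ k x := by
    intro Q hQ x hx
    refine enorm_le_enorm_of_nonneg_of_le (posSup_nonneg _ _) (posSup_mono _ fun R hR => ?_)
    obtain ⟨h1, h2⟩ := Finset.mem_filter.1 hR
    exact Finset.mem_filter.2 ⟨h1, h2 hx⟩
  have hne : ∀ Q ∈ 𝒟, Q.Nonempty := fun Q hQ => nonempty_of_measure_ne_zero (h0 Q hQ)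
  set s : Set X → Set X → Prop := fun F Q => 4 * (⨍⁻ x in F, k x ∂μ) < a Q ∨
    4 * (⨍⁻ x in F, ‖f x‖₊ ∂μ) < ⨍⁻ x in Q, ‖f x‖₊ ∂μ with hs
  obtain ⟨π, hπ⟩ := h.exists_isStoppingProjection hne s
  have hnot : ∀ Q ∈ 𝒟, ¬ s (π Q) Q := by
    intro Q hQ
    by_cases hπQ : π Q = Q
    · rw [hπQ, hs]
      simp only [not_or, not_lt]
      refine ⟨?_, le_mul_of_one_le_left zero_le (by norm_num)⟩
      refine le_trans ?_ (le_mul_of_one_le_left zero_le (by norm_num))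
      calc a Q = ⨍⁻ _ in Q, a Q ∂μ := (setLAverage_const (h0 Q hQ) (hfin Q hQ) _).symm
        _ ≤ _ := by
          rw [setLAverage_eq, setLAverage_eq]
          gcongr ?_ / _
          exact setLIntegral_mono' (hm Q hQ) fun x hx => hak Q hQ x hx
    · exact hπ.not_stop Q hQ hπQ
  refine ⟨s, π, hπ, fun R _ => hπ.sum_measure_le h hm hfin (fun F hF => ?_) R,
    fun Q hQ => not_lt.1 (not_or.1 (hnot Q hQ)).1, fun Q hQ => not_lt.1 (not_or.1 (hnot Q hQ)).2⟩
  refine ⟨{x ∈ F | 4 * (⨍⁻ y in F, k y ∂μ) < k x} ∪ ⋃ Q ∈ 𝒟.filter fun Q => Q ⊆ F ∧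
    4 * (⨍⁻ x in F, ‖f x‖₊ ∂μ) < ⨍⁻ x in Q, ‖f x‖₊ ∂μ, Q, ?_, ?_⟩
  · refine (measure_union_le _ _).trans ((add_le_add
      (setLAverage_lt_measure_le k hkm (hfin F hF) (hm F hF))
      (h.measure_stopped_average_le hm _ (hfin F hF) (hui F hF))).trans_eq ?_)
    rw [← ENNReal.add_div, ← two_mul, mul_comm, ENNReal.mul_div_right_comm]
    rw [div_eq_mul_inv, div_eq_mul_inv, mul_assoc]
    congr 1
    rw [show (4 : ℝ≥0∞) = 2 * 2 by norm_num, ENNReal.mul_inv (by simp) (by simp), mul_assoc,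
      ENNReal.inv_mul_cancel (by simp) (by simp), mul_one]
  · rintro Q hQ hQF (h1 | h1)
    · exact fun x hx => Or.inl ⟨hQF.1 hx, h1.trans_le (hak Q hQ x hx)⟩
    · exact fun x hx => Or.inr (Set.mem_biUnion (Finset.mem_filter.2 ⟨hQ, hQF.1, h1⟩) hx)

end Stopping

variable {C D : Type*} [NormedAddCommGroup C] [NormedSpace ℝ C]
  [CompleteSpace C] [Lattice C] [HasSolidNorm C] [IsOrderedAddMonoid C] [IsOrderedModule ℝ C]
  [NormedAddCommGroup D] [NormedSpace ℝ D]
  [Lattice D] [HasSolidNorm D] [IsOrderedAddMonoid D] [IsOrderedModule ℝ D] {σ ω : Measure X}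

theorem PositiveTesting.mono {Λ : Set X → C →ₚ[ℝ] D} {p q : ℝ} {T : ℝ≥0∞}
    (hT : PositiveTesting 𝒟 Λ p q σ ω T) {𝒟' : Finset (Set X)} (h : 𝒟' ⊆ 𝒟) :
    PositiveTesting 𝒟' Λ p q σ ω T := by
  classical
  intro R hR φ hφ0 hφ
  refine le_trans (eLpNorm_mono_enorm fun x => ?_) (hT R (h hR) φ hφ0 hφ)
  refine enorm_le_enorm_of_nonneg_of_le (positiveOp_nonneg _ _ hφ0 x) ?_
  exact Finset.sum_le_sum_of_subset_of_nonneg (Finset.filter_subset_filter _ h) fun Q _ _ =>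
    Set.indicator_nonneg (fun _ _ => map_nonneg (Λ Q) (integral_nonneg hφ0)) x

theorem MaximalBound.lintegral_rpow_le {p : ℝ} (hp : 1 < p) {N : ℝ≥0∞}
    (hN : MaximalBound X C p N) (h : IsLaminar 𝒟) (hm : ∀ Q ∈ 𝒟, MeasurableSet Q)
    (hfin : ∀ Q ∈ 𝒟, μ Q ≠ ∞) {f : X → C} (hfm : StronglyMeasurable f) (hf0 : 0 ≤ f)
    (hf : MemLp f (ENNReal.ofReal p) μ) :
    (∫⁻ x, (‖maximalFn μ 𝒟 f x‖₊ : ℝ≥0∞) ^ p ∂μ) ^ (1 / p) ≤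
      N * eLpNorm f (ENNReal.ofReal p) μ := by
  have hp0 : 0 < p := by linarith
  rw [one_div, ENNReal.rpow_inv_le_iff hp0, ENNReal.mul_rpow_of_nonneg _ _ hp0.le,
    eLpNorm_rpow_eq_lintegral hp0]
  exact hN μ 𝒟 h hm hfin f hfm hf0 hf

theorem ENNReal.ofReal_sum_le_sum_ofReal {ι : Type*} (s : Finset ι) (a : ι → ℝ) :
    ENNReal.ofReal (∑ i ∈ s, a i) ≤ ∑ i ∈ s, ENNReal.ofReal (a i) := by
  classical
  induction s using Finset.induction_on with
  | empty => simp
  | insert i s hi ih =>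
    rw [Finset.sum_insert hi, Finset.sum_insert hi]
    exact ENNReal.ofReal_add_le.trans (add_le_add le_rfl ih)

/-- The estimate of the bilinear form of a positive operator by the testing constants, for
nonnegative functions. -/
theorem IsLaminar.ofReal_sum_bilinear_le (h : IsLaminar 𝒟) (hm : ∀ Q ∈ 𝒟, MeasurableSet Q)
    (hσ : ∀ Q ∈ 𝒟, σ Q ≠ ∞) (hω : ∀ Q ∈ 𝒟, ω Q ≠ ∞) {Λ : Set X → C →ₚ[ℝ] D} {p p' q q' : ℝ}
    (hp : p.HolderConjugate p') (hq : q.HolderConjugate q') (hpq : p ≤ q) {T T' N N' : ℝ≥0∞}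
    (hT : PositiveTesting 𝒟 Λ p q σ ω T)
    (hT' : PositiveTesting 𝒟 (fun Q => (Λ Q).dualAdjoint) q' p' ω σ T')
    (hN : MaximalBound X C p N) (hN' : MaximalBound X (StrongDual ℝ D) q' N')
    (hNfin : N ≠ ∞) (hNfin' : N' ≠ ∞)
    {f : X → C} (hfm : StronglyMeasurable f) (hf0 : 0 ≤ f) (hf : MemLp f (ENNReal.ofReal p) σ)
    {g : X → StrongDual ℝ D} (hgm : StronglyMeasurable g) (hg0 : 0 ≤ g)
    (hg : MemLp g (ENNReal.ofReal q') ω) :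
    ENNReal.ofReal (∑ Q ∈ 𝒟, (∫ x in Q, g x ∂ω) (Λ Q (∫ x in Q, f x ∂σ))) ≤
      (parallelConst p q' * N * T + parallelConst q' p * N' * T') *
        eLpNorm f (ENNReal.ofReal p) σ * eLpNorm g (ENNReal.ofReal q') ω := by
  classical
  have hqp' : q' ≤ p' := by
    have h1 := hp.inv_add_inv_eq_one
    have h2 := hq.inv_add_inv_eq_one
    have h3 : q⁻¹ ≤ p⁻¹ := inv_anti₀ hp.pos hpq
    exact (inv_le_inv₀ hp.symm.pos hq.symm.pos).1 (by linarith)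
  -- Sets of measure zero do not contribute to the form.
  set 𝒮 := 𝒟.filter fun Q => σ Q ≠ 0 ∧ ω Q ≠ 0 with h𝒮
  have hsub : 𝒮 ⊆ 𝒟 := Finset.filter_subset _ _
  have hsum : ∑ Q ∈ 𝒟, (∫ x in Q, g x ∂ω) (Λ Q (∫ x in Q, f x ∂σ)) =
      ∑ Q ∈ 𝒮, (∫ x in Q, g x ∂ω) (Λ Q (∫ x in Q, f x ∂σ)) := by
    refine (Finset.sum_subset hsub fun Q hQ hQ' => ?_).symm
    rw [h𝒮, Finset.mem_filter, not_and, not_and_or, not_not, not_not] at hQ'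
    rcases hQ' hQ with h1 | h1
    · rw [setIntegral_measure_zero f h1]; simp
    · rw [setIntegral_measure_zero g h1]; simp
  rw [hsum]
  replace h := h.mono hsub
  replace hT := hT.mono hsub
  replace hT' := hT'.mono hsub
  have hm' : ∀ Q ∈ 𝒮, MeasurableSet Q := fun Q hQ => hm Q (hsub hQ)
  have hσ' : ∀ Q ∈ 𝒮, σ Q ≠ ∞ := fun Q hQ => hσ Q (hsub hQ)
  have hω' : ∀ Q ∈ 𝒮, ω Q ≠ ∞ := fun Q hQ => hω Q (hsub hQ)
  have hσ0 : ∀ Q ∈ 𝒮, σ Q ≠ 0 := fun Q hQ => (Finset.mem_filter.1 hQ).2.1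
  have hω0 : ∀ Q ∈ 𝒮, ω Q ≠ 0 := fun Q hQ => (Finset.mem_filter.1 hQ).2.2
  have hne : ∀ Q ∈ 𝒮, Q.Nonempty := fun Q hQ => nonempty_of_measure_ne_zero (hσ0 Q hQ)
  have hfp : ∫⁻ x, (‖f x‖₊ : ℝ≥0∞) ^ p ∂σ = eLpNorm f (ENNReal.ofReal p) σ ^ p :=
    (eLpNorm_rpow_eq_lintegral hp.pos f).symm
  have hgq : ∫⁻ x, (‖g x‖₊ : ℝ≥0∞) ^ q' ∂ω = eLpNorm g (ENNReal.ofReal q') ω ^ q' :=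
    (eLpNorm_rpow_eq_lintegral hq.symm.pos g).symm
  have hMf := hN.lintegral_rpow_le hp.lt h hm' hσ' hfm hf0 hf
  have hMg := hN'.lintegral_rpow_le hq.symm.lt h hm' hω' hgm hg0 hg
  have hMfi : ∫⁻ x, (‖maximalFn σ 𝒮 f x‖₊ : ℝ≥0∞) ^ p ∂σ ≠ ∞ := fun h1 => by
    rw [h1, ENNReal.top_rpow_of_pos hp.one_div_pos, top_le_iff] at hMf
    exact ENNReal.mul_ne_top hNfin hf.2.ne hMf
  have hMgi : ∫⁻ x, (‖maximalFn ω 𝒮 g x‖₊ : ℝ≥0∞) ^ q' ∂ω ≠ ∞ := fun h1 => by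
    rw [h1, ENNReal.top_rpow_of_pos hq.symm.one_div_pos, top_le_iff] at hMg
    exact ENNReal.mul_ne_top hNfin' hg.2.ne hMg
  have hui : ∀ Q ∈ 𝒮, ⨍⁻ x in Q, ‖f x‖₊ ∂σ ≠ ∞ := fun Q hQ =>
    setLAverage_ne_top hp.lt.le hfm.enorm (hσ' Q hQ) (hσ0 Q hQ)
      (hfp ▸ ENNReal.rpow_ne_top_of_nonneg hp.nonneg hf.2.ne)
  have hvi : ∀ Q ∈ 𝒮, ⨍⁻ x in Q, ‖g x‖₊ ∂ω ≠ ∞ := fun Q hQ =>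
    setLAverage_ne_top hq.symm.lt.le hgm.enorm (hω' Q hQ) (hω0 Q hQ)
      (hgq ▸ ENNReal.rpow_ne_top_of_nonneg hq.symm.nonneg hg.2.ne)
  have hkm := (stronglyMeasurable_maximalFn (μ := σ) hm' f).nnnorm.measurable
  have hlm := (stronglyMeasurable_maximalFn (μ := ω) hm' g).nnnorm.measurable
  have hki : ∀ Q ∈ 𝒮, ⨍⁻ x in Q, ‖maximalFn σ 𝒮 f x‖₊ ∂σ ≠ ∞ := fun Q hQ =>
    setLAverage_ne_top hp.lt.le hkm.coe_nnreal_ennreal (hσ' Q hQ) (hσ0 Q hQ) hMfi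
  have hli : ∀ Q ∈ 𝒮, ⨍⁻ x in Q, ‖maximalFn ω 𝒮 g x‖₊ ∂ω ≠ ∞ := fun Q hQ =>
    setLAverage_ne_top hq.symm.lt.le hlm.coe_nnreal_ennreal (hω' Q hQ) (hω0 Q hQ) hMgi
  have hfQ : ∀ Q ∈ 𝒮, IntegrableOn f Q σ := fun Q hQ =>
    MemLp.integrableOn_of_measure_ne_top hp.lt.le hf (hσ' Q hQ)
  have hgQ : ∀ Q ∈ 𝒮, IntegrableOn g Q ω := fun Q hQ =>
    MemLp.integrableOn_of_measure_ne_top hq.symm.lt.le hg (hω' Q hQ)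
  obtain ⟨s, π, hπ, hπpack, hfk, hfπ⟩ := h.exists_stopping_maximalFn hm' hσ' hσ0 hui
  obtain ⟨s', ρ, hρ, hρpack, hgl, hgρ⟩ := h.exists_stopping_maximalFn hm' hω' hω0 hvi
  -- The sets `Q` with `ρ Q ⊆ π Q` are treated with the testing condition of the operator, the
  -- others, for which `π Q ⊆ ρ Q`, with that of the adjoint.
  have h1 := h.sum_lintegral_positiveOp_mul_le hne hm' hσ' hω' hp.lt hpq hq hT hπ hρ hπpack hρpack
    hf0 hkm hgm.nnnorm.measurable hki hvi hfk hgρ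
    (𝒟₁ := 𝒮.filter fun Q => ρ Q ⊆ π Q) (Finset.filter_subset _ _)
    (fun Q hQ => (Finset.mem_filter.1 hQ).2)
  have h2 := h.sum_lintegral_positiveOp_mul_le hne hm' hω' hσ' hq.symm.lt hqp' hp.symm hT' hρ hπ
    hρpack hπpack hg0 hlm hfm.nnnorm.measurable hli hui hgl hfπ
    (𝒟₁ := 𝒮.filter fun Q => ¬ ρ Q ⊆ π Q) (Finset.filter_subset _ _)
    (fun Q hQ => by
      obtain ⟨hQS, hQ2⟩ := Finset.mem_filter.1 hQ
      rcases h _ (hπ.mem Q hQS) _ (hρ.mem Q hQS) with h3 | h3 | h3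
      · exact h3
      · exact (hQ2 h3).elim
      · obtain ⟨x, hx⟩ := hne Q hQS
        exact (Set.disjoint_left.1 h3 (hπ.le Q hQS hx) (hρ.le Q hQS hx)).elim)
  rw [hgq, ← ENNReal.rpow_mul, mul_one_div_cancel hq.symm.pos.ne', ENNReal.rpow_one] at h1
  rw [hfp, ← ENNReal.rpow_mul, mul_one_div_cancel hp.pos.ne', ENNReal.rpow_one] at h2
  have e1 : ENNReal.ofReal (∑ Q ∈ 𝒮 with ρ Q ⊆ π Q,
      (∫ x in Q, g x ∂ω) (Λ Q (∫ x in Q, f x ∂σ))) ≤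
      ∑ A ∈ stoppingSets 𝒮 π, ∫⁻ x, ‖positiveOp ((𝒮.filter fun Q => ρ Q ⊆ π Q).filter (π · = A))
        Λ σ f x‖ₑ * ‖g x‖₊ ∂ω := by
    rw [← Finset.sum_fiberwise_of_maps_to (g := π) (t := stoppingSets 𝒮 π) fun Q hQ =>
      mem_stoppingSets.2 ⟨hπ.mem Q (Finset.mem_filter.1 hQ).1, hπ.idem Q (Finset.mem_filter.1 hQ).1⟩]
    refine (ENNReal.ofReal_sum_le_sum_ofReal _ _).trans (Finset.sum_le_sum fun A _ => ?_)
    have hs : ∀ Q ∈ (𝒮.filter fun Q => ρ Q ⊆ π Q).filter (π · = A), Q ∈ 𝒮 := fun Q hQ =>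
      (Finset.mem_filter.1 (Finset.mem_filter.1 hQ).1).1
    exact ofReal_sum_setIntegral_apply_le (fun Q hQ => hm' Q (hs Q hQ))
      (fun Q => Λ Q (∫ x in Q, f x ∂σ)) fun Q hQ => hgQ Q (hs Q hQ)
  have e2 : ENNReal.ofReal (∑ Q ∈ 𝒮 with ¬ ρ Q ⊆ π Q,
      (∫ x in Q, g x ∂ω) (Λ Q (∫ x in Q, f x ∂σ))) ≤
      ∑ A ∈ stoppingSets 𝒮 ρ, ∫⁻ x, ‖positiveOp ((𝒮.filter fun Q => ¬ ρ Q ⊆ π Q).filter (ρ · = A))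
        (fun Q => (Λ Q).dualAdjoint) ω g x‖ₑ * ‖f x‖₊ ∂σ := by
    rw [← Finset.sum_fiberwise_of_maps_to (g := ρ) (t := stoppingSets 𝒮 ρ) fun Q hQ =>
      mem_stoppingSets.2 ⟨hρ.mem Q (Finset.mem_filter.1 hQ).1, hρ.idem Q (Finset.mem_filter.1 hQ).1⟩]
    refine (ENNReal.ofReal_sum_le_sum_ofReal _ _).trans (Finset.sum_le_sum fun A _ => ?_)
    have hs : ∀ Q ∈ (𝒮.filter fun Q => ¬ ρ Q ⊆ π Q).filter (ρ · = A), Q ∈ 𝒮 := fun Q hQ =>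
      (Finset.mem_filter.1 (Finset.mem_filter.1 hQ).1).1
    exact ofReal_sum_apply_setIntegral_le (fun Q hQ => hm' Q (hs Q hQ))
      (fun Q => (Λ Q).dualAdjoint (∫ x in Q, g x ∂ω)) fun Q hQ => hfQ Q (hs Q hQ)
  rw [← Finset.sum_filter_add_sum_filter_not 𝒮 fun Q => ρ Q ⊆ π Q]
  refine ENNReal.ofReal_add_le.trans ((add_le_add (e1.trans h1) (e2.trans h2)).trans ?_)
  calc _ ≤ parallelConst p q' * T * (N * eLpNorm f (ENNReal.ofReal p) σ) *
          eLpNorm g (ENNReal.ofReal q') ω +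
        parallelConst q' p * T' * (N' * eLpNorm g (ENNReal.ofReal q') ω) *
          eLpNorm f (ENNReal.ofReal p) σ := by gcongr
    _ = _ := by ring

/-- The upper bound of a positive operator by the testing constants, for nonnegative functions. -/
theorem IsLaminar.eLpNorm_positiveOp_le (h : IsLaminar 𝒟) (hm : ∀ Q ∈ 𝒟, MeasurableSet Q)
    (hσ : ∀ Q ∈ 𝒟, σ Q ≠ ∞) (hω : ∀ Q ∈ 𝒟, ω Q ≠ ∞) {Λ : Set X → C →ₚ[ℝ] D} {p p' q q' : ℝ}
    (hp : p.HolderConjugate p') (hq : q.HolderConjugate q') (hpq : p ≤ q) {T T' N N' : ℝ≥0∞}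
    (hT : PositiveTesting 𝒟 Λ p q σ ω T)
    (hT' : PositiveTesting 𝒟 (fun Q => (Λ Q).dualAdjoint) q' p' ω σ T')
    (hN : MaximalBound X C p N) (hN' : MaximalBound X (StrongDual ℝ D) q' N')
    (hNfin : N ≠ ∞) (hNfin' : N' ≠ ∞)
    {f : X → C} (hfm : StronglyMeasurable f) (hf0 : 0 ≤ f) (hf : MemLp f (ENNReal.ofReal p) σ) :
    eLpNorm (positiveOp 𝒟 Λ σ f) (ENNReal.ofReal q) ω ≤
      (parallelConst p q' * N * T + parallelConst q' p * N' * T') *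
        eLpNorm f (ENNReal.ofReal p) σ := by
  classical
  have hex : ∀ y : D, ∃ φ : StrongDual ℝ D, 0 ≤ φ ∧ ‖φ‖ ≤ 1 ∧ (0 ≤ y → φ y = ‖y‖) := by
    intro y
    by_cases hy : 0 ≤ y
    · obtain ⟨φ, h1, h2, h3⟩ := exists_nonneg_dual_vector hy
      exact ⟨φ, h1, h2, fun _ => h3⟩
    · exact ⟨0, le_rfl, by simp, fun h => (hy h).elim⟩
  choose ν hν0 hν1 hν using hex
  have key := mul_eLpNorm_indicatorSum_le hm hω hq (fun Q => Λ Q (∫ x in Q, f x ∂σ))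
    (NormedSpace.inclusionInDoubleDual ℝ D) (c := 1) (ν := ν) (fun _ => hν1 _)
    (fun x => by
      rw [one_mul]
      exact (hν _ (positiveOp_nonneg 𝒟 Λ hf0 x)).ge)
    (K := (parallelConst p q' * N * T + parallelConst q' p * N' * T') *
        eLpNorm f (ENNReal.ofReal p) σ)
    (fun G hG hGm hGmem => h.ofReal_sum_bilinear_le hm hσ hω hp hq hpq hT hT' hN hN' hNfin hNfin'
      hfm hf0 hf hGm (fun x => by
        obtain ⟨t, ht, e⟩ := hG x
        rw [e]
        exact smul_nonneg ht (hν0 _)) hGmem)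
  rw [ENNReal.ofReal_one, one_mul] at key
  exact key

end Bilinear

/-! ### Necessity of the testing conditions -/

section Necessity

variable {X : Type*} [MeasurableSpace X] {𝒟 : Finset (Set X)}
  {C D : Type*} [NormedAddCommGroup C] [NormedSpace ℝ C]
  [CompleteSpace C] [Lattice C] [HasSolidNorm C] [IsOrderedAddMonoid C] [IsOrderedModule ℝ C]
  [NormedAddCommGroup D] [NormedSpace ℝ D]
  [Lattice D] [HasSolidNorm D] [IsOrderedAddMonoid D] [IsOrderedModule ℝ D] {σ ω : Measure X}
  {Λ : Set X → C →ₚ[ℝ] D}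

theorem positiveOp_congr {f g : X → C} (h : ∀ Q ∈ 𝒟, f =ᵐ[σ.restrict Q] g) :
    positiveOp 𝒟 Λ σ f = positiveOp 𝒟 Λ σ g := by
  funext x
  exact Finset.sum_congr rfl fun Q hQ => by rw [integral_congr_ae (h Q hQ)]

theorem abs_positiveOp_le {𝒟' : Finset (Set X)} (h : 𝒟' ⊆ 𝒟) {f : X → C}
    (hf : ∀ Q ∈ 𝒟', IntegrableOn f Q σ) (x : X) :
    |positiveOp 𝒟' Λ σ f x| ≤ positiveOp 𝒟 Λ σ (fun y => |f y|) x := by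
  have h1 : ∀ Q ∈ 𝒟', |Q.indicator (fun _ => Λ Q (∫ y in Q, f y ∂σ)) x| ≤
      Q.indicator (fun _ => Λ Q (∫ y in Q, |f y| ∂σ)) x := by
    intro Q hQ
    by_cases hx : x ∈ Q
    · rw [Set.indicator_of_mem hx, Set.indicator_of_mem hx]
      exact ((Λ Q).abs_map_le _).trans
        (OrderHomClass.mono (Λ Q) (abs_integral_le_integral_abs (hf Q hQ)))
    · rw [Set.indicator_of_notMem hx, Set.indicator_of_notMem hx, abs_zero]
  have h2 : positiveOp 𝒟' Λ σ (fun y => |f y|) x ≤ positiveOp 𝒟 Λ σ (fun y => |f y|) x :=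
    Finset.sum_le_sum_of_subset_of_nonneg h fun Q _ _ => Set.indicator_nonneg
      (fun _ _ => map_nonneg (Λ Q) (integral_nonneg fun _ => abs_nonneg _)) x
  refine le_trans (abs_le'.2 ⟨?_, ?_⟩) h2
  · exact Finset.sum_le_sum fun Q hQ => (le_abs_self _).trans (h1 Q hQ)
  · rw [positiveOp, ← Finset.sum_neg_distrib]
    exact Finset.sum_le_sum fun Q hQ => (neg_le_abs _).trans (h1 Q hQ)

theorem eLpNorm_positiveOp_le_of_subset {𝒟' : Finset (Set X)} (h : 𝒟' ⊆ 𝒟)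
    (hσ : ∀ Q ∈ 𝒟, σ Q ≠ ∞) {p q : ℝ} (hp : 1 ≤ p) {K : ℝ≥0∞}
    (hK : ∀ f : X → C, MemLp f (ENNReal.ofReal p) σ →
      eLpNorm (positiveOp 𝒟 Λ σ f) (ENNReal.ofReal q) ω ≤ K * eLpNorm f (ENNReal.ofReal p) σ)
    {f : X → C} (hf : MemLp f (ENNReal.ofReal p) σ) :
    eLpNorm (positiveOp 𝒟' Λ σ f) (ENNReal.ofReal q) ω ≤ K * eLpNorm f (ENNReal.ofReal p) σ := by
  have h1 : eLpNorm (fun y => |f y|) (ENNReal.ofReal p) σ = eLpNorm f (ENNReal.ofReal p) σ :=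
    eLpNorm_congr_norm_ae (Filter.Eventually.of_forall fun x => norm_abs_eq_norm _)
  rw [← h1]
  refine le_trans (eLpNorm_mono_enorm fun x => ?_) (hK _ hf.abs)
  rw [← enorm_abs_eq]
  exact enorm_le_enorm_of_nonneg_of_le (abs_nonneg _) (abs_positiveOp_le h (fun Q hQ =>
    MemLp.integrableOn_of_measure_ne_top hp hf (hσ Q (h hQ))) x)

theorem eLpNorm_positiveOp_le_of_top {R : Set X} (hR : MeasurableSet R) (hσR : σ R ≠ ∞)
    (hm : ∀ Q ∈ 𝒟, MeasurableSet Q) (hsub : ∀ Q ∈ 𝒟, Q ⊆ R) {p q : ℝ} (hp : 1 ≤ p) {K : ℝ≥0∞}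
    (hK : ∀ f : X → C, MemLp f (ENNReal.ofReal p) σ →
      eLpNorm (positiveOp 𝒟 Λ σ f) (ENNReal.ofReal q) ω ≤ K * eLpNorm f (ENNReal.ofReal p) σ)
    {f : X → C} (hf : MemLp f ∞ (σ.restrict R)) :
    eLpNorm (positiveOp 𝒟 Λ σ f) (ENNReal.ofReal q) ω ≤
      K * eLpNorm f ∞ (σ.restrict R) * σ R ^ (1 / p) := by
  have hfin : IsFiniteMeasure (σ.restrict R) :=
    ⟨by rw [Measure.restrict_apply_univ]; exact hσR.lt_top⟩
  have e : positiveOp 𝒟 Λ σ f = positiveOp 𝒟 Λ σ (R.indicator f) := by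
    refine positiveOp_congr fun Q hQ => ?_
    filter_upwards [ae_restrict_mem (hm Q hQ)] with x hx
    rw [Set.indicator_of_mem (hsub Q hQ hx)]
  have hmem : MemLp (R.indicator f) (ENNReal.ofReal p) σ :=
    (memLp_indicator_iff_restrict hR).2 (hf.mono_exponent le_top)
  rw [e, mul_assoc]
  refine (hK _ hmem).trans ?_
  gcongr
  rw [eLpNorm_indicator_eq_eLpNorm_restrict hR]
  refine (eLpNorm_le_eLpNorm_mul_rpow_measure_univ le_top hf.1).trans_eq ?_
  rw [Measure.restrict_apply_univ, ENNReal.toReal_ofReal (by linarith), ENNReal.toReal_top, div_zero,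
    sub_zero]

/-- Boundedness of a positive operator implies the testing condition for its adjoint. The norm of
the adjoint is computed by duality; since a functional need not attain its norm, the norming
vectors are only approximate. -/
theorem eLpNorm_positiveOp_dualAdjoint_le_of_top {R : Set X} (hωR : ω R ≠ ∞)
    (hσ : ∀ Q ∈ 𝒟, σ Q ≠ ∞)
    (hm : ∀ Q ∈ 𝒟, MeasurableSet Q) (hsub : ∀ Q ∈ 𝒟, Q ⊆ R) {p p' q q' : ℝ}
    (hp : p.HolderConjugate p') (hq : q.HolderConjugate q') {K : ℝ≥0∞}
    (hK : ∀ f : X → C, MemLp f (ENNReal.ofReal p) σ →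
      eLpNorm (positiveOp 𝒟 Λ σ f) (ENNReal.ofReal q) ω ≤ K * eLpNorm f (ENNReal.ofReal p) σ)
    {g : X → StrongDual ℝ D} (hg : MemLp g ∞ (ω.restrict R)) :
    eLpNorm (positiveOp 𝒟 (fun Q => (Λ Q).dualAdjoint) ω g) (ENNReal.ofReal p') σ ≤
      K * eLpNorm g ∞ (ω.restrict R) * ω R ^ (1 / q') := by
  have hfin : IsFiniteMeasure (ω.restrict R) :=
    ⟨by rw [Measure.restrict_apply_univ]; exact hωR.lt_top⟩
  refine ENNReal.le_of_forall_lt_one_mul_le fun c hc => ?_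
  have hctop : c ≠ ∞ := (hc.trans ENNReal.one_lt_top).ne
  have hc1 : c.toReal < 1 := by
    rw [← ENNReal.toReal_one]
    exact (ENNReal.toReal_lt_toReal hctop ENNReal.one_ne_top).2 hc
  have hex : ∀ y : StrongDual ℝ C, ∃ z : C, ‖z‖ ≤ 1 ∧ c.toReal * ‖y‖ ≤ y z := by
    intro y
    rcases eq_or_ne y 0 with rfl | hy
    · exact ⟨0, by simp, by simp⟩
    obtain ⟨z, hz1, hz2⟩ := y.exists_lt_apply_of_lt_opNorm
      (mul_lt_of_lt_one_left (norm_pos_iff.2 hy) hc1)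
    rcases le_total 0 (y z) with h0 | h0
    · exact ⟨z, hz1.le, by rw [Real.norm_of_nonneg h0] at hz2; exact hz2.le⟩
    · refine ⟨-z, by rw [norm_neg]; exact hz1.le, ?_⟩
      rw [Real.norm_of_nonpos h0] at hz2
      rw [map_neg]
      exact hz2.le
  choose ν hν1 hν using hex
  rw [← ENNReal.ofReal_toReal hctop]
  refine mul_eLpNorm_indicatorSum_le hm hσ hp.symm
    (fun Q => (Λ Q).dualAdjoint (∫ x in Q, g x ∂ω)) (ContinuousLinearMap.id ℝ _) (ν := ν)
    (fun _ => hν1 _) (fun _ => hν _) fun f _ _ hf => ?_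
  have hrestr : ∀ Q ∈ 𝒟, (ω.restrict R).restrict Q = ω.restrict Q := fun Q hQ => by
    rw [Measure.restrict_restrict (hm Q hQ), Set.inter_eq_left.2 (hsub Q hQ)]
  have hgi : Integrable g (ω.restrict R) := hg.integrable le_top
  have h1 := ofReal_sum_setIntegral_apply_le (μ := ω.restrict R) hm
    (fun Q => Λ Q (∫ x in Q, f x ∂σ)) fun Q _ => hgi.integrableOn
  rw [Finset.sum_congr rfl fun Q hQ => by rw [hrestr Q hQ]] at h1
  refine h1.trans ?_
  change ∫⁻ x in R, ‖positiveOp 𝒟 Λ σ f x‖ₑ * ‖g x‖ₑ ∂ω ≤ _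
  have hSm : StronglyMeasurable (positiveOp 𝒟 Λ σ f) := stronglyMeasurable_positiveOp hm Λ f
  calc ∫⁻ x in R, ‖positiveOp 𝒟 Λ σ f x‖ₑ * ‖g x‖ₑ ∂ω
      ≤ ∫⁻ x in R, ‖positiveOp 𝒟 Λ σ f x‖ₑ * eLpNorm g ∞ (ω.restrict R) ∂ω := by
        refine lintegral_mono_ae ?_
        filter_upwards [ae_le_eLpNormEssSup (f := g) (μ := ω.restrict R)] with x hx
        rw [eLpNorm_exponent_top]
        gcongr
    _ = eLpNorm (positiveOp 𝒟 Λ σ f) 1 (ω.restrict R) * eLpNorm g ∞ (ω.restrict R) := by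
        rw [lintegral_mul_const _ hSm.enorm, eLpNorm_one_eq_lintegral_enorm]
    _ ≤ (eLpNorm (positiveOp 𝒟 Λ σ f) (ENNReal.ofReal q) ω * ω R ^ (1 / q')) *
          eLpNorm g ∞ (ω.restrict R) := by
        gcongr
        refine (eLpNorm_le_eLpNorm_mul_rpow_measure_univ (f := positiveOp 𝒟 Λ σ f)
          (q := ENNReal.ofReal q) (by simpa using hq.lt.le) hSm.aestronglyMeasurable).trans ?_
        rw [Measure.restrict_apply_univ, ENNReal.toReal_ofReal hq.nonneg, ENNReal.toReal_one,
          div_one, one_div, hq.one_sub_inv, ← one_div]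
        gcongr
        exact Measure.restrict_le_self
    _ ≤ (K * eLpNorm f (ENNReal.ofReal p) σ * ω R ^ (1 / q')) * eLpNorm g ∞ (ω.restrict R) := by
        gcongr
        exact hK f hf
    _ = _ := by ring

end Necessity

/-! ### Operators indexed by dyadic cubes -/

section Dyadic

variable {d : ℕ} {C D : Type*} [NormedAddCommGroup C] [NormedSpace ℝ C]
  [CompleteSpace C] [Lattice C] [HasSolidNorm C] [IsOrderedAddMonoid C] [IsOrderedModule ℝ C]
  [NormedAddCommGroup D] [NormedSpace ℝ D]
  [Lattice D] [HasSolidNorm D] [IsOrderedAddMonoid D] [IsOrderedModule ℝ D]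
  {μ ν : Measure (Fin d → ℝ)}

/-- A family of operators indexed by dyadic cubes, reindexed by the underlying sets. The value at a
set which is not a dyadic cube is irrelevant. -/
def DyadicCube.extendToSets (Λ : DyadicCube d → C →ₚ[ℝ] D) : Set (Fin d → ℝ) → C →ₚ[ℝ] D :=
  Function.extend DyadicCube.toSet Λ fun _ => Λ ⟨0, 0⟩

theorem DyadicCube.dualAdjoint_extendToSets (Λ : DyadicCube d → C →ₚ[ℝ] D) :
    (fun S => (extendToSets Λ S).dualAdjoint) = extendToSets fun Q => (Λ Q).dualAdjoint :=
  funext fun S => Function.apply_extend PositiveLinearMap.dualAdjoint _ _ S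

open Classical in
theorem dyadicOp_eq_positiveOp (hd : 0 < d) (𝒟 : Finset (DyadicCube d))
    (Λ : DyadicCube d → C →ₚ[ℝ] D) (f : (Fin d → ℝ) → C) :
    dyadicOp 𝒟 Λ μ f =
      positiveOp (𝒟.image DyadicCube.toSet) (DyadicCube.extendToSets Λ) μ f := by
  funext x
  rw [positiveOp, Finset.sum_image fun _ _ _ _ h => DyadicCube.toSet_injective hd h]
  refine Finset.sum_congr rfl fun Q _ => ?_
  rw [DyadicCube.extendToSets, (DyadicCube.toSet_injective hd).extend_apply]

open Classical in
theorem localizedOp_eq_positiveOp (hd : 0 < d) (𝒟 : Finset (DyadicCube d))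
    (Λ : DyadicCube d → C →ₚ[ℝ] D) (R : DyadicCube d) (f : (Fin d → ℝ) → C) :
    localizedOp 𝒟 Λ R μ f = positiveOp ((𝒟.image DyadicCube.toSet).filter (· ⊆ R.toSet))
      (DyadicCube.extendToSets Λ) μ f := by
  rw [localizedOp, dyadicOp_eq_positiveOp hd, Finset.filter_image]

theorem DyadicCube.isLaminar_image [DecidableEq (Set (Fin d → ℝ))] (𝒟 : Finset (DyadicCube d)) :
    IsLaminar (𝒟.image DyadicCube.toSet) := by
  intro S hS S' hS'
  obtain ⟨Q, -, rfl⟩ := Finset.mem_image.1 hS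
  obtain ⟨Q', -, rfl⟩ := Finset.mem_image.1 hS'
  exact Q.subset_or_subset_or_disjoint Q'

/-- The least testing constant is attained, also if it is infinite. -/
theorem eLpNorm_localizedOp_le_testingConst {p q : ℝ} (hp : 1 < p)
    [IsLocallyFiniteMeasure μ] {𝒟 : Finset (DyadicCube d)} (Λ : DyadicCube d → C →ₚ[ℝ] D)
    {R : DyadicCube d} (hR : R ∈ 𝒟) {f : (Fin d → ℝ) → C}
    (hf : MemLp f ∞ (μ.restrict R.toSet)) :
    eLpNorm (localizedOp 𝒟 Λ R μ f) (ENNReal.ofReal q) ν ≤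
      testingConst 𝒟 Λ p q μ ν * eLpNorm f ∞ (μ.restrict R.toSet) * μ R.toSet ^ (1 / p) := by
  classical
  have hp0 : 0 < 1 / p := by positivity
  set b := eLpNorm f ∞ (μ.restrict R.toSet) * μ R.toSet ^ (1 / p) with hb
  have hbtop : b ≠ ∞ := ENNReal.mul_ne_top hf.2.ne
    (ENNReal.rpow_ne_top_of_nonneg hp0.le (R.measure_toSet_ne_top μ))
  rw [mul_assoc, ← hb]
  rcases eq_or_ne b 0 with h0 | h0
  · have hz : f =ᵐ[μ.restrict R.toSet] 0 := by
      rcases mul_eq_zero.1 h0 with h1 | h1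
      · exact (eLpNorm_eq_zero_iff hf.1 (by simp)).1 h1
      · rw [Measure.restrict_eq_zero.2 ((ENNReal.rpow_eq_zero_iff_of_pos hp0).1 h1)]
        simp [Filter.EventuallyEq]
    have hT : localizedOp 𝒟 Λ R μ f = 0 := by
      funext x
      refine Finset.sum_eq_zero fun Q hQ => ?_
      have h1 : ∫ y in Q.toSet, f y ∂μ = 0 := integral_eq_zero_of_ae
        (ae_mono (Measure.restrict_mono_set μ (Finset.mem_filter.1 hQ).2) hz)
      simp [h1]
    rw [hT, eLpNorm_zero]
    exact zero_le
  · rw [← ENNReal.div_le_iff h0 hbtop]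
    refine le_sInf fun K hK => (ENNReal.div_le_iff h0 hbtop).2 ?_
    rw [hb, ← mul_assoc]
    exact hK R hR f hf

open Classical in
theorem positiveTesting_testingConst (hd : 0 < d) {p q : ℝ} (hp : 1 < p)
    [IsLocallyFiniteMeasure μ] (𝒟 : Finset (DyadicCube d)) (Λ : DyadicCube d → C →ₚ[ℝ] D) :
    PositiveTesting (𝒟.image DyadicCube.toSet) (DyadicCube.extendToSets Λ) p q μ ν
      (testingConst 𝒟 Λ p q μ ν) := by
  intro S hS φ _ hφ
  obtain ⟨R, hR, rfl⟩ := Finset.mem_image.1 hS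
  have := eLpNorm_localizedOp_le_testingConst (q := q) (ν := ν) hp Λ hR hφ
  rwa [localizedOp_eq_positiveOp hd] at this

theorem max_testingConst_le_operatorNorm (hd : 0 < d) [IsLocallyFiniteMeasure μ]
    [IsLocallyFiniteMeasure ν] {p p' q q' : ℝ} (hp : p.HolderConjugate p')
    (hq : q.HolderConjugate q') (𝒟 : Finset (DyadicCube d)) (Λ : DyadicCube d → C →ₚ[ℝ] D) :
    max (testingConst 𝒟 Λ p q μ ν) (testingConst 𝒟 (fun Q => (Λ Q).dualAdjoint) q' p' ν μ) ≤
      operatorNorm p q μ ν (dyadicOp 𝒟 Λ μ) := by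
  classical
  refine le_sInf fun K hK => ?_
  simp only [Set.mem_ofPred_eq, dyadicOp_eq_positiveOp hd] at hK
  have hm : ∀ S ∈ 𝒟.image DyadicCube.toSet, MeasurableSet S ∧ μ S ≠ ∞ := by
    intro S hS
    obtain ⟨Q, -, rfl⟩ := Finset.mem_image.1 hS
    exact ⟨Q.measurableSet_toSet, Q.measure_toSet_ne_top μ⟩
  have hKR : ∀ (R : DyadicCube d) (f : (Fin d → ℝ) → C), MemLp f (ENNReal.ofReal p) μ →
      eLpNorm (positiveOp ((𝒟.image DyadicCube.toSet).filter (· ⊆ R.toSet))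
        (DyadicCube.extendToSets Λ) μ f) (ENNReal.ofReal q) ν ≤
          K * eLpNorm f (ENNReal.ofReal p) μ := fun R f hf =>
    eLpNorm_positiveOp_le_of_subset (Finset.filter_subset _ _) (fun S hS => (hm S hS).2)
      hp.lt.le hK hf
  refine max_le (sInf_le fun R hR f hf => ?_) (sInf_le fun R hR g hg => ?_)
  · rw [localizedOp_eq_positiveOp hd]
    exact eLpNorm_positiveOp_le_of_top R.measurableSet_toSet (R.measure_toSet_ne_top μ)
      (fun S hS => (hm S (Finset.mem_filter.1 hS).1).1) (fun S hS => (Finset.mem_filter.1 hS).2)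
      hp.lt.le (hKR R) hf
  · rw [localizedOp_eq_positiveOp hd, ← DyadicCube.dualAdjoint_extendToSets]
    exact eLpNorm_positiveOp_dualAdjoint_le_of_top
      (R.measure_toSet_ne_top ν) (fun S hS => (hm S (Finset.mem_filter.1 hS).1).2)
      (fun S hS => (hm S (Finset.mem_filter.1 hS).1).1) (fun S hS => (Finset.mem_filter.1 hS).2)
      hp hq (hKR R) hg

/-- The upper bound of the operator norm by the testing constants, for arbitrary functions. -/
theorem operatorNorm_dyadicOp_le (hd : 0 < d) [IsLocallyFiniteMeasure μ]
    [IsLocallyFiniteMeasure ν] {p p' q q' : ℝ} (hp : p.HolderConjugate p')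
    (hq : q.HolderConjugate q') (hpq : p ≤ q) (hC : latticeMaximalNorm d C p < ∞)
    (hD : latticeMaximalNorm d (StrongDual ℝ D) q' < ∞) (𝒟 : Finset (DyadicCube d))
    (Λ : DyadicCube d → C →ₚ[ℝ] D) :
    operatorNorm p q μ ν (dyadicOp 𝒟 Λ μ) ≤
      parallelConst p q' * (4 * latticeMaximalNorm d C p) * testingConst 𝒟 Λ p q μ ν +
      parallelConst q' p * (4 * latticeMaximalNorm d (StrongDual ℝ D) q') *
        testingConst 𝒟 (fun Q => (Λ Q).dualAdjoint) q' p' ν μ := by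
  classical
  refine sInf_le fun f hf => ?_
  obtain ⟨g, hgm, hg0, hgf⟩ := exists_stronglyMeasurable_abs hf.1
  have hgnorm : eLpNorm g (ENNReal.ofReal p) μ = eLpNorm f (ENNReal.ofReal p) μ := by
    rw [← eLpNorm_congr_ae hgf]
    exact eLpNorm_congr_norm_ae (Filter.Eventually.of_forall fun x => norm_abs_eq_norm _)
  have hgmem : MemLp g (ENNReal.ofReal p) μ :=
    ⟨hgm.aestronglyMeasurable, by rw [hgnorm]; exact hf.2⟩
  have hm : ∀ S ∈ 𝒟.image DyadicCube.toSet, MeasurableSet S ∧ μ S ≠ ∞ ∧ ν S ≠ ∞ := by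
    intro S hS
    obtain ⟨Q, -, rfl⟩ := Finset.mem_image.1 hS
    exact ⟨Q.measurableSet_toSet, Q.measure_toSet_ne_top μ, Q.measure_toSet_ne_top ν⟩
  have hT' := positiveTesting_testingConst (μ := ν) (ν := μ) (q := p') hd hq.symm.lt 𝒟
    fun Q => (Λ Q).dualAdjoint
  rw [← DyadicCube.dualAdjoint_extendToSets] at hT'
  have key := (DyadicCube.isLaminar_image 𝒟).eLpNorm_positiveOp_le (fun S hS => (hm S hS).1)
    (fun S hS => (hm S hS).2.1) (fun S hS => (hm S hS).2.2) hp hq hpq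
    (positiveTesting_testingConst hd hp.lt 𝒟 Λ) hT'
    (maximalBound_latticeMaximalNorm hd hp.lt hC)
    (maximalBound_latticeMaximalNorm hd hq.symm.lt hD)
    (ENNReal.mul_ne_top (by simp) hC.ne) (ENNReal.mul_ne_top (by simp) hD.ne) hgm hg0 hgmem
  rw [hgnorm] at key
  refine le_trans (eLpNorm_mono_enorm fun x => ?_) key
  rw [dyadicOp_eq_positiveOp hd, ← positiveOp_congr fun Q _ => ae_restrict_of_ae hgf,
    ← enorm_abs_eq]
  exact enorm_le_enorm_of_nonneg_of_le (abs_nonneg _) (abs_positiveOp_le subset_rfl (fun Q hQ =>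
    MemLp.integrableOn_of_measure_ne_top hp.lt.le hf (hm Q hQ).2.1) x)

end Dyadic

end

theorem mainTheorem1 (p q : ℝ) (hp : 1 < p) (hpq : p ≤ q) :
    ∃ K : ℝ≥0, ∀ (d : ℕ) (_ : 0 < d)
      (C : Type*) [NormedAddCommGroup C] [NormedSpace ℝ C] [CompleteSpace C]
      [Lattice C] [HasSolidNorm C] [IsOrderedAddMonoid C] [IsOrderedModule ℝ C]
      (D : Type*) [NormedAddCommGroup D] [NormedSpace ℝ D] [CompleteSpace D]
      [Lattice D] [HasSolidNorm D] [IsOrderedAddMonoid D] [IsOrderedModule ℝ D]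
      (_ : HasDyadicHardyLittlewood d C)
      (_ : HasDyadicHardyLittlewood d (StrongDual ℝ D))
      (σ ω : Measure (Fin d → ℝ)) [IsLocallyFiniteMeasure σ] [IsLocallyFiniteMeasure ω]
      (𝒟 : Finset (DyadicCube d)) (Λ : DyadicCube d → C →ₚ[ℝ] D),
      latticeMaximalNorm d C p < ∞ ∧
      latticeMaximalNorm d (StrongDual ℝ D) q.conjExponent < ∞ ∧
      max (testingConst 𝒟 Λ p q σ ω)
          (testingConst 𝒟 (fun Q => (Λ Q).dualAdjoint) q.conjExponent p.conjExponent ω σ) ≤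
        operatorNorm p q σ ω (dyadicOp 𝒟 Λ σ) ∧
      operatorNorm p q σ ω (dyadicOp 𝒟 Λ σ) ≤
        K * (latticeMaximalNorm d C p * testingConst 𝒟 Λ p q σ ω +
          latticeMaximalNorm d (StrongDual ℝ D) q.conjExponent *
            testingConst 𝒟 (fun Q => (Λ Q).dualAdjoint) q.conjExponent p.conjExponent ω σ) := by
  have hp' := Real.HolderConjugate.conjExponent hp
  have hq' := Real.HolderConjugate.conjExponent (hp.trans_le hpq)
  have h1 := parallelConst_ne_top hp'.pos hq'.symm.pos
  have h2 := parallelConst_ne_top hq'.symm.pos hp'.pos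
  refine ⟨(4 * (parallelConst p q.conjExponent + parallelConst q.conjExponent p)).toNNReal, ?_⟩
  intro d hd C _ _ _ _ _ _ _ D _ _ _ _ _ _ _ hC hD σ ω _ _ 𝒟 Λ
  have hC' := latticeMaximalNorm_lt_top hd hC hp
  have hD' := latticeMaximalNorm_lt_top hd hD hq'.symm.lt
  refine ⟨hC', hD', max_testingConst_le_operatorNorm hd hp' hq' 𝒟 Λ,
    (operatorNorm_dyadicOp_le hd hp' hq' hpq hC' hD' 𝒟 Λ).trans ?_⟩
  rw [ENNReal.coe_toNNReal (ENNReal.mul_ne_top (by simp) (ENNReal.add_ne_top.2 ⟨h1, h2⟩)), mul_add]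
  refine add_le_add ?_ ?_
  · rw [← mul_assoc, ← mul_assoc, mul_comm _ 4]
    gcongr
    exact le_self_add
  · rw [← mul_assoc, ← mul_assoc, mul_comm _ 4]
    gcongr
    exact le_add_self
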